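/- Let $k\ge 1$, let $Q$ be a smooth $n$-dimensional manifold, let $T^rQ=J^r_0(\mathbb R,Q)$ be its $r$-th order tangent bundle, with natural coordinates $(q^i_0,\dots,q^i_r)$ (the derivatives at $0$, up to order $r$, of a curve written in a chart of $Q$), and let $z$ be the coordinate of the factor $\mathbb R$ in $T^rQ\times\mathbb R$. For $r\le s$ let $\tau^s_r\colon T^sQ\times\mathbb R\to T^rQ\times\mathbb R$ be the projection. Let $L\in C^\infty(T^kQ\times\mathbb R)$. For $r\ge k$ and a one-form $\xi$ on $T^rQ\times\mathbb R$ let $$D_L\xi=\mathcal L_\Gamma\big((\tau^{r+1}_r)^*\xi\big)-\frac{\partial L}{\partial z}\,(\tau^{r+1}_r)^*\xi ,$$ a one-form on $T^{r+1}Q\times\mathbb R$, where $\Gamma$ is any (local) holonomic vector field on $T^{r+1}Q\times\mathbb R$ with $dz(\Gamma)=L$, i.e. $\Gamma=\sum_{\alpha=0}^{r}q^i_{\alpha+1}\,\partial/\partial q^i_\alpha+X^i\,\partial/\partial q^i_{r+1}+L\,\partial/\partial z$ (the result does not depend on the choice of $\Gamma$). Let $J_\beta=\sum_{\alpha=0}^{k-\beta}\frac{(\beta+\alpha)!}{\alpha!}\,dq^i_\alpha\otimes\partial/\partial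 q^i_{\beta+\alpha}$ be the $\beta$-th vertical endomorphism of $T(T^kQ\times\mathbb R)$. Define on $T^{2k-1}Q\times\mathbb R$ the one-forms $$\theta_L=\sum_{\beta=1}^{k}(-1)^{\beta-1}\frac1{\beta!}\,D_L^{\beta-1}\big(dL\circ J_\beta\big),\qquad \eta_L=dz-\theta_L$$ (each summand being pulled back to $T^{2k-1}Q\times\mathbb R$). The form $\theta_L$ is semibasic over $T^{k-1}Q\times\mathbb R$; let $\widetilde{\mathcal F}_L\colon T^{2k-1}Q\times\mathbb R\to T^*(T^{k-1}Q\times\mathbb R)$ be the map over $\tau^{2k-1}_{k-1}$ determined by $(\theta_L)_p(u)=\langle T\tau^{2k-1}_{k-1}(u),\widetilde{\mathcal F}_L(p)\rangle$ for all $p$ and all $u\in T_p(T^{2k-1}Q\times\mathbb R)$. The generalized Legendre–Ostrogradskii map $\mathcal F_L\colon T^{2k-1}Q\times\mathbb R\to T^*(T^{k-1}Q)\times\mathbb R$ is the composition of $\widetilde{\mathcal F}_L$ with the canonical projection $T^*(T^{k-1}Q\times\mathbb R)\to T^*(T^{k-1}Q)\times\mathbb R$. Then the following conditions are equivalent: 1.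 $\mathcal F_L$ is a local diffeomorphism. 2. $(T^{2k-1}Q\times\mathbb R,\eta_L)$ is a $(2kn+1)$-dimensional contact manifold, i.e. $T^{2k-1}Q\times\mathbb R$ has dimension $2kn+1$ and $\eta_L$ is a smooth one-form such that $\eta_L\wedge(d\eta_L)^{\wedge kn}$ is a volume form (vanishes nowhere). 3. The Hessian matrix $\left(\dfrac{\partial^2L}{\partial q^i_k\,\partial q^j_k}\right)_{1\le i,j\le n}$ is nonsingular at every point of $T^kQ\times\mathbb R$, in all natural coordinates. -/

import Mathlib

open scoped Manifold ContDiff Topology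

noncomputable section

namespace HigherContact

/-- The model space `ℝⁿ`. -/
abbrev Euc (n : ℕ) := EuclideanSpace ℝ (Fin n)

/-- Smooth curves `ℝ → Q`. -/
abbrev Curve (n : ℕ) (Q : Type*) [TopologicalSpace Q] [ChartedSpace (Euc n) Q] :=
  C^∞⟮𝓘(ℝ, ℝ), ℝ; 𝓡 n, Q⟯

section Analysis

variable {E F : Type*} [NormedAddCommGroup E] [NormedSpace ℝ E]
  [NormedAddCommGroup F] [NormedSpace ℝ F]

/-- The polynomial curve with prescribed derivatives `q 0, …, q k` at `0`. -/
def taylorCurve {k : ℕ} (q : Fin (k + 1) → E) (t : ℝ) : E :=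
  ∑ α : Fin (k + 1), (t ^ (α : ℕ) / ((α : ℕ).factorial : ℝ)) • q α

theorem contDiff_taylorCurve {k : ℕ} :
    ContDiff ℝ ∞ (fun x : (Fin (k + 1) → E) × ℝ => taylorCurve x.1 x.2) := by
  unfold taylorCurve
  fun_prop

theorem iteratedDeriv_pow_div_smul (m : ℕ) (v : E) (α : ℕ) :
    iteratedDeriv α (fun t : ℝ => (t ^ m / (m.factorial : ℝ)) • v) 0 =
      if α = m then v else 0 := by
  rw [iteratedDeriv_smul_const (by fun_prop)]
  have : (fun t : ℝ => t ^ m / (m.factorial : ℝ)) = fun t => (m.factorial : ℝ)⁻¹ • t ^ m := by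
    funext t; simp [div_eq_inv_mul]
  simp only [this, iteratedDeriv_fun_const_smul_field, iteratedDeriv_fun_pow_zero]
  split_ifs with h1
  ·  simp [Nat.factorial_ne_zero]
  all_goals simp_all

theorem iteratedDeriv_taylorCurve {k : ℕ} (q : Fin (k + 1) → E) (α : Fin (k + 1)) :
    iteratedDeriv α (taylorCurve q) 0 = q α := by
  unfold taylorCurve
  rw [iteratedDeriv_fun_sum]
  · simp only [iteratedDeriv_pow_div_smul]
    simp [Fin.val_inj]
  · intro i _
    fun_prop

theorem taylorCurve_zero {k : ℕ} (q : Fin (k + 1) → E) : taylorCurve q 0 = q 0 := by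
  simpa using iteratedDeriv_taylorCurve q 0

/-- Derivatives of a composition up to order `k` only depend on those of the inner curve. -/
theorem iteratedDeriv_comp_congr {k : ℕ} {g : E → F} {f f' : ℝ → E}
    (hf : ContDiffAt ℝ ∞ f 0) (hf' : ContDiffAt ℝ ∞ f' 0) (hg : ContDiffAt ℝ ∞ g (f 0))
    (h : ∀ α ≤ k, iteratedDeriv α f 0 = iteratedDeriv α f' 0) :
    ∀ α ≤ k, iteratedDeriv α (g ∘ f) 0 = iteratedDeriv α (g ∘ f') 0 := by
  intro α hα
  have h0 : f 0 = f' 0 := by simpa using h 0 (Nat.zero_le _)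
  have h' : ∀ β ≤ k, iteratedFDeriv ℝ β f 0 = iteratedFDeriv ℝ β f' 0 := by
    intro β hβ
    ext
    rw [iteratedFDeriv_apply_eq_iteratedDeriv_mul_prod,
      iteratedFDeriv_apply_eq_iteratedDeriv_mul_prod, h β hβ]
  rw [iteratedDeriv_eq_iteratedFDeriv, iteratedDeriv_eq_iteratedFDeriv,
    iteratedFDeriv_comp hg hf (i := α) (by exact_mod_cast le_top),
    iteratedFDeriv_comp (h0 ▸ hg) hf' (i := α) (by exact_mod_cast le_top), ← h0]
  congr 1
  unfold FormalMultilinearSeries.taylorComp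
  refine Finset.sum_congr rfl fun c _ => ?_
  unfold FormalMultilinearSeries.compAlongOrderedFinpartition
  congr 1
  funext i
  exact h' _ ((c.partSize_le i).trans hα)

/-- Derivatives at a fixed time of a jointly smooth family of curves depend smoothly on the
parameter. -/
theorem contDiffOn_iteratedDeriv_param {G : E × ℝ → F} {U : Set (E × ℝ)} (hU : IsOpen U)
    (hG : ContDiffOn ℝ ∞ G U) (j : ℕ) :
    ContDiffOn ℝ ∞ (fun x : E × ℝ => iteratedDeriv j (fun t => G (x.1, t)) x.2) U := by
  induction j with
  | zero => simpa using hG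
  | succ j ih =>
    have h := (ih.fderiv_of_isOpen hU (m := ∞) (by simp)).clm_apply
      (contDiffOn_const (c := ((0 : E), (1 : ℝ))))
    refine h.congr fun x hx => ?_
    have hd : DifferentiableAt ℝ (fun x : E × ℝ => iteratedDeriv j (fun t => G (x.1, t)) x.2) x :=
      ((ih x hx).contDiffAt (hU.mem_nhds hx)).differentiableAt (by simp)
    rw [iteratedDeriv_succ]
    have h1 : HasDerivAt (fun t : ℝ => (x.1, t)) ((0 : E), (1 : ℝ)) x.2 :=
      (hasDerivAt_const x.2 x.1).prodMk (hasDerivAt_id x.2)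
    exact (hd.hasFDerivAt.comp_hasDerivAt x.2 h1).deriv

end Analysis

section Jets

variable (n k : ℕ) (Q : Type*) [TopologicalSpace Q] [ChartedSpace (Euc n) Q]

/-- The smooth maximal atlas of `Q`. -/
abbrev smoothCharts : Set (OpenPartialHomeomorph Q (Euc n)) :=
  IsManifold.maximalAtlas (𝓡 n) ∞ Q

/-- Two curves have the same `k`-jet at `0`: same point, and same derivatives up to order `k` in
every chart around it. -/
def jetSetoid : Setoid (Curve n Q) where
  r c d := c 0 = d 0 ∧ ∀ e ∈ smoothCharts n Q, c 0 ∈ e.source →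
    ∀ α ≤ k, iteratedDeriv α (e ∘ c) 0 = iteratedDeriv α (e ∘ d) 0
  iseqv :=
    { refl := fun _ => ⟨rfl, fun _ _ _ _ _ => rfl⟩
      symm := fun h => ⟨h.1.symm, fun e he hs α hα => (h.2 e he (h.1 ▸ hs) α hα).symm⟩
      trans := fun h h' => ⟨h.1.trans h'.1, fun e he hs α hα =>
        (h.2 e he hs α hα).trans (h'.2 e he (h.1 ▸ hs) α hα)⟩ }

/-- The `k`-th order tangent bundle `TᵏQ = J₀ᵏ(ℝ, Q)`. -/
def HTan : Type _ := Quotient (jetSetoid n k Q)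

variable {n Q}

/-- The `k`-jet at `0` of a curve. -/
def jet (c : Curve n Q) : HTan n k Q := Quotient.mk (jetSetoid n k Q) c

variable {k}

/-- The base point in `Q` of a jet. -/
def HTan.base (p : HTan n k Q) : Q :=
  Quotient.lift (s := jetSetoid n k Q) (fun c : Curve n Q => c 0) (fun _ _ h => h.1) p

/-- A curve representing a jet. -/
def HTan.rep (p : HTan n k Q) : Curve n Q := Quotient.out (s := jetSetoid n k Q) p

@[simp] theorem jet_rep (p : HTan n k Q) : jet k p.rep = p := Quotient.out_eq _

@[simp] theorem base_jet (c : Curve n Q) : (jet k c).base = c 0 := rfl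

@[simp] theorem rep_zero (p : HTan n k Q) : p.rep 0 = p.base := by
  conv_rhs => rw [← jet_rep p]
  rfl

theorem jet_eq_iff {c d : Curve n Q} : jet k c = jet k d ↔ c 0 = d 0 ∧
    ∀ e ∈ smoothCharts n Q, c 0 ∈ e.source →
    ∀ α ≤ k, iteratedDeriv α (e ∘ c) 0 = iteratedDeriv α (e ∘ d) 0 :=
  Quotient.eq (r := jetSetoid n k Q)

variable (k)

/-- The natural coordinates `(q₀, …, q_k)` of a jet in the chart `e` of `Q`. -/
def natCoord (e : OpenPartialHomeomorph Q (Euc n)) (p : HTan n k Q) : Fin (k + 1) → Euc n :=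
  fun α => iteratedDeriv α (e ∘ p.rep) 0

theorem natCoord_jet {e : OpenPartialHomeomorph Q (Euc n)} (he : e ∈ smoothCharts n Q)
    (c : Curve n Q) (hc : c 0 ∈ e.source) (α : Fin (k + 1)) :
    natCoord k e (jet k c) α = iteratedDeriv α (e ∘ c) 0 := by
  have h := jet_eq_iff.1 (jet_rep (jet k c))
  refine h.2 e he ?_ α (Nat.lt_succ_iff.1 α.2)
  rw [rep_zero]; exact hc

theorem contDiffAt_chart_comp {e : OpenPartialHomeomorph Q (Euc n)} (he : e ∈ smoothCharts n Q)
    (c : Curve n Q) (hc : c 0 ∈ e.source) : ContDiffAt ℝ ∞ (e ∘ c) 0 :=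
  contMDiffAt_iff_contDiffAt.1
    ((contMDiffAt_of_mem_maximalAtlas he hc).comp (0 : ℝ) (c.contMDiff 0))

theorem contDiffOn_chart_change [IsManifold (𝓡 n) ∞ Q] {e e' : OpenPartialHomeomorph Q (Euc n)}
    (he : e ∈ smoothCharts n Q) (he' : e' ∈ smoothCharts n Q) :
    ContDiffOn ℝ ∞ (e' ∘ e.symm) (e.target ∩ e.symm ⁻¹' e'.source) :=
  contMDiffOn_iff_contDiffOn.1 ((contMDiffOn_of_mem_maximalAtlas he').comp
    ((contMDiffOn_symm_of_mem_maximalAtlas he).mono Set.inter_subset_left) (fun _ h => h.2))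

/-- Two curves through the same point have the same `k`-jet as soon as their derivatives agree in
one chart. -/
theorem jet_eq_of_chart [IsManifold (𝓡 n) ∞ Q] {e : OpenPartialHomeomorph Q (Euc n)}
    (he : e ∈ smoothCharts n Q) {c d : Curve n Q} (hc : c 0 ∈ e.source) (hd : d 0 ∈ e.source)
    (h : ∀ α ≤ k, iteratedDeriv α (e ∘ c) 0 = iteratedDeriv α (e ∘ d) 0) :
    jet k c = jet k d := by
  have h0 : c 0 = d 0 := e.injOn hc hd (by simpa using h 0 (Nat.zero_le _))
  refine jet_eq_iff.2 ⟨h0, fun e' he' hc' => ?_⟩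
  have hm : e (c 0) ∈ e.target ∩ e.symm ⁻¹' e'.source :=
    ⟨e.map_source hc, by simpa [e.left_inv hc] using hc'⟩
  have hg : ContDiffAt ℝ ∞ (e' ∘ e.symm) ((e ∘ c) 0) :=
    (contDiffOn_chart_change he he').contDiffAt
      ((e.isOpen_inter_preimage_symm e'.open_source).mem_nhds hm)
  have key := iteratedDeriv_comp_congr (contDiffAt_chart_comp he c hc)
    (contDiffAt_chart_comp he d hd) hg h
  have hev : ∀ b : Curve n Q, b 0 ∈ e.source →
      (e' ∘ b) =ᶠ[𝓝 0] ((e' ∘ e.symm) ∘ (e ∘ b)) := by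
    intro b hb
    filter_upwards [b.contMDiff.continuous.continuousAt.preimage_mem_nhds
      (e.open_source.mem_nhds hb)] with t ht
    simp [e.left_inv ht]
  intro α hα
  rw [(hev c hc).iteratedDeriv_eq α, (hev d hd).iteratedDeriv_eq α]
  exact key α hα

/-- Every coordinate vector over the target of a chart is realized by a global smooth curve. -/
theorem exists_curve {e : OpenPartialHomeomorph Q (Euc n)} (he : e ∈ smoothCharts n Q)
    (q : Fin (k + 1) → Euc n) (hq : q 0 ∈ e.target) :
    ∃ c : Curve n Q, c 0 = e.symm (q 0) ∧ (e ∘ c) =ᶠ[𝓝 0] taylorCurve q := by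
  have hcont : ContDiff ℝ ∞ (taylorCurve q) :=
    contDiff_taylorCurve.comp (contDiff_const.prodMk contDiff_id)
  have hmem : taylorCurve q ⁻¹' e.target ∈ 𝓝 (0 : ℝ) :=
    hcont.continuous.continuousAt.preimage_mem_nhds
      (e.open_target.mem_nhds (by rwa [taylorCurve_zero]))
  obtain ⟨ε, hε, hball⟩ := Metric.mem_nhds_iff.1 hmem
  let f : ContDiffBump (0 : ℝ) := ⟨ε / 2, ε, by positivity, by linarith⟩
  have hσ : ∀ t : ℝ, taylorCurve q (f t * t) ∈ e.target := by
    intro t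
    apply hball
    rw [mem_ball_zero_iff, norm_mul, Real.norm_of_nonneg f.nonneg]
    by_cases ht : ‖t‖ < ε
    · exact (mul_le_of_le_one_left (norm_nonneg _) f.le_one).trans_lt ht
    · rw [f.zero_of_le_dist (by simpa [dist_zero_right] using not_lt.1 ht)]
      simpa using hε
  have hsm : ContMDiff 𝓘(ℝ, ℝ) (𝓡 n) ∞ fun t : ℝ => e.symm (taylorCurve q (f t * t)) := by
    have h1 : ContDiff ℝ ∞ fun t : ℝ => taylorCurve q (f t * t) :=
      hcont.comp ((f.contDiff (n := ⊤)).mul contDiff_id)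
    have h2 := (contMDiffOn_symm_of_mem_maximalAtlas he).comp (s := Set.univ)
      h1.contMDiff.contMDiffOn (fun t _ => hσ t)
    exact contMDiffOn_univ.1 h2
  refine ⟨⟨_, hsm⟩, ?_, ?_⟩
  · change e.symm (taylorCurve q (f 0 * 0)) = _
    rw [mul_zero, taylorCurve_zero]
  · filter_upwards [f.eventuallyEq_one] with t ht
    change e (e.symm (taylorCurve q (f t * t))) = _
    rw [e.right_inv (hσ t), ht]
    simp

open Classical in
/-- A jet with prescribed natural coordinates in the chart `e` (a constant jet if there is none). -/
def ofNatCoord (e : OpenPartialHomeomorph Q (Euc n)) (q : Fin (k + 1) → Euc n) : HTan n k Q :=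
  if h : ∃ c : Curve n Q, c 0 ∈ e.source ∧
      ∀ α : Fin (k + 1), iteratedDeriv α (e ∘ c) 0 = q α then
    jet k h.choose
  else jet k (ContMDiffMap.const (e.symm (q 0)))

theorem ofNatCoord_spec {e : OpenPartialHomeomorph Q (Euc n)} (he : e ∈ smoothCharts n Q)
    (q : Fin (k + 1) → Euc n) (hq : q 0 ∈ e.target) :
    ∃ c : Curve n Q, ofNatCoord k e q = jet k c ∧ c 0 ∈ e.source ∧
      ∀ α : Fin (k + 1), iteratedDeriv α (e ∘ c) 0 = q α := by
  have h : ∃ c : Curve n Q, c 0 ∈ e.source ∧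
      ∀ α : Fin (k + 1), iteratedDeriv α (e ∘ c) 0 = q α := by
    obtain ⟨c, h0, hc⟩ := exists_curve k he q hq
    refine ⟨c, h0 ▸ e.map_target hq, fun α => ?_⟩
    rw [hc.iteratedDeriv_eq, iteratedDeriv_taylorCurve]
  exact ⟨h.choose, by rw [ofNatCoord, dif_pos h], h.choose_spec⟩

/-- The natural chart of `TᵏQ` induced by a chart `e` of `Q`. -/
def natChart [IsManifold (𝓡 n) ∞ Q] (e : OpenPartialHomeomorph Q (Euc n))
    (he : e ∈ smoothCharts n Q) : PartialEquiv (HTan n k Q) (Fin (k + 1) → Euc n) where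
  toFun := natCoord k e
  invFun := ofNatCoord k e
  source := {p | p.base ∈ e.source}
  target := {q | q 0 ∈ e.target}
  map_source' p hp := by
    have : natCoord k e p 0 = e p.base := by simp [natCoord]
    simpa [this] using e.map_source hp
  map_target' q hq := by
    obtain ⟨c, h, h0, _⟩ := ofNatCoord_spec k he q hq
    simpa [h] using h0
  left_inv' p hp := by
    have h0 : natCoord k e p 0 = e p.base := by simp [natCoord]
    obtain ⟨c, h, hc, hα⟩ := ofNatCoord_spec k he (natCoord k e p)
      (by rw [h0]; exact e.map_source hp)
    rw [h]
    conv_rhs => rw [← jet_rep p]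
    refine jet_eq_of_chart k he hc (by simpa using hp) fun α hα' => ?_
    exact hα ⟨α, Nat.lt_succ_iff.2 hα'⟩
  right_inv' q hq := by
    obtain ⟨c, h, hc, hα⟩ := ofNatCoord_spec k he q hq
    rw [h]
    funext α
    rw [natCoord_jet k he c hc, hα]

variable [IsManifold (𝓡 n) ∞ Q]

theorem natChart_change_source {e e' : OpenPartialHomeomorph Q (Euc n)}
    (he : e ∈ smoothCharts n Q) (he' : e' ∈ smoothCharts n Q) :
    ((natChart k e he).symm.trans (natChart k e' he')).source =
      {q | q 0 ∈ e.target ∩ e.symm ⁻¹' e'.source} := by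
  ext q
  simp only [PartialEquiv.trans_source, PartialEquiv.symm_source, Set.mem_inter_iff,
    Set.mem_preimage, Set.mem_ofPred_eq]
  refine and_congr_right fun hq => ?_
  change (ofNatCoord k e q).base ∈ e'.source ↔ _
  obtain ⟨c, h, hc, hα⟩ := ofNatCoord_spec k he q hq
  have : e (c 0) = q 0 := by simpa using hα 0
  rw [h, ← this, e.left_inv hc]
  rfl

theorem isOpen_natChart_change_source {e e' : OpenPartialHomeomorph Q (Euc n)}
    (he : e ∈ smoothCharts n Q) (he' : e' ∈ smoothCharts n Q) :
    IsOpen ((natChart k e he).symm.trans (natChart k e' he')).source := by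
  rw [natChart_change_source]
  exact (e.isOpen_inter_preimage_symm e'.open_source).preimage (continuous_apply 0)

theorem contDiffOn_natChart_change {e e' : OpenPartialHomeomorph Q (Euc n)}
    (he : e ∈ smoothCharts n Q) (he' : e' ∈ smoothCharts n Q) :
    ContDiffOn ℝ ∞ ((natChart k e he).symm.trans (natChart k e' he'))
      ((natChart k e he).symm.trans (natChart k e' he')).source := by
  rw [natChart_change_source]
  have hWo : IsOpen (e.target ∩ e.symm ⁻¹' e'.source) := e.isOpen_inter_preimage_symm e'.open_source
  have hT : ContDiff ℝ ∞ (fun x : (Fin (k + 1) → Euc n) × ℝ => taylorCurve x.1 x.2) :=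
    contDiff_taylorCurve
  have hG := (contDiffOn_chart_change he he').comp
    (s := (fun x : (Fin (k + 1) → Euc n) × ℝ => taylorCurve x.1 x.2) ⁻¹'
      (e.target ∩ e.symm ⁻¹' e'.source)) hT.contDiffOn (fun _ h => h)
  have hU := hWo.preimage hT.continuous
  rw [contDiffOn_pi]
  intro α
  have h := (contDiffOn_iteratedDeriv_param hU hG α).comp
    (s := {q : Fin (k + 1) → Euc n | q 0 ∈ e.target ∩ e.symm ⁻¹' e'.source})
    ((contDiff_id.prodMk contDiff_const).contDiffOn :
      ContDiffOn ℝ ∞ (fun q : Fin (k + 1) → Euc n => (q, (0 : ℝ))) _)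
    (fun q hq => by simpa [taylorCurve_zero] using hq)
  refine h.congr fun q hq => ?_
  obtain ⟨c, hc, hs, hα⟩ := ofNatCoord_spec k he q hq.1
  change natCoord k e' (ofNatCoord k e q) α =
    iteratedDeriv α ((e' ∘ e.symm) ∘ taylorCurve q) 0
  have h0 : e (c 0) = q 0 := by simpa using hα 0
  have hs' : c 0 ∈ e'.source := by
    have := hq.2; rwa [Set.mem_preimage, ← h0, e.left_inv hs] at this
  rw [hc, natCoord_jet k he' c hs']
  have hev : (e' ∘ c) =ᶠ[𝓝 0] ((e' ∘ e.symm) ∘ (e ∘ c)) := by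
    filter_upwards [c.contMDiff.continuous.continuousAt.preimage_mem_nhds
      (e.open_source.mem_nhds hs)] with t ht
    simp [e.left_inv ht]
  rw [hev.iteratedDeriv_eq]
  refine iteratedDeriv_comp_congr (k := k) (contDiffAt_chart_comp he c hs)
    (hT.comp (contDiff_const.prodMk contDiff_id)).contDiffAt ?_ ?_ α (Nat.lt_succ_iff.1 α.2)
  · refine (contDiffOn_chart_change he he').contDiffAt (hWo.mem_nhds ?_)
    simpa [h0] using hq
  · intro β hβ
    have h1 := hα ⟨β, Nat.lt_succ_iff.2 hβ⟩
    have h2 := iteratedDeriv_taylorCurve q ⟨β, Nat.lt_succ_iff.2 hβ⟩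
    exact h1.trans h2.symm

variable (n Q)

/-- The atlas of natural charts of `TᵏQ`. -/
def htanCore : ChartedSpaceCore (Fin (k + 1) → Euc n) (HTan n k Q) where
  atlas := {f | ∃ e, ∃ he : e ∈ smoothCharts n Q, f = natChart k e he}
  chartAt p := natChart k (chartAt (Euc n) p.base) (IsManifold.chart_mem_maximalAtlas p.base)
  mem_chart_source p := mem_chart_source (Euc n) p.base
  chart_mem_atlas _ := ⟨_, _, rfl⟩
  open_source := by
    rintro _ _ ⟨e, he, rfl⟩ ⟨e', he', rfl⟩
    exact isOpen_natChart_change_source k he he'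
  continuousOn_toFun := by
    rintro _ _ ⟨e, he, rfl⟩ ⟨e', he', rfl⟩
    exact (contDiffOn_natChart_change k he he').continuousOn

instance : TopologicalSpace (HTan n k Q) := (htanCore n k Q).toTopologicalSpace

instance : ChartedSpace (Fin (k + 1) → Euc n) (HTan n k Q) := (htanCore n k Q).toChartedSpace

/-- The model with corners of `TᵏQ`. -/
abbrev jetModel : ModelWithCorners ℝ (Fin (k + 1) → Euc n) (Fin (k + 1) → Euc n) :=
  𝓘(ℝ, Fin (k + 1) → Euc n)

instance : IsManifold (jetModel n k) ∞ (HTan n k Q) := by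
  refine isManifold_of_contDiffOn _ _ _ ?_
  intro f f' hf hf'
  simp only [atlas, ChartedSpace.atlas] at hf hf'
  obtain ⟨_, hf⟩ := Set.mem_iUnion.1 hf
  obtain ⟨⟨e, he, rfl⟩, hf⟩ := Set.mem_iUnion.1 hf
  obtain ⟨_, hf'⟩ := Set.mem_iUnion.1 hf'
  obtain ⟨⟨e', he', rfl⟩, hf'⟩ := Set.mem_iUnion.1 hf'
  obtain rfl := Set.mem_singleton_iff.1 hf
  obtain rfl := Set.mem_singleton_iff.1 hf'
  have := contDiffOn_natChart_change k he he'
  simp only [modelWithCornersSelf_coe, modelWithCornersSelf_coe_symm, Function.id_comp,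
    Function.comp_id, Set.preimage_id, Set.range_id, Set.inter_univ]
  exact this

end Jets

section Forms

variable {E : Type*} [NormedAddCommGroup E] [NormedSpace ℝ E] {H : Type*} [TopologicalSpace H]
  (I : ModelWithCorners ℝ E H) {M : Type*} [TopologicalSpace M] [ChartedSpace H M]
  {E' : Type*} [NormedAddCommGroup E'] [NormedSpace ℝ E'] {H' : Type*} [TopologicalSpace H']
  (J : ModelWithCorners ℝ E' H') {N : Type*} [TopologicalSpace N] [ChartedSpace H' N]

/-- Fields of covectors on `M`. -/
abbrev OneForm (M : Type*) [TopologicalSpace M] [ChartedSpace H M] :=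
  ∀ p : M, TangentSpace I p →L[ℝ] ℝ

/-- The cotangent bundle `T*M`. -/
abbrev Cotangent (M : Type*) [TopologicalSpace M] [ChartedSpace H M] :=
  Bundle.TotalSpace (E →L[ℝ] ℝ) (fun p : M => TangentSpace I p →L[ℝ] Bundle.Trivial M ℝ p)

/-- The pullback `f^*ξ` of a one-form. -/
def pullbackForm (f : M → N) (ξ : OneForm J N) : OneForm I M :=
  fun p => (ξ (f p)).comp (mfderiv I J f p)

/-- The differential `df` of a function. -/
def dFun (f : M → ℝ) : OneForm I M := fun p => mfderiv I 𝓘(ℝ, ℝ) f p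

/-- The expression of a one-form in the chart at `p`. -/
def chartExpr (ξ : OneForm I M) (p : M) : OneForm 𝓘(ℝ, E) E :=
  pullbackForm 𝓘(ℝ, E) I (extChartAt I p).symm ξ

/-- The exterior derivative `dξ` of a one-form on a manifold without boundary, computed at `p` in
the chart at `p`. -/
def extD (ξ : OneForm I M) (p : M) : TangentSpace I p [⋀^Fin 2]→L[ℝ] ℝ :=
  (extDeriv (fun y : E => ContinuousAlternatingMap.ofSubsingleton ℝ E ℝ (0 : Fin 1)
      (chartExpr I ξ p y : E →L[ℝ] ℝ)) (extChartAt I p p)).compContinuousLinearMap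
    (mfderiv I 𝓘(ℝ, E) (extChartAt I p) p)

/-- The contraction `i(v)ξ = ξ(v, ·)` of a two-covector with a vector. -/
def contract {V : Type*} [NormedAddCommGroup V] [NormedSpace ℝ V] (ξ : V [⋀^Fin 2]→L[ℝ] ℝ)
    (v : V) : V →L[ℝ] ℝ :=
  (ContinuousAlternatingMap.ofSubsingleton ℝ V ℝ (0 : Fin 1)).symm (ξ.curryLeft v)

/-- The value `(η ∧ ξ ∧ ⋯ ∧ ξ)(v₀, …, v_{2m})` of the wedge product of a covector `η` with `m`
copies of a two-covector `ξ`. -/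
def wedgePow {V : Type*} [AddCommGroup V] [Module ℝ V] [TopologicalSpace V] (η : V →L[ℝ] ℝ)
    (ξ : V [⋀^Fin 2]→L[ℝ] ℝ) (m : ℕ) (v : Fin (2 * m + 1) → V) : ℝ :=
  (1 / 2 ^ m : ℝ) * ∑ σ : Equiv.Perm (Fin (2 * m + 1)), ((Equiv.Perm.sign σ : ℤ) : ℝ) *
    (η (v (σ 0)) * ∏ i : Fin m,
      ξ ![v (σ ⟨2 * (i : ℕ) + 1, by omega⟩), v (σ ⟨2 * (i : ℕ) + 2, by omega⟩)])

/-- `(M, η)` is a `(2m+1)`-dimensional contact manifold: `η` is a smooth one-form such that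
`η ∧ (dη)^m` is a volume form. -/
structure IsContactManifold [IsManifold I 1 M] (m : ℕ) (η : OneForm I M) : Prop where
  finrank_eq : Module.finrank ℝ E = 2 * m + 1
  smooth : ContMDiff I (I.prod 𝓘(ℝ, E →L[ℝ] ℝ)) ∞ (fun p => (⟨p, η p⟩ : Cotangent I M))
  volume : ∀ p : M, ∃ v : Fin (2 * m + 1) → TangentSpace I p, wedgePow (η p) (extD I η p) m v ≠ 0

end Forms

section Lagrangian

variable {n : ℕ} {Q : Type*} [TopologicalSpace Q] [ChartedSpace (Euc n) Q]

/-- The projection `TˢQ → TʳQ`, `r ≤ s`. -/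
def proj {r s : ℕ} (h : r ≤ s) : HTan n s Q → HTan n r Q :=
  Quotient.map (sa := jetSetoid n s Q) (sb := jetSetoid n r Q) id
    fun _ _ hcd => ⟨hcd.1, fun e he hs α hα => hcd.2 e he hs α (hα.trans h)⟩

/-- The projection `TˢQ × ℝ → TʳQ × ℝ`, `r ≤ s`. -/
def extProj {r s : ℕ} (h : r ≤ s) : HTan n s Q × ℝ → HTan n r Q × ℝ := Prod.map (proj h) id

/-- The canonical lifting `t ↦ jʳ(s ↦ c (s + t))` of a curve to `TʳQ`. -/
def canonicalLift (r : ℕ) (c : Curve n Q) (t : ℝ) : HTan n r Q :=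
  jet r (c.comp ⟨fun s : ℝ => s + t, (contDiff_id.add contDiff_const).contMDiff⟩)

variable [IsManifold (𝓡 n) ∞ Q]

/-- The model with corners of `TʳQ × ℝ`. -/
abbrev extModel (n r : ℕ) := (jetModel n r).prod 𝓘(ℝ, ℝ)

/-- The canonical injection `T^{r+1}Q → T(TʳQ)`, sending the jet of a curve to the velocity at `0`
of its canonical lifting to `TʳQ`. -/
def canonicalInj {r : ℕ} (p : HTan n (r + 1) Q) :
    TangentSpace (jetModel n r) (proj r.le_succ p) :=
  mfderiv 𝓘(ℝ, ℝ) (jetModel n r) (canonicalLift r p.rep) 0 (1 : ℝ)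

/-- The vector field `(q₁, …, q_{r+1}, L)` along `T^{r+1}Q × ℝ → TʳQ × ℝ`: the common projection of
all holonomic vector fields `Γ` on `T^{r+1}Q × ℝ` with `dz(Γ) = L`. -/
def holonomicVec {k r : ℕ} (L : HTan n k Q × ℝ → ℝ) (h : k ≤ r) (p : HTan n (r + 1) Q × ℝ) :
    TangentSpace (extModel n r) (extProj r.le_succ p) :=
  (canonicalInj p.1, L (extProj (h.trans r.le_succ) p))

/-- The function `∂L/∂z` on `TˢQ × ℝ`. -/
def lagDz {k s : ℕ} (L : HTan n k Q × ℝ → ℝ) (h : k ≤ s) (p : HTan n s Q × ℝ) : ℝ :=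
  deriv (fun z : ℝ => L (proj h p.1, z)) p.2

/-- The derivation `d_L` on one-forms: `d_L ξ` is the Lie derivative of `τ^*ξ` along any holonomic
`Γ` with `dz(Γ) = L`, written with Cartan's formula `i(Γ) d + d i(Γ)`. -/
def lagDeriv {k r : ℕ} (L : HTan n k Q × ℝ → ℝ) (h : k ≤ r) (ξ : OneForm (extModel n r) (HTan n r Q × ℝ)) :
    OneForm (extModel n (r + 1)) (HTan n (r + 1) Q × ℝ) := fun p =>
  (contract (V := (Fin (r + 1) → Euc n) × ℝ) (extD (extModel n r) ξ (extProj r.le_succ p))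
      (holonomicVec L h p)).comp
    (mfderiv (extModel n (r + 1)) (extModel n r) (extProj r.le_succ) p) +
  dFun (extModel n (r + 1))
    (fun q : HTan n (r + 1) Q × ℝ => ξ (extProj r.le_succ q) (holonomicVec L h q)) p

/-- The Lagrangian total derivative `D_L ξ = d_L ξ - (∂L/∂z) τ^*ξ` on one-forms. -/
def DL {k r : ℕ} (L : HTan n k Q × ℝ → ℝ) (h : k ≤ r) (ξ : OneForm (extModel n r) (HTan n r Q × ℝ)) :
    OneForm (extModel n (r + 1)) (HTan n (r + 1) Q × ℝ) := fun p =>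
  lagDeriv L h ξ p - lagDz L (h.trans r.le_succ) p •
    pullbackForm (extModel n (r + 1)) (extModel n r) (extProj r.le_succ) ξ p

/-- The iterates `D_Lᵐ`, from one-forms on `TᵏQ × ℝ` to one-forms on `T^{k+m}Q × ℝ`. -/
def DLiter {k : ℕ} (L : HTan n k Q × ℝ → ℝ) (ξ : OneForm (extModel n k) (HTan n k Q × ℝ)) :
    (m : ℕ) → OneForm (extModel n (k + m)) (HTan n (k + m) Q × ℝ)
  | 0 => ξ
  | m + 1 => DL L (Nat.le_add_right k m) (DLiter L ξ m)

/-- The `β`-th vertical endomorphism in natural coordinates,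
`(v₀, …, v_k, w) ↦ (0, …, 0, (β!/0!) v₀, …, (k!/(k-β)!) v_{k-β}, 0)`. -/
def vertCoord (n k β : ℕ) :
    ((Fin (k + 1) → Euc n) × ℝ) →L[ℝ] ((Fin (k + 1) → Euc n) × ℝ) :=
  (ContinuousLinearMap.inl ℝ (Fin (k + 1) → Euc n) ℝ).comp
    ((ContinuousLinearMap.pi fun α : Fin (k + 1) =>
      if β ≤ (α : ℕ) then
        (((α : ℕ).factorial : ℝ) / (((α : ℕ) - β).factorial : ℝ)) •
          ContinuousLinearMap.proj (R := ℝ) (φ := fun _ : Fin (k + 1) => Euc n)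
            ⟨(α : ℕ) - β, (Nat.sub_le _ _).trans_lt α.2⟩
      else 0).comp
      (ContinuousLinearMap.fst ℝ (Fin (k + 1) → Euc n) ℝ))

/-- The `β`-th vertical endomorphism of `T(TᵏQ × ℝ)`, given by `vertCoord` in natural charts. -/
def vertEndo (k β : ℕ) (p : HTan n k Q × ℝ) :
    TangentSpace (extModel n k) p →L[ℝ] TangentSpace (extModel n k) p :=
  (mfderiv 𝓘(ℝ, (Fin (k + 1) → Euc n) × ℝ) (extModel n k) (extChartAt (extModel n k) p).symm
      (extChartAt (extModel n k) p p)).comp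
    ((vertCoord n k β).comp
      (mfderiv (extModel n k) 𝓘(ℝ, (Fin (k + 1) → Euc n) × ℝ) (extChartAt (extModel n k) p) p))

/-- The Cartan one-form
`θ_L = ∑_{β=1}^k (-1)^{β-1} (1/β!) D_L^{β-1} i(J_β) dL` on `T^{2k-1}Q × ℝ` (with `β = m + 1`). -/
def cartanForm {k : ℕ} (L : HTan n k Q × ℝ → ℝ) :
    OneForm (extModel n (2 * k - 1)) (HTan n (2 * k - 1) Q × ℝ) := fun p =>
  ∑ m : Fin k, ((-1 : ℝ) ^ (m : ℕ) / (((m : ℕ) + 1).factorial : ℝ)) •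
    pullbackForm (extModel n (2 * k - 1)) (extModel n (k + m))
      (extProj (show k + (m : ℕ) ≤ 2 * k - 1 by omega))
      (DLiter L (fun q => (dFun (extModel n k) L q).comp (vertEndo k (m + 1) q)) m) p

/-- The contact Lagrangian form `η_L = dz - θ_L`. -/
def contactForm {k : ℕ} (L : HTan n k Q × ℝ → ℝ) :
    OneForm (extModel n (2 * k - 1)) (HTan n (2 * k - 1) Q × ℝ) := fun p =>
  dFun (extModel n (2 * k - 1)) Prod.snd p - cartanForm L p

/-- The extended Legendre–Ostrogradskii map `T^{2k-1}Q × ℝ → T*(T^{k-1}Q × ℝ)`, whose value over `p`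
is the covector `λ` at the projection of `p` with `θ_L(p)(u) = λ(Tτ u)` for all `u`. -/
def extLegendre {k : ℕ} (L : HTan n k Q × ℝ → ℝ) (p : HTan n (2 * k - 1) Q × ℝ) :
    Cotangent (extModel n (k - 1)) (HTan n (k - 1) Q × ℝ) :=
  have h : k - 1 ≤ 2 * k - 1 := Nat.sub_le_sub_right (Nat.le_mul_of_pos_left k two_pos) 1
  ⟨extProj h p, Classical.epsilon fun l :
      TangentSpace (extModel n (k - 1)) (extProj h p) →L[ℝ] ℝ =>
    ∀ u, cartanForm L p u =
      l (mfderiv (extModel n (2 * k - 1)) (extModel n (k - 1)) (extProj h) p u)⟩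

/-- The canonical projection `T*(TʳQ × ℝ) → T*(TʳQ) × ℝ`. -/
def cotangentProj {r : ℕ} (x : Cotangent (extModel n r) (HTan n r Q × ℝ)) :
    Cotangent (jetModel n r) (HTan n r Q) × ℝ :=
  (⟨x.proj.1, x.snd.comp (ContinuousLinearMap.inl ℝ (Fin (r + 1) → Euc n) ℝ)⟩, x.proj.2)

/-- The model with corners of `T*(TʳQ) × ℝ`. -/
abbrev cotModel (n r : ℕ) :=
  ((jetModel n r).prod 𝓘(ℝ, (Fin (r + 1) → Euc n) →L[ℝ] ℝ)).prod 𝓘(ℝ, ℝ)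

/-- The generalized Legendre map `T^{2k-1}Q × ℝ → T*(T^{k-1}Q) × ℝ`. -/
def legendre {k : ℕ} (L : HTan n k Q × ℝ → ℝ) (p : HTan n (2 * k - 1) Q × ℝ) :
    Cotangent (jetModel n (k - 1)) (HTan n (k - 1) Q) × ℝ :=
  cotangentProj (extLegendre L p)

/-- The Hessian matrix `∂²L/∂q_kⁱ∂q_kʲ` at the point of natural coordinates `(q, z)` in the chart `e`
of `Q`. -/
def hessian {k : ℕ} (L : HTan n k Q × ℝ → ℝ) (e : OpenPartialHomeomorph Q (Euc n))
    (q : Fin (k + 1) → Euc n) (z : ℝ) : Matrix (Fin n) (Fin n) ℝ :=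
  Matrix.of fun i j => fderiv ℝ (fun w : Euc n =>
      fderiv ℝ (fun v : Euc n => L (ofNatCoord k e (Function.update q (Fin.last k) v), z)) w
        (EuclideanSpace.single j 1))
    (q (Fin.last k)) (EuclideanSpace.single i 1)

end Lagrangian

end HigherContact

end

open HigherContact

/-! All three conditions are local, so the argument runs in natural coordinates `(q_0, …, q_r, z)`,
where `D_L` acts on components by a simple recursion. For `ξ = ∑ ξ_a dq_a` the component of `D_L ξ`
along `q_a` is `D_L ξ_a + ξ_{a-1}`, and no `dz`-component ever appears (`flatDL_cv`, `flatDL_dz`).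
Hence `θ_L = ∑_{a<k} θ_a dq_a`: it is semibasic over the coordinates of order below `k`.

The core of the proof is the triangular structure of the momenta (`hasTop_flatTheta`): `θ_a` depends
on `q_b` only for `b ≤ 2k-1-a`, and `∂θ_a/∂q_{2k-1-a} = (-1)^{k-1-a} W`, where `W` is the Hessian of
`L` in `q_k`. This rests on the commutation rule `∂(D_L f)/∂q_b = ∂f/∂q_{b-1}`, valid for `b` above
both `k` and the order of `f` (`HasTop.flatD`). By Pascal's rule the top coefficient of `D_L^m (dL ∘
J_β)` is then a binomial coefficient times `k!/(k-β)!`, and the alternating sum over `β` collapses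
to a sign by a Beta integral (`sum_leadCoeff`).

The equivalence is proved as a cycle.

1 ⇒ 2: in coordinates the Legendre map is `(q_0, …, q_{k-1}, θ_0, …, θ_{k-1}, z)`. If its
differential is injective, then the `dq_a`, `dθ_a` and `dz` are independent. Since `η_L = dz - ∑ θ_a
dq_a` and `dη_L = ∑ dq_a ∧ dθ_a`, the form `η_L ∧ (dη_L)^{kn}` does not vanish
(`exists_wedgePow_ne_zero`).

2 ⇒ 3: if `W w = 0`, the vector `w ∂/∂q_{2k-1}` is killed by `η_L`, which has no
`dq_{2k-1}`-component, and by `dη_L`, because only `θ_0` can involve `q_{2k-1}`, with derivative `±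
W`. A volume form leaves no such vector but zero (`eq_zero_of_wedgePow_ne_zero`).

3 ⇒ 1: with `W` invertible, the triangular structure determines a kernel vector of the differential
successively to be zero in `q_k, …, q_{2k-1}`, and the inverse function theorem applies.

Passing between manifold and coordinates needs `d` to be chart independent (`extD_apply`), Cartan's
formula to reduce to the coordinate formula for `D_L` (`DL_apply`), and the vertical endomorphisms,
defined through preferred charts, to commute with jet prolongations of chart changes
(`fderiv_jetTrans_vertCoord`). -/

noncomputable section

set_option linter.unusedSectionVars false
set_option linter.unusedSimpArgs false

namespace HigherContact

/-! ### Jet coordinates, the coordinate form of `D_L`, and top-order dependence. -/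

section FlatJets

variable {E : Type*} [NormedAddCommGroup E] [NormedSpace ℝ E]

/-- Coordinates `(q₀, …, q_r, z)` on `TʳE × ℝ`. -/
abbrev JetSp (E : Type*) (r : ℕ) := (Fin (r + 1) → E) × ℝ

/-- The projection `(q₀, …, q_s, z) ↦ (q₀, …, q_r, z)`. -/
def trunc {r s : ℕ} (h : r ≤ s) : JetSp E s →L[ℝ] JetSp E r :=
  ((ContinuousLinearMap.pi fun α : Fin (r + 1) =>
    ContinuousLinearMap.proj (R := ℝ) (φ := fun _ : Fin (s + 1) => E)
      (Fin.castLE (Nat.succ_le_succ h) α)).comp (ContinuousLinearMap.fst ℝ _ ℝ)).prod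
    (ContinuousLinearMap.snd ℝ _ ℝ)

/-- The inclusion of the `a`-th coordinate space into `TʳE × ℝ` (zero if `r < a`). -/
def cv (E : Type*) [NormedAddCommGroup E] [NormedSpace ℝ E] (r a : ℕ) : E →L[ℝ] JetSp E r :=
  (ContinuousLinearMap.inl ℝ (Fin (r + 1) → E) ℝ).comp
    (ContinuousLinearMap.pi fun α : Fin (r + 1) =>
      if (α : ℕ) = a then ContinuousLinearMap.id ℝ E else 0)

theorem cv_apply (r a : ℕ) (v : E) :
    cv E r a v = (fun α : Fin (r + 1) => if (α : ℕ) = a then v else 0, 0) := by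
  ext α
  · by_cases h : (α : ℕ) = a <;> simp [cv, h]
  · simp [cv]

theorem trunc_apply {r s : ℕ} (h : r ≤ s) (y : JetSp E s) :
    trunc h y = (fun α : Fin (r + 1) => y.1 (Fin.castLE (Nat.succ_le_succ h) α), y.2) := rfl

@[simp] theorem trunc_cv {r s : ℕ} (h : r ≤ s) (a : ℕ) (v : E) :
    trunc h (cv E s a v) = cv E r a v := by
  simp [cv_apply, trunc_apply]

@[simp] theorem trunc_trunc {r s t : ℕ} (h : r ≤ s) (h' : s ≤ t) (y : JetSp E t) :
    trunc h (trunc h' y) = trunc (h.trans h') y := rfl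

/-- Because out-of-range indices give zero, statements about `∂/∂q_b` need no bound on `b`, and
functions of order `k` are automatically constant along `q_b` for `b > k`. -/
theorem cv_of_lt {r a : ℕ} (h : r < a) : cv E r a = 0 := by
  ext v α
  · have : (α : ℕ) ≠ a := by omega
    simp [cv_apply, this]
  · simp [cv_apply]

theorem eq_sum_cv {r : ℕ} (y : JetSp E r) :
    y = ∑ α : Fin (r + 1), cv E r α (y.1 α) + ((0 : Fin (r + 1) → E), y.2) := by
  ext α
  · simp only [Prod.fst_add, Prod.fst_sum, Finset.sum_apply, cv_apply, add_zero, Pi.add_apply,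
      Pi.zero_apply, Fin.val_inj]
    simp
  · simp [Prod.snd_sum, cv_apply]

theorem ext_cv {F : Type*} [NormedAddCommGroup F] [NormedSpace ℝ F] {r : ℕ}
    {A B : JetSp E r →L[ℝ] F} (h : ∀ a ≤ r, ∀ v, A (cv E r a v) = B (cv E r a v))
    (hz : A (0, 1) = B (0, 1)) : A = B := by
  refine ContinuousLinearMap.ext fun y => ?_
  have hz' : ((0 : Fin (r + 1) → E), y.2) = y.2 • ((0 : Fin (r + 1) → E), (1 : ℝ)) := by simp
  rw [eq_sum_cv y, hz', map_add, map_add, map_sum, map_sum, map_smul, map_smul, hz]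
  congr 1
  exact Finset.sum_congr rfl fun α _ => h _ (Nat.lt_succ_iff.1 α.2) _

/-- The shift `(q₀, …, q_{r+1}, z) ↦ (q₁, …, q_{r+1})`. -/
def shift (E : Type*) [NormedAddCommGroup E] [NormedSpace ℝ E] (r : ℕ) :
    JetSp E (r + 1) →L[ℝ] (Fin (r + 1) → E) :=
  (ContinuousLinearMap.pi fun α : Fin (r + 1) =>
    ContinuousLinearMap.proj (R := ℝ) (φ := fun _ : Fin (r + 1 + 1) => E) α.succ).comp
    (ContinuousLinearMap.fst ℝ _ ℝ)

theorem shift_apply (r : ℕ) (y : JetSp E (r + 1)) (α : Fin (r + 1)) :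
    shift E r y α = y.1 α.succ := rfl

theorem shift_cv_zero (r : ℕ) (v : E) : shift E r (cv E (r + 1) 0 v) = 0 := by
  ext α; simp [shift_apply, cv_apply]

theorem shift_cv_succ (r a : ℕ) (v : E) :
    shift E r (cv E (r + 1) (a + 1) v) = (cv E r a v).1 := by
  ext α; simp [shift_apply, cv_apply]

variable (V : Set E)

/-- The part of `TʳE × ℝ` over `V`. -/
def dom (r : ℕ) : Set (JetSp E r) := {y | y.1 0 ∈ V}

variable {V}

theorem isOpen_dom (hV : IsOpen V) (r : ℕ) : IsOpen (dom V r) :=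
  hV.preimage ((continuous_apply 0).comp continuous_fst)

theorem trunc_mem_dom {r s : ℕ} (h : r ≤ s) {y : JetSp E s} :
    trunc h y ∈ dom V r ↔ y ∈ dom V s := Iff.rfl

theorem mapsTo_trunc {r s : ℕ} (h : r ≤ s) : Set.MapsTo (trunc h) (dom V s) (dom V r) :=
  fun _ hy => hy

theorem contDiffOn_trunc {r s : ℕ} (h : r ≤ s) (t : Set (JetSp E s)) :
    ContDiffOn ℝ ∞ (trunc (E := E) h) t :=
  (trunc (E := E) h).contDiff.contDiffOn

theorem hasFDerivAt_trunc {r s : ℕ} (h : r ≤ s) (y : JetSp E s) :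
    HasFDerivAt (trunc (E := E) h) (trunc h) y :=
  (trunc (E := E) h).hasFDerivAt

variable {k : ℕ}

/-- The coordinate expression of the holonomic vector fields `Γ` with `dz(Γ) = ℓ`. -/
def flatHol (ℓ : JetSp E k → ℝ) {r : ℕ} (h : k ≤ r) (y : JetSp E (r + 1)) : JetSp E r :=
  (shift E r y, ℓ (trunc (h.trans r.le_succ) y))

theorem contDiffOn_flatHol {ℓ : JetSp E k → ℝ} (hℓ : ContDiffOn ℝ ∞ ℓ (dom V k)) {r : ℕ}
    (h : k ≤ r) : ContDiffOn ℝ ∞ (flatHol ℓ h) (dom V (r + 1)) :=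
  (shift E r).contDiff.contDiffOn.prodMk
    (hℓ.comp (contDiffOn_trunc _ _) (mapsTo_trunc _))

theorem fderiv_comp_trunc {F : Type*} [NormedAddCommGroup F] [NormedSpace ℝ F] {r s : ℕ}
    (h : r ≤ s) {f : JetSp E r → F} {y : JetSp E s} (hf : DifferentiableAt ℝ f (trunc h y)) :
    fderiv ℝ (fun y => f (trunc h y)) y = (fderiv ℝ f (trunc h y)).comp (trunc h) :=
  (hf.hasFDerivAt.comp y (hasFDerivAt_trunc h _)).fderiv

theorem differentiableAt_of_dom {F : Type*} [NormedAddCommGroup F] [NormedSpace ℝ F] {r : ℕ}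
    (hV : IsOpen V) {f : JetSp E r → F} (hf : ContDiffOn ℝ ∞ f (dom V r)) {y : JetSp E r}
    (hy : y ∈ dom V r) : DifferentiableAt ℝ f y :=
  (hf.contDiffAt ((isOpen_dom hV r).mem_nhds hy)).differentiableAt (by simp)

theorem contDiffOn_fderiv {F : Type*} [NormedAddCommGroup F] [NormedSpace ℝ F] {r : ℕ}
    (hV : IsOpen V) {f : JetSp E r → F} (hf : ContDiffOn ℝ ∞ f (dom V r)) :
    ContDiffOn ℝ ∞ (fderiv ℝ f) (dom V r) :=
  hf.fderiv_of_isOpen (isOpen_dom hV r) (by simp)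

theorem fderiv_flatHol (hV : IsOpen V) {ℓ : JetSp E k → ℝ} (hℓ : ContDiffOn ℝ ∞ ℓ (dom V k))
    {r : ℕ} (h : k ≤ r) {y : JetSp E (r + 1)} (hy : y ∈ dom V (r + 1)) :
    fderiv ℝ (flatHol ℓ h) y = (shift E r).prod
      ((fderiv ℝ ℓ (trunc (h.trans r.le_succ) y)).comp (trunc (h.trans r.le_succ))) :=
  ((shift E r).hasFDerivAt.prodMk (((differentiableAt_of_dom hV hℓ
    ((trunc_mem_dom (h.trans r.le_succ)).2 hy)).hasFDerivAt).comp y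
      (hasFDerivAt_trunc (h.trans r.le_succ) _))).fderiv

/-- The coordinate expression of `D_L` on one-forms. -/
def flatDL (ℓ : JetSp E k → ℝ) {r : ℕ} (h : k ≤ r) (ξ : JetSp E r → JetSp E r →L[ℝ] ℝ)
    (y : JetSp E (r + 1)) : JetSp E (r + 1) →L[ℝ] ℝ :=
  (fderiv ℝ ξ (trunc r.le_succ y) (flatHol ℓ h y)).comp (trunc r.le_succ) +
    (ξ (trunc r.le_succ y)).comp (fderiv ℝ (flatHol ℓ h) y) -
    fderiv ℝ ℓ (trunc (h.trans r.le_succ) y) (0, 1) • (ξ (trunc r.le_succ y)).comp (trunc r.le_succ)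

/-- The coordinate expression of `D_L` on functions. -/
def flatD (ℓ : JetSp E k → ℝ) {r : ℕ} (h : k ≤ r) (f : JetSp E r → ℝ)
    (y : JetSp E (r + 1)) : ℝ :=
  fderiv ℝ f (trunc r.le_succ y) (flatHol ℓ h y) -
    fderiv ℝ ℓ (trunc (h.trans r.le_succ) y) (0, 1) * f (trunc r.le_succ y)

theorem contDiffOn_flatDL (hV : IsOpen V) {ℓ : JetSp E k → ℝ} (hℓ : ContDiffOn ℝ ∞ ℓ (dom V k))
    {r : ℕ} (h : k ≤ r) {ξ : JetSp E r → JetSp E r →L[ℝ] ℝ} (hξ : ContDiffOn ℝ ∞ ξ (dom V r)) :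
    ContDiffOn ℝ ∞ (flatDL ℓ h ξ) (dom V (r + 1)) := by
  have hX := contDiffOn_flatHol hℓ h
  have hξτ := hξ.comp (contDiffOn_trunc r.le_succ _) (mapsTo_trunc (E := E) (V := V) r.le_succ)
  have hdξτ := (contDiffOn_fderiv hV hξ).comp (contDiffOn_trunc r.le_succ _)
    (mapsTo_trunc (E := E) (V := V) r.le_succ)
  have hdℓ := (contDiffOn_fderiv hV hℓ).comp (contDiffOn_trunc (h.trans r.le_succ) _)
    (mapsTo_trunc (E := E) (V := V) (h.trans r.le_succ))
  refine ContDiffOn.sub (ContDiffOn.add ?_ ?_) ?_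
  · exact (hdξτ.clm_apply hX).clm_comp contDiffOn_const
  · exact hξτ.clm_comp (contDiffOn_fderiv hV hX)
  · exact (hdℓ.clm_apply contDiffOn_const).smul (hξτ.clm_comp contDiffOn_const)

/-- The component of `D_L ξ` along `q_a`, for a form without `dz`-component. -/
theorem flatDL_cv (hV : IsOpen V) {ℓ : JetSp E k → ℝ} (hℓ : ContDiffOn ℝ ∞ ℓ (dom V k))
    {r : ℕ} (h : k ≤ r) {ξ : JetSp E r → JetSp E r →L[ℝ] ℝ} (hξ : ContDiffOn ℝ ∞ ξ (dom V r))
    (hz : ∀ y ∈ dom V r, ξ y (0, 1) = 0) {y : JetSp E (r + 1)} (hy : y ∈ dom V (r + 1)) (a : ℕ)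
    (v : E) :
    flatDL ℓ h ξ y (cv E (r + 1) a v) = flatD ℓ h (fun x => ξ x (cv E r a v)) y +
      (if a = 0 then 0 else ξ (trunc r.le_succ y) (cv E r (a - 1) v)) := by
  have hy' : trunc r.le_succ y ∈ dom V r := hy
  have hz' : ∀ t : ℝ, ξ (trunc r.le_succ y) (0, t) = 0 := fun t => by
    have : ((0 : Fin (r + 1) → E), t) = t • ((0 : Fin (r + 1) → E), (1 : ℝ)) := by simp
    rw [this, map_smul, hz _ hy', smul_zero]
  have h1 : fderiv ℝ (fun x => ξ x (cv E r a v)) (trunc r.le_succ y) (flatHol ℓ h y) =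
      fderiv ℝ ξ (trunc r.le_succ y) (flatHol ℓ h y) (cv E r a v) := by
    rw [fderiv_clm_apply (differentiableAt_of_dom hV hξ hy') (differentiableAt_const _)]
    simp
  -- The differential of `Γ` sends `∂/∂q_a` to `∂/∂q_{a-1}` plus a multiple of `∂/∂z`; the latter is
  -- invisible to `ξ`. For `a = 0` only the invisible part remains.
  have h2 : ξ (trunc r.le_succ y) (fderiv ℝ (flatHol ℓ h) y (cv E (r + 1) a v)) =
      if a = 0 then 0 else ξ (trunc r.le_succ y) (cv E r (a - 1) v) := by
    rw [fderiv_flatHol hV hℓ h hy]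
    rcases a with _ | a
    · simp [shift_cv_zero, hz']
    · have : ∀ (u : Fin (r + 1) → E) (t : ℝ), (u, t) = (u, 0) + (0, t) := by intros; simp
      rw [if_neg (by omega)]
      simp only [ContinuousLinearMap.prod_apply, shift_cv_succ]
      rw [this, map_add, hz', add_zero]
      rfl
  simp only [flatDL, flatD, sub_apply, add_apply,
    ContinuousLinearMap.comp_apply, smul_apply, trunc_cv, h1, h2, smul_eq_mul]
  ring

/-- `L_Γ(ξ_a dq_a) = Γ(ξ_a) dq_a + ξ_a dq_{a+1}` contains no `dz`; a `dz` could only come from `ξ_z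
dL` or `Γ(ξ_z) dz`, and `ξ_z = 0`. -/
theorem flatDL_dz (hV : IsOpen V) {ℓ : JetSp E k → ℝ} (hℓ : ContDiffOn ℝ ∞ ℓ (dom V k))
    {r : ℕ} (h : k ≤ r) {ξ : JetSp E r → JetSp E r →L[ℝ] ℝ} (hξ : ContDiffOn ℝ ∞ ξ (dom V r))
    (hz : ∀ y ∈ dom V r, ξ y (0, 1) = 0) {y : JetSp E (r + 1)} (hy : y ∈ dom V (r + 1)) :
    flatDL ℓ h ξ y (0, 1) = 0 := by
  have hy' : trunc r.le_succ y ∈ dom V r := hy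
  have hz' : ∀ t : ℝ, ξ (trunc r.le_succ y) (0, t) = 0 := fun t => by
    have : ((0 : Fin (r + 1) → E), t) = t • ((0 : Fin (r + 1) → E), (1 : ℝ)) := by simp
    rw [this, map_smul, hz _ hy', smul_zero]
  have ht : trunc r.le_succ ((0, 1) : JetSp E (r + 1)) = (0, 1) := rfl
  have h1 : fderiv ℝ ξ (trunc r.le_succ y) (flatHol ℓ h y) (0, 1) = 0 := by
    have h3 : (fun x => ξ x (0, 1)) =ᶠ[𝓝 (trunc r.le_succ y)] fun _ => 0 := by
      filter_upwards [(isOpen_dom hV r).mem_nhds hy'] with x hx using hz x hx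
    have h4 := h3.fderiv_eq (𝕜 := ℝ)
    rw [fderiv_clm_apply (differentiableAt_of_dom hV hξ hy') (differentiableAt_const _)] at h4
    simpa using congrArg (fun A => A (flatHol ℓ h y)) h4
  have h2 : shift E r ((0, 1) : JetSp E (r + 1)) = 0 := by ext; simp [shift_apply]
  simp [flatDL, ht, h1, hz', fderiv_flatHol hV hℓ h hy, h2]

/-- The top Hessian `∂²ℓ/∂q_k∂q_k`. -/
def topHess (ℓ : JetSp E k → ℝ) (x : JetSp E k) (w v : E) : ℝ :=
  fderiv ℝ (fun x => fderiv ℝ ℓ x (cv E k k v)) x (cv E k k w)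

variable (V) in
/-- `f` does not depend on `q_b` for `b > s`, and its derivative along `q_s` is `c` times the top
Hessian of `ℓ` contracted with `v`. -/
def HasTop (ℓ : JetSp E k → ℝ) (v : E) {r : ℕ} (h : k ≤ r) (s : ℕ) (c : ℝ)
    (f : JetSp E r → ℝ) : Prop :=
  ContDiffOn ℝ ∞ f (dom V r) ∧ ∀ y ∈ dom V r, ∀ (b : ℕ) (w : E),
    (s < b → fderiv ℝ f y (cv E r b w) = 0) ∧
    (b = s → fderiv ℝ f y (cv E r b w) = c * topHess ℓ (trunc h y) w v)

theorem contDiffOn_flatD (hV : IsOpen V) {ℓ : JetSp E k → ℝ} (hℓ : ContDiffOn ℝ ∞ ℓ (dom V k))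
    {r : ℕ} (h : k ≤ r) {f : JetSp E r → ℝ} (hf : ContDiffOn ℝ ∞ f (dom V r)) :
    ContDiffOn ℝ ∞ (flatD ℓ h f) (dom V (r + 1)) := by
  have hτ := fun {s : ℕ} (h : s ≤ r + 1) => (trunc (E := E) h).contDiff.contDiffOn (n := ∞)
    (s := dom V (r + 1))
  exact (((contDiffOn_fderiv hV hf).comp (hτ _) (mapsTo_trunc r.le_succ)).clm_apply
    (contDiffOn_flatHol hℓ h)).sub
    ((((contDiffOn_fderiv hV hℓ).comp (hτ _) (mapsTo_trunc _)).clm_apply contDiffOn_const).mul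
      (hf.comp (hτ _) (mapsTo_trunc r.le_succ)))

theorem fderiv_fderiv_swap {F : Type*} [NormedAddCommGroup F] [NormedSpace ℝ F]
    {G : Type*} [NormedAddCommGroup G] [NormedSpace ℝ G] {f : G → F} {x : G}
    (hf : ContDiffAt ℝ ∞ f x) (u w : G) :
    fderiv ℝ (fderiv ℝ f) x u w = fderiv ℝ (fun y => fderiv ℝ f y u) x w := by
  have hd : DifferentiableAt ℝ (fderiv ℝ f) x :=
    (hf.fderiv_right (m := 1) (by norm_cast)).differentiableAt (by simp)
  rw [fderiv_clm_apply hd (differentiableAt_const _)]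
  have := (hf.isSymmSndFDerivAt (by
    simp only [minSmoothness_of_isRCLikeNormedField]
    exact ENat.LEInfty.out)).eq u w
  simp [this]

/-- Differentiating `D_L f` along `q_b` gives `D_L(∂f/∂q_b) + ∂f/∂q_{b-1}` plus terms containing a
derivative of `L` along `q_b`. For `b > s ≥ k` the last terms vanish because `L` has order `k`, and
the first because `f` does not involve `q_b`. What is left, `∂f/∂q_{b-1}`, raises the top index by
one and keeps its coefficient. -/
theorem HasTop.flatD (hV : IsOpen V) {ℓ : JetSp E k → ℝ} (hℓ : ContDiffOn ℝ ∞ ℓ (dom V k)) {v : E}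
    {r : ℕ} {h : k ≤ r} {s : ℕ} (hs : k ≤ s) {c : ℝ} {f : JetSp E r → ℝ}
    (hf : HasTop V ℓ v h s c f) :
    HasTop V ℓ v (h.trans r.le_succ) (s + 1) c (flatD ℓ h f) := by
  refine ⟨contDiffOn_flatD hV hℓ h hf.1, fun y hy b w => ?_⟩
  suffices H : s < b → fderiv ℝ (HigherContact.flatD ℓ h f) y (cv E (r + 1) b w) =
      fderiv ℝ f (trunc r.le_succ y) (cv E r (b - 1) w) by
    have hy' : trunc r.le_succ y ∈ dom V r := hy
    constructor
    · intro hb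
      rw [H (by omega)]
      exact (hf.2 _ hy' (b - 1) w).1 (by omega)
    · intro hb
      rw [H (by omega)]
      exact (hf.2 _ hy' (b - 1) w).2 (by omega)
  intro hb
  obtain ⟨b, rfl⟩ : ∃ b', b = b' + 1 := ⟨b - 1, by omega⟩
  have hy' : trunc r.le_succ y ∈ dom V r := hy
  have hyk : trunc (h.trans r.le_succ) y ∈ dom V k := hy
  have hfd := contDiffOn_fderiv hV hf.1
  have hℓd := contDiffOn_fderiv hV hℓ
  have hd1 : HasFDerivAt (fun y => fderiv ℝ f (trunc r.le_succ y))
      ((fderiv ℝ (fderiv ℝ f) (trunc r.le_succ y)).comp (trunc r.le_succ)) y :=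
    (differentiableAt_of_dom hV hfd hy').hasFDerivAt.comp y (hasFDerivAt_trunc r.le_succ _)
  have hd2 : HasFDerivAt (flatHol ℓ h) (fderiv ℝ (flatHol ℓ h) y) y :=
    (differentiableAt_of_dom hV (contDiffOn_flatHol hℓ h) hy).hasFDerivAt
  have hd3 : HasFDerivAt (fun y => fderiv ℝ ℓ (trunc (h.trans r.le_succ) y))
      ((fderiv ℝ (fderiv ℝ ℓ) (trunc (h.trans r.le_succ) y)).comp (trunc (h.trans r.le_succ))) y :=
    (differentiableAt_of_dom hV hℓd hyk).hasFDerivAt.comp y (hasFDerivAt_trunc _ _)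
  have hd4 : HasFDerivAt (fun y => f (trunc r.le_succ y))
      ((fderiv ℝ f (trunc r.le_succ y)).comp (trunc r.le_succ)) y :=
    (differentiableAt_of_dom hV hf.1 hy').hasFDerivAt.comp y (hasFDerivAt_trunc r.le_succ _)
  have hD := (hd1.clm_apply hd2).sub
    ((hd3.clm_apply (hasFDerivAt_const ((0, 1) : JetSp E k) y)).mul hd4)
  have hk0 : cv E k (b + 1) w = 0 := by rw [cv_of_lt (by omega)]; simp
  -- By symmetry of second derivatives this is the derivative along `Γ` of `∂f/∂q_{b+1}`, which
  -- vanishes on an open set.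
  have hsym : fderiv ℝ (fderiv ℝ f) (trunc r.le_succ y) (cv E r (b + 1) w) (flatHol ℓ h y) = 0 := by
    rw [fderiv_fderiv_swap (hf.1.contDiffAt ((isOpen_dom hV r).mem_nhds hy'))]
    have h3 : (fun x => fderiv ℝ f x (cv E r (b + 1) w)) =ᶠ[𝓝 (trunc r.le_succ y)] fun _ => 0 := by
      filter_upwards [(isOpen_dom hV r).mem_nhds hy'] with x hx using (hf.2 x hx _ w).1 hb
    rw [h3.fderiv_eq]; simp
  have hspl : ((cv E r b w).1, (0 : ℝ)) = cv E r b w := rfl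
  have := congrArg (fun A => A (cv E (r + 1) (b + 1) w)) hD.fderiv
  refine this.trans ?_
  simp only [sub_apply, add_apply,
    ContinuousLinearMap.comp_apply, smul_apply, trunc_cv,
    ContinuousLinearMap.flip_apply, fderiv_flatHol hV hℓ h hy, ContinuousLinearMap.prod_apply,
    shift_cv_succ, hk0, map_zero, zero_apply, hsym, hspl, smul_eq_mul,
    (hf.2 _ hy' (b + 1) w).1 hb, Nat.add_sub_cancel]
  simp

theorem HasTop.congr (hV : IsOpen V) {ℓ : JetSp E k → ℝ} {v : E} {r : ℕ} {h : k ≤ r} {s : ℕ} {c : ℝ}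
    {f g : JetSp E r → ℝ} (hf : HasTop V ℓ v h s c f) (hfg : Set.EqOn g f (dom V r)) :
    HasTop V ℓ v h s c g := by
  refine ⟨hf.1.congr hfg, fun y hy b w => ?_⟩
  rw [(hfg.eventuallyEq_of_mem ((isOpen_dom hV r).mem_nhds hy)).fderiv_eq]
  exact hf.2 y hy b w

theorem HasTop.zero {ℓ : JetSp E k → ℝ} {v : E} {r : ℕ} {h : k ≤ r} {s : ℕ} :
    HasTop V ℓ v h s 0 (fun _ => 0) :=
  ⟨contDiffOn_const, fun y _ b w => by simp⟩

theorem HasTop.add (hV : IsOpen V) {ℓ : JetSp E k → ℝ} {v : E} {r : ℕ} {h : k ≤ r} {s : ℕ}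
    {c d : ℝ} {f g : JetSp E r → ℝ} (hf : HasTop V ℓ v h s c f) (hg : HasTop V ℓ v h s d g) :
    HasTop V ℓ v h s (c + d) (fun y => f y + g y) := by
  refine ⟨hf.1.add hg.1, fun y hy b w => ?_⟩
  rw [fderiv_fun_add (differentiableAt_of_dom hV hf.1 hy) (differentiableAt_of_dom hV hg.1 hy)]
  constructor
  · intro hb
    simp [(hf.2 y hy b w).1 hb, (hg.2 y hy b w).1 hb]
  · intro hb
    simp [(hf.2 y hy b w).2 hb, (hg.2 y hy b w).2 hb, add_mul]

theorem HasTop.const_mul (hV : IsOpen V) {ℓ : JetSp E k → ℝ} {v : E} {r : ℕ} {h : k ≤ r} {s : ℕ}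
    {c : ℝ} {f : JetSp E r → ℝ} (hf : HasTop V ℓ v h s c f) (d : ℝ) :
    HasTop V ℓ v h s (d * c) (fun y => d * f y) := by
  refine ⟨contDiffOn_const.mul hf.1, fun y hy b w => ?_⟩
  rw [fderiv_const_mul (differentiableAt_of_dom hV hf.1 hy)]
  constructor
  · intro hb
    simp [(hf.2 y hy b w).1 hb]
  · intro hb
    simp [(hf.2 y hy b w).2 hb, mul_assoc]

theorem HasTop.sum (hV : IsOpen V) {ℓ : JetSp E k → ℝ} {v : E} {r : ℕ} {h : k ≤ r} {s : ℕ}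
    {ι : Type*} (t : Finset ι) {c : ι → ℝ} {f : ι → JetSp E r → ℝ}
    (hf : ∀ i ∈ t, HasTop V ℓ v h s (c i) (f i)) :
    HasTop V ℓ v h s (∑ i ∈ t, c i) (fun y => ∑ i ∈ t, f i y) := by
  classical
  induction t using Finset.induction_on with
  | empty => simpa using HasTop.zero
  | insert i t hi ih =>
    simp only [Finset.sum_insert hi]
    exact (hf i (Finset.mem_insert_self _ _)).add hV
      (ih fun j hj => hf j (Finset.mem_insert_of_mem hj))

theorem HasTop.comp_trunc (hV : IsOpen V) {ℓ : JetSp E k → ℝ} {v : E} {r r' : ℕ} {h : k ≤ r}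
    {s : ℕ} {c : ℝ} {f : JetSp E r → ℝ} (hf : HasTop V ℓ v h s c f) (hr : r ≤ r') :
    HasTop V ℓ v (h.trans hr) s c (fun y => f (trunc hr y)) := by
  refine ⟨hf.1.comp (contDiffOn_trunc hr _) (mapsTo_trunc hr), fun y hy b w => ?_⟩
  have hy' : trunc hr y ∈ dom V r := hy
  rw [fderiv_comp_trunc hr (differentiableAt_of_dom hV hf.1 hy')]
  simpa using hf.2 _ hy' b w

end FlatJets

/-! ### The Cartan form in coordinates and the leading coefficients of its momenta. -/

section FlatCartan

variable {n k : ℕ} {V : Set (Euc n)}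

theorem vertCoord_cv (β a : ℕ) (v : Euc n) :
    vertCoord n k β (cv (Euc n) k a v) =
      (((a + β).factorial : ℝ) / (a.factorial : ℝ)) • cv (Euc n) k (a + β) v := by
  ext α i
  · by_cases h : β ≤ (α : ℕ)
    · by_cases h' : (α : ℕ) = a + β
      · have h2 : (α : ℕ) - β = a := by omega
        simp [vertCoord, cv_apply, h, h2, h']
      · have h2 : (α : ℕ) - β ≠ a := by omega
        simp [vertCoord, cv_apply, h, h2, h']
    · have h' : (α : ℕ) ≠ a + β := by omega
      simp [vertCoord, cv_apply, h, h']
  · simp [vertCoord, cv_apply]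

theorem vertCoord_dz (β : ℕ) (t : ℝ) : vertCoord n k β (0, t) = 0 := by
  ext α i
  · by_cases h : β ≤ (α : ℕ) <;> simp [vertCoord, h]
  · simp [vertCoord]

/-- The iterates of `flatDL`. -/
def flatDLiter (ℓ : JetSp (Euc n) k → ℝ) (ξ : JetSp (Euc n) k → JetSp (Euc n) k →L[ℝ] ℝ) :
    (m : ℕ) → JetSp (Euc n) (k + m) → JetSp (Euc n) (k + m) →L[ℝ] ℝ
  | 0 => ξ
  | m + 1 => flatDL ℓ (Nat.le_add_right k m) (flatDLiter ℓ ξ m)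

/-- The coordinate expression of `i(J_β) dℓ`. -/
def vertForm (ℓ : JetSp (Euc n) k → ℝ) (β : ℕ) (x : JetSp (Euc n) k) :
    JetSp (Euc n) k →L[ℝ] ℝ :=
  (fderiv ℝ ℓ x).comp (vertCoord n k β)

/-- The leading coefficient of the component along `q_a` of `D_L^m (i(J_β) dL)`. -/
def leadCoeff (k β m a : ℕ) : ℝ :=
  if k ≤ a + β then (m.choose (a + β - k) : ℝ) * ((k.factorial : ℝ) / ((k - β).factorial : ℝ))
  else 0

/-- Pascal's rule, matching the recursion `(D_L ξ)_a = D_L ξ_a + ξ_{a-1}`. -/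
theorem leadCoeff_succ {k β m a : ℕ} (ha : a ≠ 0) :
    leadCoeff k β (m + 1) a = leadCoeff k β m a + leadCoeff k β m (a - 1) := by
  obtain ⟨a, rfl⟩ : ∃ b, a = b + 1 := ⟨a - 1, by omega⟩
  unfold leadCoeff
  rw [Nat.add_sub_cancel]
  by_cases h : k ≤ a + β
  · rw [if_pos (by omega), if_pos (by omega), if_pos h]
    have : a + 1 + β - k = (a + β - k) + 1 := by omega
    rw [this, Nat.choose_succ_succ]
    push_cast
    ring
  · rw [if_neg h, add_zero]
    split_ifs with h'
    · have : a + 1 + β - k = 0 := by omega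
      simp [this]
    · rfl

/-- The component along `q_0` receives nothing from a lower index. Since `β ≤ k`, the coefficient is
nonzero only for `β = k`, where the binomial is `m.choose 0 = 1` for every `m`. -/
theorem leadCoeff_zero {k β m : ℕ} (hβ : β ≤ k) : leadCoeff k β (m + 1) 0 = leadCoeff k β m 0 := by
  unfold leadCoeff
  split_ifs with h
  · have : 0 + β - k = 0 := by omega
    simp only [this, Nat.choose_zero_right]
  · rfl

theorem leadCoeff_of_lt {k β m a : ℕ} (h : k + m < a + β) : leadCoeff k β m a = 0 := by
  unfold leadCoeff
  rw [Nat.choose_eq_zero_of_lt (by omega)]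
  simp

theorem contDiffOn_vertForm (hV : IsOpen V) {ℓ : JetSp (Euc n) k → ℝ}
    (hℓ : ContDiffOn ℝ ∞ ℓ (dom V k)) (β : ℕ) : ContDiffOn ℝ ∞ (vertForm ℓ β) (dom V k) :=
  (contDiffOn_fderiv hV hℓ).clm_comp contDiffOn_const

theorem contDiffOn_flatDLiter (hV : IsOpen V) {ℓ : JetSp (Euc n) k → ℝ}
    (hℓ : ContDiffOn ℝ ∞ ℓ (dom V k)) {ξ : JetSp (Euc n) k → JetSp (Euc n) k →L[ℝ] ℝ}
    (hξ : ContDiffOn ℝ ∞ ξ (dom V k)) (m : ℕ) :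
    ContDiffOn ℝ ∞ (flatDLiter ℓ ξ m) (dom V (k + m)) := by
  induction m with
  | zero => exact hξ
  | succ m ih => exact contDiffOn_flatDL hV hℓ _ ih

theorem flatDLiter_dz (hV : IsOpen V) {ℓ : JetSp (Euc n) k → ℝ}
    (hℓ : ContDiffOn ℝ ∞ ℓ (dom V k)) (β m : ℕ) :
    ∀ y ∈ dom V (k + m), flatDLiter ℓ (vertForm ℓ β) m y (0, 1) = 0 := by
  induction m with
  | zero => intro _ _; simp [flatDLiter, vertForm, vertCoord_dz]
  | succ m ih =>
    intro y hy
    exact flatDL_dz hV hℓ _ (contDiffOn_flatDLiter hV hℓ (contDiffOn_vertForm hV hℓ β) m) ih hy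

theorem flatDLiter_succ_cv (hV : IsOpen V) {ℓ : JetSp (Euc n) k → ℝ}
    (hℓ : ContDiffOn ℝ ∞ ℓ (dom V k)) (β m a : ℕ) (v : Euc n) :
    ∀ y ∈ dom V (k + m + 1), flatDLiter ℓ (vertForm ℓ β) (m + 1) y (cv _ (k + m + 1) a v) =
      flatD ℓ (Nat.le_add_right k m)
        (fun x => flatDLiter ℓ (vertForm ℓ β) m x (cv _ (k + m) a v)) y +
      if a = 0 then 0 else flatDLiter ℓ (vertForm ℓ β) m (trunc (k + m).le_succ y)
        (cv _ (k + m) (a - 1) v) := fun _ hy =>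
  flatDL_cv hV hℓ _ (contDiffOn_flatDLiter hV hℓ (contDiffOn_vertForm hV hℓ β) m)
    (flatDLiter_dz hV hℓ β m) hy a v

theorem flatD_zero {ℓ : JetSp (Euc n) k → ℝ} (hV : IsOpen V) {r : ℕ} (h : k ≤ r)
    {f : JetSp (Euc n) r → ℝ} (hf : ∀ x ∈ dom V r, f x = 0) {y : JetSp (Euc n) (r + 1)}
    (hy : y ∈ dom V (r + 1)) : flatD ℓ h f y = 0 := by
  have hy' : trunc r.le_succ y ∈ dom V r := hy
  have h3 : f =ᶠ[𝓝 (trunc r.le_succ y)] fun _ => 0 := by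
    filter_upwards [(isOpen_dom hV r).mem_nhds hy'] with x hx using hf x hx
  simp [flatD, h3.fderiv_eq, hf _ hy']

/-- Since `J_β` sends `∂/∂q_a` to a multiple of `∂/∂q_{a+β}`, the components of `dL ∘ J_β` stop at
`a = k - β`; each application of `D_L` admits one further index, through the term `ξ_{a-1}`. -/
theorem flatDLiter_cv_eq_zero (hV : IsOpen V) {ℓ : JetSp (Euc n) k → ℝ}
    (hℓ : ContDiffOn ℝ ∞ ℓ (dom V k)) {β : ℕ} (hβ : β ≤ k) (m : ℕ) :
    ∀ a, k + m < a + β → ∀ v, ∀ y ∈ dom V (k + m),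
      flatDLiter ℓ (vertForm ℓ β) m y (cv _ (k + m) a v) = 0 := by
  induction m with
  | zero =>
    intro a ha v y _
    change vertForm ℓ β y (cv _ k a v) = 0
    rw [vertForm, ContinuousLinearMap.comp_apply, vertCoord_cv, cv_of_lt (by omega)]
    simp
  | succ m ih =>
    intro a ha v y hy
    have ha0 : a ≠ 0 := by omega
    refine (flatDLiter_succ_cv hV hℓ β m a v y hy).trans ?_
    rw [flatD_zero hV _ (fun x hx => ih a (by omega) v x hx) hy, if_neg ha0, zero_add]
    exact ih (a - 1) (by omega) v _ hy

/-- In the recursion for the component along `q_a`, the term `D_L ξ_a` has its top index raised by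
one, while `ξ_{a-1}` already had a top index larger by one than that of `ξ_a`. Both therefore have
the same top index, `s = 2k + m - a - β` after `m` applications, and their coefficients add. The
bound `a + β ≤ k + m` guarantees `s ≥ k`, as the commutation rule requires. -/
theorem hasTop_flatDLiter (hV : IsOpen V) {ℓ : JetSp (Euc n) k → ℝ}
    (hℓ : ContDiffOn ℝ ∞ ℓ (dom V k)) {β : ℕ} (hβ : β ≤ k) (hβ' : 1 ≤ β) (v : Euc n) (m : ℕ) :
    ∀ a s, a + β ≤ k + m → s + a + β = 2 * k + m →
      HasTop V ℓ v (Nat.le_add_right k m) s (leadCoeff k β m a)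
        (fun y => flatDLiter ℓ (vertForm ℓ β) m y (cv _ (k + m) a v)) := by
  induction m with
  | zero =>
    intro a s ha hs
    change HasTop V ℓ v (Nat.le_refl k) s (leadCoeff k β 0 a)
      (fun y => vertForm ℓ β y (cv _ k a v))
    have hf : ∀ y, vertForm ℓ β y (cv _ k a v) =
        (((a + β).factorial : ℝ) / (a.factorial : ℝ)) * fderiv ℝ ℓ y (cv (Euc n) k (a + β) v) := by
      intro y
      rw [vertForm, ContinuousLinearMap.comp_apply, vertCoord_cv, map_smul, smul_eq_mul]
    simp only [hf]
    have hsm : ContDiffOn ℝ ∞ (fun y => fderiv ℝ ℓ y (cv (Euc n) k (a + β) v)) (dom V k) :=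
      (contDiffOn_fderiv hV hℓ).clm_apply contDiffOn_const
    by_cases hk : a + β = k
    · have hc : leadCoeff k β 0 a = ((a + β).factorial : ℝ) / (a.factorial : ℝ) * 1 := by
        have h1 : k - β = a := by omega
        simp [leadCoeff, hk, h1]
      rw [hc]
      refine HasTop.const_mul hV ⟨hsm, fun y hy b w => ⟨fun hb => ?_, fun hb => ?_⟩⟩ _
      · rw [cv_of_lt (show k < b by omega)]; simp
      · obtain rfl : b = k := by omega
        rw [one_mul, hk]; rfl
    -- Here `s = 2k - a - β > k`, so the top index lies beyond the order of `L` and the derivative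
    -- along `q_s` is trivially zero, as is the coefficient.
    · have hc : leadCoeff k β 0 a = ((a + β).factorial : ℝ) / (a.factorial : ℝ) * 0 := by
        simp [leadCoeff, show ¬ k ≤ a + β by omega]
      rw [hc]
      refine HasTop.const_mul hV ⟨hsm, fun y hy b w => ⟨fun hb => ?_, fun hb => ?_⟩⟩ _
      · rw [cv_of_lt (show k < b by omega)]; simp
      · rw [cv_of_lt (show k < b by omega)]; simp
  | succ m ih =>
    intro a s ha hs
    have hsm : ∀ a, ContDiffOn ℝ ∞ (fun y => flatDLiter ℓ (vertForm ℓ β) m y (cv _ (k + m) a v))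
        (dom V (k + m)) := fun a =>
      (contDiffOn_flatDLiter hV hℓ (contDiffOn_vertForm hV hℓ β) m).clm_apply contDiffOn_const
    obtain ⟨s, rfl⟩ : ∃ s', s = s' + 1 := ⟨s - 1, by omega⟩
    have h1 : HasTop V ℓ v (Nat.le_add_right k (m + 1)) (s + 1) (leadCoeff k β m a)
        (flatD ℓ (Nat.le_add_right k m)
          (fun x => flatDLiter ℓ (vertForm ℓ β) m x (cv _ (k + m) a v))) := by
      by_cases h : a + β ≤ k + m
      · exact (ih a s h (by omega)).flatD hV hℓ (by omega)
      -- The boundary case `a + β = k + m + 1`: the component `ξ_a` is identically zero before `D_L`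
      -- is applied, consistently with `m.choose (m + 1) = 0`.
      · rw [leadCoeff_of_lt (by omega)]
        exact HasTop.zero.congr hV fun y hy =>
          flatD_zero hV _ (fun x hx => flatDLiter_cv_eq_zero hV hℓ hβ m a (by omega) v x hx) hy
    by_cases h0 : a = 0
    · subst h0
      rw [leadCoeff_zero hβ]
      refine h1.congr hV fun y hy => ?_
      exact (flatDLiter_succ_cv hV hℓ β m 0 v y hy).trans (by simp)
    · rw [leadCoeff_succ h0]
      refine (h1.add hV ((ih (a - 1) (s + 1) (by omega) (by omega)).comp_trunc hV
        (k + m).le_succ)).congr hV fun y hy => ?_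
      exact (flatDLiter_succ_cv hV hℓ β m a v y hy).trans (by simp [h0])

/-- Both sides equal the Beta integral `∫₀¹ tⁱ (1-t)^g dt`, the left one after binomial expansion.
The induction is the identity `(1-t)^{g+1} = (1-t)^g - t (1-t)^g` in discrete form. -/
theorem sum_alternating_choose_div (g i : ℕ) :
    ∑ j ∈ Finset.range (g + 1), (-1 : ℝ) ^ j * (g.choose j : ℝ) / ((i + j + 1 : ℕ) : ℝ) =
      (i.factorial : ℝ) * (g.factorial : ℝ) / ((i + g + 1).factorial : ℝ) := by
  induction g generalizing i with
  | zero =>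
    simp [Nat.factorial_succ]
    field_simp
  | succ g ih =>
    have key : ∑ j ∈ Finset.range (g + 1 + 1),
        (-1 : ℝ) ^ j * ((g + 1).choose j : ℝ) / ((i + j + 1 : ℕ) : ℝ) =
        (∑ j ∈ Finset.range (g + 1), (-1 : ℝ) ^ j * (g.choose j : ℝ) / ((i + j + 1 : ℕ) : ℝ)) -
        ∑ j ∈ Finset.range (g + 1), (-1 : ℝ) ^ j * (g.choose j : ℝ) /
          (((i + 1) + j + 1 : ℕ) : ℝ) := by
      have h1 : ∑ j ∈ Finset.range (g + 1),
          (-1 : ℝ) ^ j * (g.choose j : ℝ) / ((i + j + 1 : ℕ) : ℝ) =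
          ∑ j ∈ Finset.range (g + 1 + 1),
          (-1 : ℝ) ^ j * (g.choose j : ℝ) / ((i + j + 1 : ℕ) : ℝ) := by
        rw [Finset.sum_range_succ _ (g + 1)]
        simp
      rw [h1, Finset.sum_range_succ', Finset.sum_range_succ' _ (g + 1), add_sub_right_comm,
        ← Finset.sum_sub_distrib]
      congr 1
      · refine Finset.sum_congr rfl fun j _ => ?_
        rw [Nat.choose_succ_succ, show i + 1 + j + 1 = i + (j + 1) + 1 by ring]
        push_cast
        ring
      · simp
    rw [key, ih, ih]
    rw [show i + 1 + g + 1 = (i + g + 1) + 1 by ring, show i + (g + 1) + 1 = (i + g + 1) + 1 by ring,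
      Nat.factorial_succ (i + g + 1), Nat.factorial_succ i, Nat.factorial_succ g]
    have : ((i + g + 1).factorial : ℝ) ≠ 0 := by positivity
    have : ((i : ℝ) + g + 1 + 1) ≠ 0 := by positivity
    push_cast
    field_simp
    ring

theorem sum_leadCoeff {k a : ℕ} (ha : a < k) :
    ∑ m : Fin k, (-1 : ℝ) ^ (m : ℕ) / (((m : ℕ) + 1).factorial : ℝ) *
      leadCoeff k ((m : ℕ) + 1) m a = (-1) ^ (k - 1 - a) := by
  -- With `i = k - 1 - a`, the terms `m < i` vanish. For `m = i + j` the factorials combine to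
  -- `(-1)^i k!/(i! a!)` times `(-1)^j a.choose j / (i + j + 1)`, and the Beta sum `i! a!/k!`
  -- cancels everything but the sign.
  obtain ⟨i, rfl⟩ : ∃ i, k = i + (a + 1) := ⟨k - 1 - a, by omega⟩
  rw [Fin.sum_univ_eq_sum_range (fun m => (-1 : ℝ) ^ m / ((m + 1).factorial : ℝ) *
      leadCoeff (i + (a + 1)) (m + 1) m a), Finset.sum_range_add]
  have h0 : ∑ m ∈ Finset.range i, (-1 : ℝ) ^ m / ((m + 1).factorial : ℝ) *
      leadCoeff (i + (a + 1)) (m + 1) m a = 0 := by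
    refine Finset.sum_eq_zero fun m hm => ?_
    rw [Finset.mem_range] at hm
    simp [leadCoeff, show ¬ (i + (a + 1) ≤ a + (m + 1)) by omega]
  rw [h0, zero_add, show i + (a + 1) - 1 - a = i by omega]
  have h1 : ∀ j ∈ Finset.range (a + 1), (-1 : ℝ) ^ (i + j) / ((i + j + 1).factorial : ℝ) *
      leadCoeff (i + (a + 1)) (i + j + 1) (i + j) a =
      ((-1) ^ i * ((i + a + 1).factorial : ℝ) / ((i.factorial : ℝ) * (a.factorial : ℝ))) *
        ((-1 : ℝ) ^ j * (a.choose j : ℝ) / ((i + j + 1 : ℕ) : ℝ)) := by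
    intro j hj
    rw [Finset.mem_range] at hj
    have hc1 := Nat.choose_mul_factorial_mul_factorial (show j ≤ a by omega)
    have hc2 := Nat.choose_mul_factorial_mul_factorial (show j ≤ i + j by omega)
    rw [Nat.add_sub_cancel] at hc2
    rw [leadCoeff, if_pos (by omega), show a + (i + j + 1) - (i + (a + 1)) = j by omega,
      show i + (a + 1) - (i + j + 1) = a - j by omega, ← add_assoc, Nat.factorial_succ (i + j),
      ← hc2, ← hc1]
    have h2 : ((i + j).choose j : ℝ) ≠ 0 := by
      exact_mod_cast (Nat.choose_pos (show j ≤ i + j by omega)).ne'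
    have h3 : (a.choose j : ℝ) ≠ 0 := by
      exact_mod_cast (Nat.choose_pos (show j ≤ a by omega)).ne'
    have h4 : ((i : ℝ) + j + 1) ≠ 0 := by positivity
    push_cast
    field_simp
    ring
  rw [Finset.sum_congr rfl h1, ← Finset.mul_sum, sum_alternating_choose_div]
  have : ((i + a + 1).factorial : ℝ) ≠ 0 := by positivity
  field_simp

/-- The coordinate expression of the Cartan one-form. -/
def flatTheta (ℓ : JetSp (Euc n) k → ℝ) (y : JetSp (Euc n) (2 * k - 1)) :
    JetSp (Euc n) (2 * k - 1) →L[ℝ] ℝ :=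
  ∑ m : Fin k, ((-1 : ℝ) ^ (m : ℕ) / (((m : ℕ) + 1).factorial : ℝ)) •
    (flatDLiter ℓ (vertForm ℓ ((m : ℕ) + 1)) m
      (trunc (show k + (m : ℕ) ≤ 2 * k - 1 by omega) y)).comp
      (trunc (show k + (m : ℕ) ≤ 2 * k - 1 by omega))

theorem flatTheta_apply (ℓ : JetSp (Euc n) k → ℝ) (y u : JetSp (Euc n) (2 * k - 1)) :
    flatTheta ℓ y u = ∑ m : Fin k, ((-1 : ℝ) ^ (m : ℕ) / (((m : ℕ) + 1).factorial : ℝ)) *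
      flatDLiter ℓ (vertForm ℓ ((m : ℕ) + 1)) m
        (trunc (show k + (m : ℕ) ≤ 2 * k - 1 by omega) y)
        (trunc (show k + (m : ℕ) ≤ 2 * k - 1 by omega) u) := by
  simp [flatTheta, sum_apply]

theorem contDiffOn_flatTheta (hV : IsOpen V) {ℓ : JetSp (Euc n) k → ℝ}
    (hℓ : ContDiffOn ℝ ∞ ℓ (dom V k)) : ContDiffOn ℝ ∞ (flatTheta ℓ) (dom V (2 * k - 1)) := by
  refine ContDiffOn.sum fun m _ => ?_
  have h := (contDiffOn_flatDLiter hV hℓ (contDiffOn_vertForm hV hℓ ((m : ℕ) + 1)) m).comp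
    (contDiffOn_trunc (show k + (m : ℕ) ≤ 2 * k - 1 by omega) _) (mapsTo_trunc _)
  exact ContDiffOn.const_smul _ (h.clm_comp (contDiffOn_const
    (c := trunc (E := Euc n) (show k + (m : ℕ) ≤ 2 * k - 1 by omega))))

theorem flatTheta_dz (hV : IsOpen V) {ℓ : JetSp (Euc n) k → ℝ}
    (hℓ : ContDiffOn ℝ ∞ ℓ (dom V k)) {y : JetSp (Euc n) (2 * k - 1)}
    (hy : y ∈ dom V (2 * k - 1)) : flatTheta ℓ y (0, 1) = 0 := by
  rw [flatTheta_apply]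
  exact Finset.sum_eq_zero fun m _ => by
    erw [flatDLiter_dz hV hℓ _ m _ hy, mul_zero]

/-- With `β = m + 1`, the vanishing range `k + m < a + β` of the component of `D_L^m (dL ∘ J_β)`
reads `k ≤ a`, uniformly in `m`. This is why `θ_L` is semibasic. -/
theorem flatTheta_cv_eq_zero (hV : IsOpen V) {ℓ : JetSp (Euc n) k → ℝ}
    (hℓ : ContDiffOn ℝ ∞ ℓ (dom V k)) {y : JetSp (Euc n) (2 * k - 1)}
    (hy : y ∈ dom V (2 * k - 1)) {a : ℕ} (ha : k ≤ a) (v : Euc n) :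
    flatTheta ℓ y (cv _ (2 * k - 1) a v) = 0 := by
  rw [flatTheta_apply]
  exact Finset.sum_eq_zero fun m _ => by
    rw [trunc_cv, flatDLiter_cv_eq_zero hV hℓ (by omega) m a (by omega) v _ hy, mul_zero]

/-- The momentum `θ_a` conjugate to `q_a` depends on `q_b` for `b ≤ 2k-1-a` only, and its derivative
along `q_{2k-1-a}` is `±` the top Hessian. -/
theorem hasTop_flatTheta (hV : IsOpen V) {ℓ : JetSp (Euc n) k → ℝ}
    (hℓ : ContDiffOn ℝ ∞ ℓ (dom V k)) {a : ℕ} (ha : a < k) (v : Euc n) :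
    HasTop V ℓ v (show k ≤ 2 * k - 1 by omega) (2 * k - 1 - a) ((-1) ^ (k - 1 - a))
      (fun y => flatTheta ℓ y (cv _ (2 * k - 1) a v)) := by
  rw [← sum_leadCoeff ha]
  simp only [flatTheta_apply, trunc_cv]
  refine HasTop.sum hV _ fun m _ => HasTop.const_mul hV ?_ _
  exact (hasTop_flatDLiter hV hℓ (show (m : ℕ) + 1 ≤ k by omega) (by omega) v m a (2 * k - 1 - a) (by omega)
    (by omega)).comp_trunc hV (show k + (m : ℕ) ≤ 2 * k - 1 by omega)

end FlatCartan

/-! ### Linear algebra of `η ∧ ξᵐ`. -/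

section Wedge

variable {V : Type*} [AddCommGroup V] [Module ℝ V] [TopologicalSpace V]

/-- Each argument enters exactly one factor: slot `0` belongs to `η`, and slot `j > 0` to the `((j -
1) / 2)`-th copy of `ξ`. Producing the linear functional once yields both axioms of a multilinear
map for `tensorPow`. -/
theorem exists_linear_tensorPow [DecidableEq (Fin (2 * m + 1))] (η : V →L[ℝ] ℝ)
    (ξ : V [⋀^Fin 2]→L[ℝ] ℝ) (v : Fin (2 * m + 1) → V) (j : Fin (2 * m + 1)) :
    ∃ φ : V →ₗ[ℝ] ℝ, ∀ x, (fun v : Fin (2 * m + 1) → V => η (v 0) * ∏ i : Fin m,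
      ξ ![v ⟨2 * (i : ℕ) + 1, by omega⟩, v ⟨2 * (i : ℕ) + 2, by omega⟩])
        (Function.update v j x) = φ x := by
  classical
  have hne : ∀ {a b : Fin (2 * m + 1)} (x : V), (a : ℕ) ≠ b → Function.update v b x a = v a :=
    fun x h => Function.update_of_ne (fun h' => h (congrArg Fin.val h')) _ _
  have hl : ∀ w, ∃ φ : V →ₗ[ℝ] ℝ, ∀ x, φ x = ξ ![x, w] := fun w =>
    ⟨ξ.toMultilinearMap.toLinearMap ![0, w] 0, fun x =>
      congrArg ξ (by ext i; fin_cases i <;> simp)⟩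
  have hr : ∀ w, ∃ φ : V →ₗ[ℝ] ℝ, ∀ x, φ x = ξ ![w, x] := fun w =>
    ⟨ξ.toMultilinearMap.toLinearMap ![w, 0] 1, fun x =>
      congrArg ξ (by ext i; fin_cases i <;> simp)⟩
  rcases Nat.eq_zero_or_pos (j : ℕ) with h0 | h0
  · obtain rfl : j = 0 := Fin.ext h0
    refine ⟨(∏ i : Fin m, ξ ![v ⟨2 * (i : ℕ) + 1, by omega⟩,
      v ⟨2 * (i : ℕ) + 2, by omega⟩]) • (η : V →ₗ[ℝ] ℝ), fun x => ?_⟩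
    simp only [Function.update_self, LinearMap.smul_apply, smul_eq_mul]
    rw [mul_comm]
    congr 1
    exact Finset.prod_congr rfl fun i _ => by rw [hne _ (by simp), hne _ (by simp)]
  · have hi : ((j : ℕ) - 1) / 2 < m := by omega
    obtain ⟨i₀, hi₀⟩ : ∃ i₀ : Fin m, (i₀ : ℕ) = ((j : ℕ) - 1) / 2 := ⟨⟨_, hi⟩, rfl⟩
    obtain ⟨φ, hφ⟩ : ∃ φ : V →ₗ[ℝ] ℝ, ∀ x,
        φ x = ξ ![Function.update v j x ⟨2 * (i₀ : ℕ) + 1, by omega⟩,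
          Function.update v j x ⟨2 * (i₀ : ℕ) + 2, by omega⟩] := by
      rcases Nat.mod_two_eq_zero_or_one (j : ℕ) with h1 | h1
      · have hj : (⟨2 * (i₀ : ℕ) + 2, by omega⟩ : Fin (2 * m + 1)) = j := Fin.ext (by
          simp only; omega)
        obtain ⟨φ, hφ⟩ := hr (v ⟨2 * (i₀ : ℕ) + 1, by omega⟩)
        exact ⟨φ, fun x => by rw [hφ, hj, Function.update_self, hne _ (by simp only; omega)]⟩
      · have hj : (⟨2 * (i₀ : ℕ) + 1, by omega⟩ : Fin (2 * m + 1)) = j := Fin.ext (by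
          simp only; omega)
        obtain ⟨φ, hφ⟩ := hl (v ⟨2 * (i₀ : ℕ) + 2, by omega⟩)
        exact ⟨φ, fun x => by rw [hφ, hj, Function.update_self, hne _ (by simp only; omega)]⟩
    refine ⟨(η (v 0) * ∏ i ∈ Finset.univ.erase i₀, ξ ![v ⟨2 * (i : ℕ) + 1, by omega⟩,
      v ⟨2 * (i : ℕ) + 2, by omega⟩]) • φ, fun x => ?_⟩
    simp only [LinearMap.smul_apply, smul_eq_mul]
    rw [hφ, hne _ (by simpa using h0.ne), ← Finset.mul_prod_erase _ _ (Finset.mem_univ i₀)]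
    have : ∏ i ∈ Finset.univ.erase i₀,
        ξ ![Function.update v j x ⟨2 * (i : ℕ) + 1, by omega⟩,
          Function.update v j x ⟨2 * (i : ℕ) + 2, by omega⟩] =
        ∏ i ∈ Finset.univ.erase i₀, ξ ![v ⟨2 * (i : ℕ) + 1, by omega⟩,
          v ⟨2 * (i : ℕ) + 2, by omega⟩] := by
      refine Finset.prod_congr rfl fun i hi => ?_
      have hii : (i : ℕ) ≠ i₀ := fun h => (Finset.mem_erase.1 hi).1 (Fin.ext h)
      rw [hne _ (by simp only; omega), hne _ (by simp only; omega)]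
    rw [this]
    ring

/-- The multilinear map `η ⊗ ξ ⊗ ⋯ ⊗ ξ`. -/
def tensorPow (η : V →L[ℝ] ℝ) (ξ : V [⋀^Fin 2]→L[ℝ] ℝ) (m : ℕ) :
    MultilinearMap ℝ (fun _ : Fin (2 * m + 1) => V) ℝ :=
  MultilinearMap.mk (fun v => η (v 0) * ∏ i : Fin m,
      ξ ![v ⟨2 * (i : ℕ) + 1, by omega⟩, v ⟨2 * (i : ℕ) + 2, by omega⟩])
    (fun v j x y => by
      obtain ⟨φ, hφ⟩ := exists_linear_tensorPow η ξ v j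
      have h1 := hφ x
      have h2 := hφ y
      have h3 := hφ (x + y)
      simp only at h1 h2 h3
      rw [h1, h2, h3, map_add])
    (fun v j c x => by
      obtain ⟨φ, hφ⟩ := exists_linear_tensorPow η ξ v j
      have h1 := hφ x
      have h3 := hφ (c • x)
      simp only at h1 h3
      rw [h1, h3, map_smul])

theorem wedgePow_eq_alternatization (η : V →L[ℝ] ℝ) (ξ : V [⋀^Fin 2]→L[ℝ] ℝ)
    (v : Fin (2 * m + 1) → V) :
    wedgePow η ξ m v = (1 / 2 ^ m : ℝ) * (tensorPow η ξ m).alternatization v := by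
  rw [wedgePow, MultilinearMap.alternatization_apply]
  congr 1
  refine Finset.sum_congr rfl fun σ _ => ?_
  rw [Units.smul_def, zsmul_eq_mul]
  rfl

/-- In every term of the alternating sum `u` is fed to some factor, which it annihilates. -/
theorem wedgePow_eq_zero_of_kernel_entry {η : V →L[ℝ] ℝ} {ξ : V [⋀^Fin 2]→L[ℝ] ℝ} {u : V}
    (hη : η u = 0) (hξ : ∀ w, ξ ![u, w] = 0) {v : Fin (2 * m + 1) → V} {j : Fin (2 * m + 1)}
    (hv : v j = u) : wedgePow η ξ m v = 0 := by
  have hξ' : ∀ w, ξ ![w, u] = 0 := fun w => by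
    have := ξ.map_swap ![u, w] (show (0 : Fin 2) ≠ 1 by decide)
    have h2 : ![u, w] ∘ ⇑(Equiv.swap (0 : Fin 2) 1) = ![w, u] := by
      ext i
      fin_cases i <;> simp
    rw [h2] at this
    exact this.trans (by rw [neg_eq_zero]; exact hξ w)
  rw [wedgePow]
  refine mul_eq_zero_of_right _ (Finset.sum_eq_zero fun σ _ => mul_eq_zero_of_right _ ?_)
  obtain ⟨l, hl⟩ := σ.surjective j
  rcases Nat.eq_zero_or_pos (l : ℕ) with h0 | h0
  · have : l = 0 := Fin.ext h0
    rw [← this, hl, hv, hη, zero_mul]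
  · refine mul_eq_zero_of_right _ ?_
    have hi : ((l : ℕ) - 1) / 2 < m := by omega
    refine Finset.prod_eq_zero (Finset.mem_univ ⟨((l : ℕ) - 1) / 2, hi⟩) ?_
    rcases Nat.mod_two_eq_zero_or_one (l : ℕ) with h1 | h1
    · have : (⟨2 * (((l : ℕ) - 1) / 2) + 2, by omega⟩ : Fin (2 * m + 1)) = l := Fin.ext (by
        simp only; omega)
      simp only [this, hl, hv, hξ']
    · have : (⟨2 * (((l : ℕ) - 1) / 2) + 1, by omega⟩ : Fin (2 * m + 1)) = l := Fin.ext (by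
        simp only; omega)
      simp only [this, hl, hv, hξ]

/-- If `η ∧ ξᵐ ≠ 0` in dimension `2m+1`, then `ker η ∩ ker ξ = 0`. -/
theorem eq_zero_of_wedgePow_ne_zero [FiniteDimensional ℝ V] {η : V →L[ℝ] ℝ} {ξ : V [⋀^Fin 2]→L[ℝ] ℝ}
    (hV : Module.finrank ℝ V = 2 * m + 1) {v : Fin (2 * m + 1) → V}
    (hv : wedgePow η ξ m v ≠ 0) {u : V} (hη : η u = 0) (hξ : ∀ w, ξ ![u, w] = 0) : u = 0 := by
  set A := (tensorPow η ξ m).alternatization with hA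
  have hAv : A v ≠ 0 := by
    rw [wedgePow_eq_alternatization] at hv
    exact right_ne_zero_of_mul hv
  -- The form is nonzero on `v`, so `v` is a basis. Replacing its `i`-th vector by `u` multiplies
  -- the value by the `i`-th coordinate of `u`; since the replaced value is zero, that coordinate
  -- vanishes.
  have hli : LinearIndependent ℝ v := by
    by_contra h
    exact hAv (A.map_linearDependent v h)
  let b := basisOfLinearIndependentOfCardEqFinrank hli (by simp [hV])
  have hb : ⇑b = v := coe_basisOfLinearIndependentOfCardEqFinrank hli (by simp [hV])
  have hu : u = ∑ j, b.repr u j • v j := by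
    conv_lhs => rw [← b.sum_repr u]
    simp [hb]
  have hc : ∀ i, b.repr u i = 0 := by
    intro i
    have h1 : A (Function.update v i u) = 0 := by
      have := wedgePow_eq_zero_of_kernel_entry (m := m) (v := Function.update v i u) (j := i) hη hξ
        (by simp)
      rw [wedgePow_eq_alternatization] at this
      exact (mul_eq_zero.1 this).resolve_left (by positivity)
    rw [hu, AlternatingMap.map_update_sum, Finset.sum_eq_single i] at h1
    · rw [AlternatingMap.map_update_smul, Function.update_eq_self, smul_eq_mul] at h1
      exact (mul_eq_zero.1 h1).resolve_right hAv
    · intro j _ hj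
      rw [AlternatingMap.map_update_smul, A.map_update_self _ hj.symm, smul_zero]
    · simp
  rw [hu]
  simp [hc]

/-- Indices `0, 2i+1, 2i+2` as `none, (i, 0), (i, 1)`. -/
def pairEquiv (m : ℕ) : Option (Fin m × Fin 2) ≃ Fin (2 * m + 1) :=
  (Equiv.optionCongr (finProdFinEquiv.trans (finCongr (mul_comm m 2)))).trans (finSuccEquiv _).symm

theorem pairEquiv_none (m : ℕ) : pairEquiv m none = 0 := rfl

theorem pairEquiv_some (m : ℕ) (i : Fin m) (a : Fin 2) :
    ((pairEquiv m (some (i, a)) : Fin (2 * m + 1)) : ℕ) = 2 * i + a + 1 := by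
  simp [pairEquiv, finProdFinEquiv]
  omega

theorem pairEquiv_some_zero (m : ℕ) (i : Fin m) :
    (⟨2 * (i : ℕ) + 1, by omega⟩ : Fin (2 * m + 1)) = pairEquiv m (some (i, 0)) :=
  Fin.ext (by simp [pairEquiv_some])

theorem pairEquiv_some_one (m : ℕ) (i : Fin m) :
    (⟨2 * (i : ℕ) + 2, by omega⟩ : Fin (2 * m + 1)) = pairEquiv m (some (i, 1)) :=
  Fin.ext (by simp [pairEquiv_some])

/-- The sign of a permutation of `{0, 1, …, 2m}` that preserves the pairs `{2i+1, 2i+2}`. -/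
theorem sign_of_pairs {m : ℕ} (σ : Equiv.Perm (Fin (2 * m + 1))) (h0 : σ 0 = 0) (τ : Fin m → Fin m)
    (ρ : Fin m → Equiv.Perm (Fin 2))
    (h : ∀ i a, σ (pairEquiv m (some (i, a))) = pairEquiv m (some (τ i, ρ i a))) :
    Equiv.Perm.sign σ = ∏ i, Equiv.Perm.sign (ρ i) := by
  have hτ : Function.Injective τ := by
    intro i j hij
    have h1 := h i ((ρ i).symm 0)
    have h2 := h j ((ρ j).symm 0)
    rw [Equiv.apply_symm_apply] at h1 h2
    rw [hij, ← h2] at h1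
    have := (pairEquiv m).injective (σ.injective h1)
    simp only [Option.some.injEq, Prod.mk.injEq] at this
    exact this.1
  let τ' : Equiv.Perm (Fin m) := Equiv.ofBijective τ (Finite.injective_iff_bijective.1 hτ)
  -- Off the fixed point, `σ` is a permutation of the pairs composed with flips inside pairs. The
  -- former acts identically on both members of a pair, so its sign enters squared and only the
  -- flips count.
  let κ : Equiv.Perm (Fin m × Fin 2) :=
    Equiv.prodCongrLeft (fun _ : Fin 2 => τ') * Equiv.prodCongrRight ρ
  have hσ : σ = (pairEquiv m).permCongr (Equiv.optionCongr κ) := by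
    ext x : 1
    obtain ⟨y, rfl⟩ := (pairEquiv m).surjective x
    rw [Equiv.permCongr_apply, Equiv.symm_apply_apply]
    rcases y with _ | ⟨i, a⟩
    · simp [pairEquiv_none, h0]
    · rw [h]
      rfl
  rw [hσ, Equiv.Perm.sign_permCongr, Equiv.optionCongr_sign, Equiv.Perm.sign_mul,
    Equiv.Perm.sign_prodCongrLeft, Equiv.Perm.sign_prodCongrRight]
  simp

theorem perm_fin_two (ρ : Equiv.Perm (Fin 2)) : ρ = 1 ∨ ρ = Equiv.swap 0 1 := by
  revert ρ
  decide

theorem ite_mul_ite_sub {p q r s : Prop} [Decidable p] [Decidable q] [Decidable r] [Decidable s]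
    (h : ¬ (p ∧ q)) (h' : ¬ (r ∧ s)) :
    (if p then (1 : ℝ) else 0) * (if q then 1 else 0) -
      (if r then 1 else 0) * (if s then 1 else 0) = 0 := by
  split_ifs <;> simp_all

/-- If `η`, `e_j`, `f_j` are independent covectors and `ξ = ∑ e_j ∧ f_j`, then `η ∧ ξᵐ ≠ 0`. -/
theorem exists_wedgePow_ne_zero [FiniteDimensional ℝ V] {η : V →L[ℝ] ℝ}
    {ξ : V [⋀^Fin 2]→L[ℝ] ℝ} (hV : Module.finrank ℝ V = 2 * m + 1) (e f : Fin m → V →L[ℝ] ℝ)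
    (hξ : ∀ u w, ξ ![u, w] = ∑ j, (e j u * f j w - f j u * e j w))
    (hinj : ∀ u, η u = 0 → (∀ j, e j u = 0) → (∀ j, f j u = 0) → u = 0) :
    ∃ v, wedgePow η ξ m v ≠ 0 := by
  classical
  let c : Option (Fin m × Fin 2) → V →ₗ[ℝ] ℝ := fun o => match o with
    | none => η
    | some (j, a) => if a = 0 then e j else f j
  have hbij : Function.Bijective (LinearMap.pi c) := by
    have hi : Function.Injective (LinearMap.pi c) := by
      rw [← LinearMap.ker_eq_bot, LinearMap.ker_eq_bot']
      intro u hu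
      refine hinj u (congrFun hu none) (fun j => ?_) (fun j => ?_)
      · simpa [c] using congrFun hu (some (j, 0))
      · simpa [c] using congrFun hu (some (j, 1))
    refine ⟨hi, (LinearMap.injective_iff_surjective_of_finrank_eq_finrank ?_).1 hi⟩
    rw [hV, Module.finrank_fintype_fun_eq_card, Fintype.card_congr (pairEquiv m)]
    simp
  -- The basis dual to `η`, `e_j`, `f_j`.
  choose b hb using fun o : Option (Fin m × Fin 2) => hbij.2 (Pi.single o 1)
  have hb' : ∀ o o', c o' (b o) = if o' = o then 1 else 0 := fun o o' => by
    have := congrFun (hb o) o'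
    rwa [Pi.single_apply] at this
  have hη : ∀ o, η (b o) = if o = none then 1 else 0 := fun o => by
    have := hb' o none
    simpa [c, eq_comm] using this
  have he : ∀ j o, e j (b o) = if o = some (j, 0) then 1 else 0 := fun j o => by
    have := hb' o (some (j, 0))
    simpa [c, eq_comm] using this
  have hf : ∀ j o, f j (b o) = if o = some (j, 1) then 1 else 0 := fun j o => by
    have := hb' o (some (j, 1))
    simpa [c, eq_comm] using this
  have hpair : ∀ (i : Fin m) (ρ : Equiv.Perm (Fin 2)),
      ξ ![b (some (i, ρ 0)), b (some (i, ρ 1))] = ((Equiv.Perm.sign ρ : ℤ) : ℝ) := by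
    intro i ρ
    have h := perm_fin_two ρ
    rcases h with rfl | rfl
    · simp [hξ, he, hf]
    · simp [hξ, he, hf]
  have hpair0 : ∀ o o', ξ ![b o, b o'] ≠ 0 →
      ∃ (i : Fin m) (ρ : Equiv.Perm (Fin 2)), o = some (i, ρ 0) ∧ o' = some (i, ρ 1) := by
    intro o o' h
    rw [hξ] at h
    obtain ⟨j, -, hj⟩ := Finset.exists_ne_zero_of_sum_ne_zero h
    rw [he, he, hf, hf] at hj
    by_cases h1 : o = some (j, 0) ∧ o' = some (j, 1)
    · exact ⟨j, 1, by simpa using h1⟩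
    · refine ⟨j, Equiv.swap 0 1, ?_⟩
      by_contra h2
      simp only [Equiv.swap_apply_left, Equiv.swap_apply_right] at h2
      apply hj
      exact ite_mul_ite_sub h1 h2
  refine ⟨fun x => b ((pairEquiv m).symm x), ?_⟩
  rw [wedgePow]
  refine mul_ne_zero (by positivity) (ne_of_gt ?_)
  -- On the dual basis a nonzero term forces `σ` to fix `0` and to permute the pairs, with a flip `ρ
  -- i` in each. Both `sign σ` and the product of the values of `ξ` equal `∏ sign (ρ i)`, so the
  -- term is a product of squares. There is thus no cancellation, and the identity alone contributes
  -- `1`.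
  have hterm : ∀ σ : Equiv.Perm (Fin (2 * m + 1)), 0 ≤ ((Equiv.Perm.sign σ : ℤ) : ℝ) *
      (η (b ((pairEquiv m).symm (σ 0))) * ∏ i : Fin m,
      ξ ![b ((pairEquiv m).symm (σ ⟨2 * (i : ℕ) + 1, by omega⟩)),
        b ((pairEquiv m).symm (σ ⟨2 * (i : ℕ) + 2, by omega⟩))]) := by
    intro σ
    by_contra hne
    have hne' : η (b ((pairEquiv m).symm (σ 0))) * ∏ i : Fin m,
      ξ ![b ((pairEquiv m).symm (σ ⟨2 * (i : ℕ) + 1, by omega⟩)),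
        b ((pairEquiv m).symm (σ ⟨2 * (i : ℕ) + 2, by omega⟩))] ≠ 0 := by
      intro h
      rw [h, mul_zero] at hne
      exact hne le_rfl
    apply hne
    have h0 : σ 0 = 0 := by
      have := left_ne_zero_of_mul hne'
      rw [hη] at this
      have h : (pairEquiv m).symm (σ 0) = none := by
        by_contra h; simp [h] at this
      rw [Equiv.symm_apply_eq] at h
      exact h
    have hp := fun i => hpair0 _ _ (Finset.prod_ne_zero_iff.1 (right_ne_zero_of_mul hne') i
      (Finset.mem_univ i))
    choose τ ρ h1 h2 using hp
    have hs := sign_of_pairs σ h0 τ ρ (fun i a => by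
      fin_cases a
      · have := h1 i
        rw [Equiv.symm_apply_eq, pairEquiv_some_zero] at this
        exact this
      · have := h2 i
        rw [Equiv.symm_apply_eq, pairEquiv_some_one] at this
        exact this)
    simp only [h1, h2, hpair, hs, h0]
    rw [show (pairEquiv m).symm 0 = none from by rw [Equiv.symm_apply_eq]; rfl, hη, if_pos rfl,
      one_mul, Units.coe_prod, Int.cast_prod, ← Finset.prod_mul_distrib]
    refine Finset.prod_nonneg fun i _ => mul_self_nonneg _
  refine lt_of_lt_of_le ?_ (Finset.single_le_sum (fun σ _ => hterm σ) (Finset.mem_univ 1))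
  have h0 : (pairEquiv m).symm 0 = none := by rw [Equiv.symm_apply_eq]; rfl
  simp only [Equiv.Perm.coe_one, id_eq, Equiv.Perm.sign_one, h0, hη, pairEquiv_some_zero,
    pairEquiv_some_one, Equiv.symm_apply_apply]
  have := fun i => hpair i 1
  simp only [Equiv.Perm.coe_one, id_eq, Equiv.Perm.sign_one] at this
  simp [this]

end Wedge

/-! ### Natural charts of `TʳQ × ℝ` and coordinate expressions of forms. -/

section JetCharts

variable {n : ℕ} {Q : Type*} [TopologicalSpace Q] [ChartedSpace (Euc n) Q]

/-- Natural coordinates `(q₀, …, q_r, z)` on `TʳQ × ℝ`. -/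
def jetChart (r : ℕ) (e : OpenPartialHomeomorph Q (Euc n)) (p : HTan n r Q × ℝ) :
    JetSp (Euc n) r := (natCoord r e p.1, p.2)

/-- The point of `TʳQ × ℝ` with given natural coordinates. -/
def jetChartSymm (r : ℕ) (e : OpenPartialHomeomorph Q (Euc n)) (y : JetSp (Euc n) r) :
    HTan n r Q × ℝ := (ofNatCoord r e y.1, y.2)

/-- The part of `TʳQ × ℝ` over the domain of a chart of `Q`. -/
def overChart (r : ℕ) (e : OpenPartialHomeomorph Q (Euc n)) : Set (HTan n r Q × ℝ) :=
  {p | p.1.base ∈ e.source}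

variable [IsManifold (𝓡 n) ∞ Q] {e : OpenPartialHomeomorph Q (Euc n)}

/-- The natural charts of `TʳQ`, as open partial homeomorphisms. -/
def natHomeo (r : ℕ) (he : e ∈ smoothCharts n Q) :
    OpenPartialHomeomorph (HTan n r Q) (Fin (r + 1) → Euc n) :=
  (htanCore n r Q).openPartialHomeomorph (natChart r e he) ⟨e, he, rfl⟩

theorem natHomeo_mem_atlas (r : ℕ) (he : e ∈ smoothCharts n Q) :
    natHomeo r he ∈ atlas (Fin (r + 1) → Euc n) (HTan n r Q) := by
  refine Set.mem_iUnion.2 ⟨natChart r e he, Set.mem_iUnion.2 ⟨⟨e, he, rfl⟩, ?_⟩⟩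
  exact Set.mem_singleton _

theorem contMDiffOn_natCoord (r : ℕ) (he : e ∈ smoothCharts n Q) :
    ContMDiffOn (jetModel n r) 𝓘(ℝ, Fin (r + 1) → Euc n) ∞ (natCoord r e)
      {p : HTan n r Q | p.base ∈ e.source} :=
  contMDiffOn_of_mem_maximalAtlas (I := jetModel n r) (e := natHomeo r he)
    (IsManifold.subset_maximalAtlas (natHomeo_mem_atlas r he))

theorem contMDiffOn_ofNatCoord (r : ℕ) (he : e ∈ smoothCharts n Q) :
    ContMDiffOn 𝓘(ℝ, Fin (r + 1) → Euc n) (jetModel n r) ∞ (ofNatCoord r e : _ → HTan n r Q)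
      {q | q 0 ∈ e.target} :=
  contMDiffOn_symm_of_mem_maximalAtlas (I := jetModel n r) (e := natHomeo r he)
    (IsManifold.subset_maximalAtlas (natHomeo_mem_atlas r he))

theorem isOpen_base_mem (r : ℕ) (he : e ∈ smoothCharts n Q) :
    IsOpen {p : HTan n r Q | p.base ∈ e.source} :=
  (natHomeo r he).open_source

theorem isOpen_overChart (r : ℕ) (he : e ∈ smoothCharts n Q) : IsOpen (overChart r e) :=
  (isOpen_base_mem r he).preimage continuous_fst

theorem jetChartSymm_jetChart {r : ℕ} (he : e ∈ smoothCharts n Q) {p : HTan n r Q × ℝ}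
    (hp : p ∈ overChart r e) : jetChartSymm r e (jetChart r e p) = p :=
  Prod.ext ((natHomeo r he).left_inv hp) rfl

theorem jetChart_jetChartSymm {r : ℕ} (he : e ∈ smoothCharts n Q) {y : JetSp (Euc n) r}
    (hy : y ∈ dom e.target r) : jetChart r e (jetChartSymm r e y) = y :=
  Prod.ext ((natHomeo r he).right_inv hy) rfl

theorem jetChart_mem {r : ℕ} (he : e ∈ smoothCharts n Q) {p : HTan n r Q × ℝ}
    (hp : p ∈ overChart r e) : jetChart r e p ∈ dom e.target r :=
  (natHomeo r he).map_source hp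

theorem jetChartSymm_mem {r : ℕ} (he : e ∈ smoothCharts n Q) {y : JetSp (Euc n) r}
    (hy : y ∈ dom e.target r) : jetChartSymm r e y ∈ overChart r e :=
  (natHomeo r he).map_target hy

theorem contMDiffOn_jetChart (r : ℕ) (he : e ∈ smoothCharts n Q) :
    ContMDiffOn (extModel n r) 𝓘(ℝ, JetSp (Euc n) r) ∞ (jetChart r e) (overChart r e) := by
  refine ContMDiffOn.prodMk_space ?_ contMDiff_snd.contMDiffOn
  exact (contMDiffOn_natCoord r he).comp contMDiff_fst.contMDiffOn (fun p hp => hp)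

theorem contMDiffOn_jetChartSymm (r : ℕ) (he : e ∈ smoothCharts n Q) :
    ContMDiffOn 𝓘(ℝ, JetSp (Euc n) r) (extModel n r) ∞ (jetChartSymm r e : _ → HTan n r Q × ℝ)
      (dom e.target r) := by
  refine ContMDiffOn.prodMk ?_ ?_
  · exact (contMDiffOn_ofNatCoord r he).comp contDiff_fst.contMDiff.contMDiffOn (fun p hp => hp)
  · exact contDiff_snd.contMDiff.contMDiffOn

theorem mdifferentiableAt_jetChart {r : ℕ} (he : e ∈ smoothCharts n Q) {p : HTan n r Q × ℝ}
    (hp : p ∈ overChart r e) :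
    MDifferentiableAt (extModel n r) 𝓘(ℝ, JetSp (Euc n) r) (jetChart r e) p :=
  ((contMDiffOn_jetChart r he).contMDiffAt ((isOpen_overChart r he).mem_nhds hp)).mdifferentiableAt
    (by simp)

theorem isOpen_dom_target (r : ℕ) (e : OpenPartialHomeomorph Q (Euc n)) :
    IsOpen (dom e.target r) := isOpen_dom e.open_target r

theorem mdifferentiableAt_jetChartSymm {r : ℕ} (he : e ∈ smoothCharts n Q) {y : JetSp (Euc n) r}
    (hy : y ∈ dom e.target r) :
    MDifferentiableAt 𝓘(ℝ, JetSp (Euc n) r) (extModel n r)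
      (jetChartSymm r e : _ → HTan n r Q × ℝ) y :=
  ((contMDiffOn_jetChartSymm r he).contMDiffAt
    ((isOpen_dom_target r e).mem_nhds hy)).mdifferentiableAt (by simp)

/-- The derivative of the inverse natural chart. -/
def dSymm (r : ℕ) (e : OpenPartialHomeomorph Q (Euc n)) (y : JetSp (Euc n) r) :
    JetSp (Euc n) r →L[ℝ] TangentSpace (extModel n r) (jetChartSymm r e y : HTan n r Q × ℝ) :=
  mfderiv 𝓘(ℝ, JetSp (Euc n) r) (extModel n r) (jetChartSymm r e) y

/-- The derivative of the natural chart. -/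
def dChart (r : ℕ) (e : OpenPartialHomeomorph Q (Euc n)) (p : HTan n r Q × ℝ) :
    TangentSpace (extModel n r) p →L[ℝ] JetSp (Euc n) r :=
  mfderiv (extModel n r) 𝓘(ℝ, JetSp (Euc n) r) (jetChart r e) p

theorem dChart_dSymm {r : ℕ} (he : e ∈ smoothCharts n Q) {y : JetSp (Euc n) r}
    (hy : y ∈ dom e.target r) (u : JetSp (Euc n) r) :
    dChart r e (jetChartSymm r e y : HTan n r Q × ℝ) (dSymm r e y u) = u := by
  have h := mfderiv_comp y (mdifferentiableAt_jetChart he (jetChartSymm_mem he hy))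
    (mdifferentiableAt_jetChartSymm he hy)
  have h2 : (jetChart r e ∘ (jetChartSymm r e : _ → HTan n r Q × ℝ)) =ᶠ[𝓝 y] id := by
    filter_upwards [(isOpen_dom_target r e).mem_nhds hy] with x hx
      using jetChart_jetChartSymm he hx
  rw [h2.mfderiv_eq, mfderiv_id] at h
  exact (congrArg (fun A => A u) h).symm

theorem dSymm_dChart {r : ℕ} (he : e ∈ smoothCharts n Q) {p : HTan n r Q × ℝ}
    (hp : p ∈ overChart r e) (u : TangentSpace (extModel n r) p) :
    dSymm r e (jetChart r e p) (dChart r e p u) = u := by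
  have h := mfderiv_comp p (mdifferentiableAt_jetChartSymm he (jetChart_mem he hp))
    (mdifferentiableAt_jetChart he hp)
  have h2 : ((jetChartSymm r e : _ → HTan n r Q × ℝ) ∘ jetChart r e) =ᶠ[𝓝 p] id := by
    filter_upwards [(isOpen_overChart r he).mem_nhds hp] with x hx
      using jetChartSymm_jetChart he hx
  rw [h2.mfderiv_eq, mfderiv_id] at h
  exact (congrArg (fun A => A u) h).symm

theorem chart_smooth (x : Q) : chartAt (Euc n) x ∈ smoothCharts n Q :=
  IsManifold.chart_mem_maximalAtlas x

theorem mem_over_chartAt {r : ℕ} (p : HTan n r Q × ℝ) :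
    p ∈ overChart r (chartAt (Euc n) p.1.base) := mem_chart_source (Euc n) p.1.base

/-- The coordinate expression of a one-form in a natural chart. -/
def coordForm (r : ℕ) (e : OpenPartialHomeomorph Q (Euc n))
    (ξ : OneForm (extModel n r) (HTan n r Q × ℝ)) (y : JetSp (Euc n) r) :
    JetSp (Euc n) r →L[ℝ] ℝ :=
  (ξ (jetChartSymm r e y)).comp (dSymm r e y)

theorem proj_base {r s : ℕ} (h : r ≤ s) (p : HTan n s Q) : (proj h p).base = p.base := by
  rw [← jet_rep p]; rfl

theorem natCoord_proj {r s : ℕ} (h : r ≤ s) (he : e ∈ smoothCharts n Q) (p : HTan n s Q)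
    (hp : p.base ∈ e.source) (α : Fin (r + 1)) :
    natCoord r e (proj h p) α = natCoord s e p (Fin.castLE (Nat.succ_le_succ h) α) := by
  obtain ⟨c, rfl⟩ : ∃ c, jet s c = p := ⟨_, jet_rep p⟩
  rw [natCoord_jet s he c hp]
  exact natCoord_jet r he c hp α

theorem extProj_mem_over {r s : ℕ} (h : r ≤ s) {p : HTan n s Q × ℝ} :
    extProj h p ∈ overChart r e ↔ p ∈ overChart s e := by
  change (proj h p.1).base ∈ e.source ↔ _
  rw [proj_base]; rfl

theorem jetChart_extProj {r s : ℕ} (h : r ≤ s) (he : e ∈ smoothCharts n Q) {p : HTan n s Q × ℝ}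
    (hp : p ∈ overChart s e) : jetChart r e (extProj h p) = trunc h (jetChart s e p) :=
  Prod.ext (funext fun α => natCoord_proj h he p.1 hp α) rfl

theorem extProj_jetChartSymm {r s : ℕ} (h : r ≤ s) (he : e ∈ smoothCharts n Q)
    {y : JetSp (Euc n) s} (hy : y ∈ dom e.target s) :
    extProj h (jetChartSymm s e y : HTan n s Q × ℝ) = jetChartSymm r e (trunc h y) := by
  have h1 := jetChartSymm_mem (Q := Q) he hy
  rw [← jetChartSymm_jetChart he ((extProj_mem_over h).2 h1), jetChart_extProj h he h1,
    jetChart_jetChartSymm he hy]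

theorem contMDiffAt_of_jetChart {r : ℕ} (he : e ∈ smoothCharts n Q)
    {E' : Type*} [NormedAddCommGroup E'] [NormedSpace ℝ E'] {H' : Type*} [TopologicalSpace H']
    {J : ModelWithCorners ℝ E' H'} {N : Type*} [TopologicalSpace N] [ChartedSpace H' N]
    {f : HTan n r Q × ℝ → N} {p : HTan n r Q × ℝ} (hp : p ∈ overChart r e)
    (hf : ContMDiffAt 𝓘(ℝ, JetSp (Euc n) r) J ∞ (fun y => f (jetChartSymm r e y))
      (jetChart r e p)) : ContMDiffAt (extModel n r) J ∞ f p := by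
  have h := hf.comp p ((contMDiffOn_jetChart r he).contMDiffAt ((isOpen_overChart r he).mem_nhds hp))
  refine h.congr_of_eventuallyEq ?_
  filter_upwards [(isOpen_overChart r he).mem_nhds hp] with x hx
  simp [jetChartSymm_jetChart he hx]

theorem contMDiff_extProj {r s : ℕ} (h : r ≤ s) :
    ContMDiff (extModel n s) (extModel n r) ∞
      (extProj h : HTan n s Q × ℝ → HTan n r Q × ℝ) := by
  intro p
  have he := chart_smooth (n := n) p.1.base
  refine contMDiffAt_of_jetChart he (mem_over_chartAt p) ?_
  have hy := jetChart_mem he (mem_over_chartAt p)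
  have h1 : ContMDiffAt 𝓘(ℝ, JetSp (Euc n) s) (extModel n r) ∞
      ((jetChartSymm r (chartAt (Euc n) p.1.base) : _ → HTan n r Q × ℝ) ∘ trunc h)
      (jetChart s (chartAt (Euc n) p.1.base) p) :=
    ((contMDiffOn_jetChartSymm r he).contMDiffAt ((isOpen_dom_target r _).mem_nhds
      ((trunc_mem_dom h).2 hy))).comp _ (trunc (E := Euc n) h).contDiff.contMDiff.contMDiffAt
  refine h1.congr_of_eventuallyEq ?_
  filter_upwards [(isOpen_dom_target s _).mem_nhds hy] with y hy
    using extProj_jetChartSymm h he hy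

/-- In natural coordinates the projection is the linear map `trunc`, which is its own derivative. -/
theorem dChart_mfderiv_extProj {r s : ℕ} (h : r ≤ s) (he : e ∈ smoothCharts n Q)
    {p : HTan n s Q × ℝ} (hp : p ∈ overChart s e) (v : TangentSpace (extModel n s) p) :
    dChart r e (extProj h p) (mfderiv (extModel n s) (extModel n r) (extProj h) p v) =
      trunc h (dChart s e p v) := by
  have h1 := mfderiv_comp p (mdifferentiableAt_jetChart he ((extProj_mem_over h).2 hp))
    ((contMDiff_extProj h p).mdifferentiableAt (by simp))
  have h2 := mfderiv_comp p
    (((trunc (E := Euc n) h).contDiff (n := 1)).contMDiff.mdifferentiableAt (by simp))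
    (mdifferentiableAt_jetChart he hp)
  have h3 : jetChart r e ∘ extProj h =ᶠ[𝓝 p] trunc h ∘ jetChart s e := by
    filter_upwards [(isOpen_overChart s he).mem_nhds hp] with x hx using jetChart_extProj h he hx
  rw [mfderiv_eq_fderiv, ContinuousLinearMap.fderiv] at h2
  have h4 := (h1.symm.trans (h3.mfderiv_eq (I := extModel n s)
    (I' := 𝓘(ℝ, JetSp (Euc n) r)))).trans h2
  exact congrArg (fun A : JetSp (Euc n) s →L[ℝ] JetSp (Euc n) r => A v) h4

/-- A one-form is recovered from its coordinate expression. -/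
theorem form_apply {r : ℕ} (he : e ∈ smoothCharts n Q)
    (ξ : OneForm (extModel n r) (HTan n r Q × ℝ)) {p : HTan n r Q × ℝ} (hp : p ∈ overChart r e)
    (v : TangentSpace (extModel n r) p) :
    ξ p v = coordForm r e ξ (jetChart r e p) (dChart r e p v) := by
  -- The round trip through the chart returns to `p` only propositionally. Since every tangent space
  -- is the same model space, generalizing the point allows the substitution.
  have h1 : ∀ q, q = p → ∀ w : JetSp (Euc n) r, w = v → (ξ q : JetSp (Euc n) r →L[ℝ] ℝ) w = ξ p v := by
    rintro q rfl w rfl; rfl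
  exact (h1 _ (jetChartSymm_jetChart he hp) _ (dSymm_dChart he hp v)).symm

theorem coordForm_eq_of_forall {r : ℕ} (he : e ∈ smoothCharts n Q)
    {ξ : OneForm (extModel n r) (HTan n r Q × ℝ)} {ζ : JetSp (Euc n) r → JetSp (Euc n) r →L[ℝ] ℝ}
    (h : ∀ p ∈ overChart r e, ∀ v, ξ p v = ζ (jetChart r e p) (dChart r e p v))
    {y : JetSp (Euc n) r} (hy : y ∈ dom e.target r) : coordForm r e ξ y = ζ y := by
  refine ContinuousLinearMap.ext fun u => ?_
  have := h _ (jetChartSymm_mem he hy) (dSymm r e y u)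
  rw [dChart_dSymm he hy, jetChart_jetChartSymm he hy] at this
  exact this

theorem dFun_apply {r : ℕ} (he : e ∈ smoothCharts n Q) {f : HTan n r Q × ℝ → ℝ}
    {p : HTan n r Q × ℝ} (hp : p ∈ overChart r e)
    (hf : DifferentiableAt ℝ (fun y => f (jetChartSymm r e y)) (jetChart r e p))
    (v : TangentSpace (extModel n r) p) :
    dFun (extModel n r) f p v =
      fderiv ℝ (fun y => f (jetChartSymm r e y)) (jetChart r e p) (dChart r e p v) := by
  have h1 := mfderiv_comp p hf.mdifferentiableAt (mdifferentiableAt_jetChart he hp)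
  have h2 : (fun y => f (jetChartSymm r e y)) ∘ jetChart r e =ᶠ[𝓝 p] f := by
    filter_upwards [(isOpen_overChart r he).mem_nhds hp] with x hx
    simp [jetChartSymm_jetChart he hx]
  rw [mfderiv_eq_fderiv] at h1
  have h4 := (h2.mfderiv_eq (I := extModel n r) (I' := 𝓘(ℝ, ℝ))).symm.trans h1
  exact congrArg (fun A : JetSp (Euc n) r →L[ℝ] ℝ => A v) h4

/-- The transition map between natural charts. -/
def jetTrans (r : ℕ) (e e' : OpenPartialHomeomorph Q (Euc n)) (y : JetSp (Euc n) r) :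
    JetSp (Euc n) r := jetChart r e' (jetChartSymm r e y : HTan n r Q × ℝ)

theorem contDiffAt_jetTrans {r : ℕ} {e' : OpenPartialHomeomorph Q (Euc n)}
    (he : e ∈ smoothCharts n Q) (he' : e' ∈ smoothCharts n Q) {p : HTan n r Q × ℝ}
    (hp : p ∈ overChart r e) (hp' : p ∈ overChart r e') :
    ContDiffAt ℝ ∞ (jetTrans r e e') (jetChart r e p) := by
  have h1 := (contMDiffOn_jetChart r he').contMDiffAt (x := p) ((isOpen_overChart r he').mem_nhds hp')
  have h2 := (contMDiffOn_jetChartSymm r he).contMDiffAt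
    ((isOpen_dom_target r e).mem_nhds (jetChart_mem he hp))
  rw [← jetChartSymm_jetChart he hp] at h1
  exact (h1.comp _ h2).contDiffAt

theorem fderiv_jetTrans_dChart {r : ℕ} {e' : OpenPartialHomeomorph Q (Euc n)}
    (he : e ∈ smoothCharts n Q) (he' : e' ∈ smoothCharts n Q) {p : HTan n r Q × ℝ}
    (hp : p ∈ overChart r e) (hp' : p ∈ overChart r e') (v : TangentSpace (extModel n r) p) :
    fderiv ℝ (jetTrans r e e') (jetChart r e p) (dChart r e p v) = dChart r e' p v := by
  have h1 := mfderiv_comp p (((contDiffAt_jetTrans he he' hp hp').differentiableAt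
    (by simp)).mdifferentiableAt) (mdifferentiableAt_jetChart he hp)
  have h2 : jetTrans r e e' ∘ jetChart r e =ᶠ[𝓝 p] jetChart r e' := by
    filter_upwards [(isOpen_overChart r he).mem_nhds hp] with x hx
    simp [jetTrans, jetChartSymm_jetChart he hx]
  rw [mfderiv_eq_fderiv] at h1
  have h4 := (h2.mfderiv_eq (I := extModel n r) (I' := 𝓘(ℝ, JetSp (Euc n) r))).symm.trans h1
  exact (congrArg (fun A : JetSp (Euc n) r →L[ℝ] JetSp (Euc n) r => A v) h4).symm

theorem coordForm_trans {r : ℕ} {e' : OpenPartialHomeomorph Q (Euc n)}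
    (he : e ∈ smoothCharts n Q) (he' : e' ∈ smoothCharts n Q)
    (ξ : OneForm (extModel n r) (HTan n r Q × ℝ)) {y : JetSp (Euc n) r}
    (hy : y ∈ dom e.target r) (hy' : (jetChartSymm r e y : HTan n r Q × ℝ) ∈ overChart r e') :
    coordForm r e ξ y =
      (coordForm r e' ξ (jetTrans r e e' y)).comp (fderiv ℝ (jetTrans r e e') y) := by
  refine ContinuousLinearMap.ext fun u => ?_
  have h1 := form_apply he' ξ hy' (dSymm r e y u)
  rw [← fderiv_jetTrans_dChart he he' (jetChartSymm_mem he hy) hy', dChart_dSymm he hy,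
    jetChart_jetChartSymm he hy] at h1
  exact h1

theorem differentiableAt_ofSubsingleton {F : Type*} [NormedAddCommGroup F] [NormedSpace ℝ F]
    {ζ : F → F →L[ℝ] ℝ} {x : F} (hζ : DifferentiableAt ℝ ζ x) : DifferentiableAt ℝ
      (fun y => ContinuousAlternatingMap.ofSubsingleton ℝ F ℝ (0 : Fin 1) (ζ y)) x :=
  (ContinuousAlternatingMap.ofSubsingletonLIE (𝕜 := ℝ) (E := F) (F := ℝ)
    (0 : Fin 1)).toContinuousLinearEquiv.differentiableAt.comp x hζ

theorem extDeriv_ofSubsingleton {F : Type*} [NormedAddCommGroup F] [NormedSpace ℝ F]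
    {ζ : F → F →L[ℝ] ℝ} {x : F} (hζ : DifferentiableAt ℝ ζ x) (u w : F) :
    extDeriv (fun y => ContinuousAlternatingMap.ofSubsingleton ℝ F ℝ (0 : Fin 1) (ζ y)) x ![u, w] =
      fderiv ℝ ζ x u w - fderiv ℝ ζ x w u := by
  have h : ∀ a b : F, fderiv ℝ (fun y => ζ y a) x b = fderiv ℝ ζ x b a := fun a b => by
    rw [fderiv_clm_apply hζ (differentiableAt_const _)]
    simp
  rw [extDeriv_apply (differentiableAt_ofSubsingleton hζ)]
  simp [Fin.sum_univ_two, Fin.removeNth, h, sub_eq_add_neg]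

/-- The exterior derivative may be computed in any natural chart. -/
theorem extD_apply {r : ℕ} (he : e ∈ smoothCharts n Q)
    {ξ : OneForm (extModel n r) (HTan n r Q × ℝ)} (hξ : ContDiffOn ℝ ∞ (coordForm r e ξ)
      (dom e.target r)) {p : HTan n r Q × ℝ} (hp : p ∈ overChart r e)
    (v w : TangentSpace (extModel n r) p) :
    extD (extModel n r) ξ p ![v, w] =
      fderiv ℝ (coordForm r e ξ) (jetChart r e p) (dChart r e p v) (dChart r e p w) -
      fderiv ℝ (coordForm r e ξ) (jetChart r e p) (dChart r e p w) (dChart r e p v) := by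
  set e₀ := chartAt (Euc n) p.1.base with he₀
  have hs := chart_smooth (n := n) p.1.base
  have hp₀ := mem_over_chartAt p
  have hT : jetTrans r e₀ e (jetChart r e₀ p) = jetChart r e p := by
    rw [jetTrans, jetChartSymm_jetChart hs hp₀]
  have hd : DifferentiableAt ℝ (coordForm r e ξ) (jetTrans r e₀ e (jetChart r e₀ p)) := by
    rw [hT]
    exact differentiableAt_of_dom e.open_target hξ (jetChart_mem he hp)
  have h1 : (fun y => ContinuousAlternatingMap.ofSubsingleton ℝ (JetSp (Euc n) r) ℝ (0 : Fin 1)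
      (coordForm r e₀ ξ y)) =ᶠ[𝓝 (jetChart r e₀ p)] fun y =>
      (ContinuousAlternatingMap.ofSubsingleton ℝ (JetSp (Euc n) r) ℝ (0 : Fin 1)
        (coordForm r e ξ (jetTrans r e₀ e y))).compContinuousLinearMap
          (fderiv ℝ (jetTrans r e₀ e) y) := by
    have hO : ∀ᶠ y in 𝓝 (jetChart r e₀ p), (jetChartSymm r e₀ y : HTan n r Q × ℝ) ∈ overChart r e :=
      ((contMDiffOn_jetChartSymm (Q := Q) r hs).contMDiffAt ((isOpen_dom_target r e₀).mem_nhds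
        (jetChart_mem hs hp₀))).continuousAt.preimage_mem_nhds ((isOpen_overChart r he).mem_nhds
          (by rw [jetChartSymm_jetChart hs hp₀]; exact hp))
    filter_upwards [(isOpen_dom_target r e₀).mem_nhds (jetChart_mem hs hp₀), hO] with y hy hy'
    rw [coordForm_trans hs he ξ hy hy']
    rfl
  -- Naturality of `d` under the transition map; this makes the exterior derivative, defined with
  -- the preferred chart at `p`, computable in any natural chart.
  have h2 : extDeriv (fun y =>
      (ContinuousAlternatingMap.ofSubsingleton ℝ (JetSp (Euc n) r) ℝ (0 : Fin 1)
        (coordForm r e ξ (jetTrans r e₀ e y))).compContinuousLinearMap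
          (fderiv ℝ (jetTrans r e₀ e) y)) (jetChart r e₀ p) =
      (extDeriv (fun y => ContinuousAlternatingMap.ofSubsingleton ℝ (JetSp (Euc n) r) ℝ (0 : Fin 1)
        (coordForm r e ξ y)) (jetTrans r e₀ e (jetChart r e₀ p))).compContinuousLinearMap
          (fderiv ℝ (jetTrans r e₀ e) (jetChart r e₀ p)) :=
    extDeriv_pullback (r := ∞) (differentiableAt_ofSubsingleton hd)
      (contDiffAt_jetTrans hs he hp₀ hp)
      (by simp only [minSmoothness_of_isRCLikeNormedField]; exact ENat.LEInfty.out)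
  have h3 : extD (extModel n r) ξ p ![v, w] =
      extDeriv (fun y => ContinuousAlternatingMap.ofSubsingleton ℝ (JetSp (Euc n) r) ℝ (0 : Fin 1)
        (coordForm r e₀ ξ y)) (jetChart r e₀ p) ![dChart r e₀ p v, dChart r e₀ p w] := by
    change extDeriv (fun y => ContinuousAlternatingMap.ofSubsingleton ℝ (JetSp (Euc n) r) ℝ
      (0 : Fin 1) (coordForm r e₀ ξ y)) (jetChart r e₀ p) (⇑(dChart r e₀ p) ∘ ![v, w]) = _
    congr 1
    ext1 i
    fin_cases i <;> rfl
  rw [h3, h1.extDeriv_eq, h2, ContinuousAlternatingMap.compContinuousLinearMap_apply,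
    ← fderiv_jetTrans_dChart hs he hp₀ hp, ← fderiv_jetTrans_dChart hs he hp₀ hp, ← hT,
    ← extDeriv_ofSubsingleton hd]
  congr 1
  ext1 i
  fin_cases i <;> rfl

end JetCharts

/-! ### Holonomic vectors and `D_L` in natural coordinates. -/

section Transfer

variable {n : ℕ} {Q : Type*} [TopologicalSpace Q] [ChartedSpace (Euc n) Q]
  [IsManifold (𝓡 n) ∞ Q] {e : OpenPartialHomeomorph Q (Euc n)}

/-- The coordinate expression of a canonical lifting. -/
def liftCoord (r : ℕ) (e : OpenPartialHomeomorph Q (Euc n)) (c : Curve n Q) (t : ℝ) :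
    Fin (r + 1) → Euc n := fun α => iteratedDeriv α (e ∘ c) t

theorem contDiffAt_liftCoord (r : ℕ) (he : e ∈ smoothCharts n Q) (c : Curve n Q)
    (hc : c 0 ∈ e.source) : ContDiffAt ℝ ∞ (liftCoord r e c) 0 := by
  have hO : IsOpen (c ⁻¹' e.source) := e.open_source.preimage c.contMDiff.continuous
  have h1 : ContDiffOn ℝ ∞ (e ∘ c) (c ⁻¹' e.source) :=
    contMDiffOn_iff_contDiffOn.1 ((contMDiffOn_of_mem_maximalAtlas he).comp
      c.contMDiff.contMDiffOn (fun _ h => h))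
  have h2 : ContDiffOn ℝ ∞ (fun x : ℝ × ℝ => (e ∘ c) x.2) (Set.univ ×ˢ (c ⁻¹' e.source)) :=
    h1.comp contDiff_snd.contDiffOn (fun x hx => hx.2)
  refine contDiffAt_pi.2 fun α => ?_
  have h3 := (contDiffOn_iteratedDeriv_param (isOpen_univ.prod hO) h2 α).contDiffAt
    (x := (0, 0)) ((isOpen_univ.prod hO).mem_nhds ⟨Set.mem_univ _, hc⟩)
  exact h3.comp (0 : ℝ) (contDiff_const.prodMk contDiff_id : ContDiff ℝ ∞
    (fun t : ℝ => ((0 : ℝ), t))).contDiffAt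

theorem natCoord_canonicalLift (r : ℕ) (he : e ∈ smoothCharts n Q) (c : Curve n Q) {t : ℝ}
    (hc : c t ∈ e.source) : natCoord r e (canonicalLift r c t) = liftCoord r e c t := by
  funext α
  rw [canonicalLift, natCoord_jet r he _ (by change c (0 + t) ∈ e.source; rwa [zero_add])]
  have := congrFun (iteratedDeriv_comp_add_const (α : ℕ) (e ∘ c) t) 0
  simp only [zero_add] at this
  rw [liftCoord, ← this]
  rfl

theorem base_canonicalLift (r : ℕ) (c : Curve n Q) (t : ℝ) : (canonicalLift r c t).base = c t := by
  change c (0 + t) = c t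
  rw [zero_add]

theorem contMDiffAt_canonicalLift (r : ℕ) (he : e ∈ smoothCharts n Q) (c : Curve n Q)
    (hc : c 0 ∈ e.source) :
    ContMDiffAt 𝓘(ℝ, ℝ) (jetModel n r) ∞ (canonicalLift r c) 0 := by
  have h0 : liftCoord r e c 0 ∈ {q : Fin (r + 1) → Euc n | q 0 ∈ e.target} := by
    simpa [liftCoord] using e.map_source hc
  have h1 := ((contMDiffOn_ofNatCoord r he).contMDiffAt
    ((natHomeo r he).open_target.mem_nhds h0)).comp (0 : ℝ)
      (contDiffAt_liftCoord r he c hc).contMDiffAt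
  refine h1.congr_of_eventuallyEq ?_
  filter_upwards [c.contMDiff.continuous.continuousAt.preimage_mem_nhds
    (e.open_source.mem_nhds hc)] with t ht
  rw [Function.comp_apply, ← natCoord_canonicalLift r he c ht]
  exact ((natHomeo r he).left_inv (show (canonicalLift r c t).base ∈ e.source by
    rw [base_canonicalLift]; exact ht)).symm

theorem canonicalLift_zero (r : ℕ) (c : Curve n Q) : canonicalLift r c 0 = jet r c := by
  rw [canonicalLift]
  congr 1
  ext t
  exact congrArg c (add_zero t)

variable {k : ℕ}

/-- The coordinate expression of a Lagrangian. -/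
def coordFun (e : OpenPartialHomeomorph Q (Euc n)) (L : HTan n k Q × ℝ → ℝ)
    (y : JetSp (Euc n) k) : ℝ := L (jetChartSymm k e y)

theorem contDiffOn_coordFun (he : e ∈ smoothCharts n Q) {L : HTan n k Q × ℝ → ℝ}
    (hL : ContMDiff (extModel n k) 𝓘(ℝ, ℝ) ∞ L) :
    ContDiffOn ℝ ∞ (coordFun e L) (dom e.target k) :=
  contMDiffOn_iff_contDiffOn.1 (hL.comp_contMDiffOn (contMDiffOn_jetChartSymm k he))

theorem coordFun_jetChart (he : e ∈ smoothCharts n Q) (L : HTan n k Q × ℝ → ℝ)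
    {p : HTan n k Q × ℝ} (hp : p ∈ overChart k e) : coordFun e L (jetChart k e p) = L p := by
  rw [coordFun, jetChartSymm_jetChart he hp]

/-- The vector is the velocity at `0` of `t ↦ (canonicalLift r c t, z + t L)`, with `c` representing
the jet. In coordinates the lift consists of the derivatives of `e ∘ c` up to order `r`, so
differentiating shifts them by one. -/
theorem dChart_holonomicVec {r : ℕ} (he : e ∈ smoothCharts n Q) (L : HTan n k Q × ℝ → ℝ)
    (h : k ≤ r) {p : HTan n (r + 1) Q × ℝ} (hp : p ∈ overChart (r + 1) e) :
    dChart r e (extProj r.le_succ p) (holonomicVec L h p) =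
      flatHol (coordFun e L) h (jetChart (r + 1) e p) := by
  set c := p.1.rep with hcdef
  have hc : c 0 ∈ e.source := by rw [hcdef, rep_zero]; exact hp
  set l := L (extProj (h.trans r.le_succ) p) with hl
  have hp0 : (canonicalLift r c 0, p.2 + 0 * l) = extProj r.le_succ p := by
    refine Prod.ext ?_ (by simp [extProj])
    rw [canonicalLift_zero]
    change _ = proj r.le_succ p.1
    conv_rhs => rw [← jet_rep p.1]
    rfl
  have hlin : HasDerivAt (fun t : ℝ => p.2 + t * l) l 0 := by
    simpa using ((hasDerivAt_id (0 : ℝ)).mul_const l).const_add p.2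
  have hγ1 := (contMDiffAt_canonicalLift r he c hc).mdifferentiableAt (by simp)
  have hγ2 : MDifferentiableAt 𝓘(ℝ, ℝ) 𝓘(ℝ, ℝ) (fun t : ℝ => p.2 + t * l) 0 :=
    hlin.differentiableAt.mdifferentiableAt
  have hγ := mfderiv_prodMk hγ1 hγ2
  have h1 : mfderiv 𝓘(ℝ, ℝ) (extModel n r) (fun t => (canonicalLift r c t, p.2 + t * l)) 0 (1 : ℝ) =
      (holonomicVec L h p : JetSp (Euc n) r) := by
    rw [hγ]
    refine Prod.ext rfl ?_
    change mfderiv 𝓘(ℝ, ℝ) 𝓘(ℝ, ℝ) (fun t : ℝ => p.2 + t * l) 0 1 = l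
    rw [mfderiv_eq_fderiv]
    exact hlin.deriv
  have hmem : (canonicalLift r c 0, p.2 + 0 * l) ∈ overChart r e := by
    rw [hp0]; exact (extProj_mem_over _).2 hp
  have h2 := mfderiv_comp (0 : ℝ) (mdifferentiableAt_jetChart he hmem) (hγ1.prodMk hγ2)
  have h3 : jetChart r e ∘ (fun t => (canonicalLift r c t, p.2 + t * l)) =ᶠ[𝓝 (0 : ℝ)]
      fun t => (liftCoord r e c t, p.2 + t * l) := by
    filter_upwards [c.contMDiff.continuous.continuousAt.preimage_mem_nhds
      (e.open_source.mem_nhds hc)] with t ht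
    exact Prod.ext (natCoord_canonicalLift r he c ht) rfl
  have hder : HasDerivAt (fun t => (liftCoord r e c t, p.2 + t * l))
      (flatHol (coordFun e L) h (jetChart (r + 1) e p)) 0 := by
    refine HasDerivAt.prodMk ?_ ?_
    · have hd : DifferentiableAt ℝ (liftCoord r e c) 0 :=
        (contDiffAt_liftCoord r he c hc).differentiableAt (by simp)
      refine hasDerivAt_pi.2 fun α => ?_
      have h4 := (differentiableAt_pi.1 hd α).hasDerivAt
      have h5 : deriv (fun x => liftCoord r e c x α) 0 = iteratedDeriv (α + 1) (e ∘ c) 0 := by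
        rw [iteratedDeriv_succ]; rfl
      rw [h5] at h4
      exact h4
    · refine hlin.congr_deriv ?_
      change l = coordFun e L (trunc (h.trans r.le_succ) (jetChart (r + 1) e p))
      rw [← jetChart_extProj (h.trans r.le_succ) he hp,
        coordFun_jetChart he L ((extProj_mem_over _).2 hp)]
  have h6 : mfderiv 𝓘(ℝ, ℝ) 𝓘(ℝ, JetSp (Euc n) r)
      (jetChart r e ∘ (fun t => (canonicalLift r c t, p.2 + t * l))) 0 (1 : ℝ) =
      flatHol (coordFun e L) h (jetChart (r + 1) e p) := by
    have := h3.mfderiv_eq (I := 𝓘(ℝ, ℝ)) (I' := 𝓘(ℝ, JetSp (Euc n) r))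
    rw [mfderiv_eq_fderiv (f := fun t => (liftCoord r e c t, p.2 + t * l))] at this
    exact (congrArg (fun A : ℝ →L[ℝ] JetSp (Euc n) r => A 1) this).trans hder.deriv
  have h7 : dChart r e (canonicalLift r c 0, p.2 + 0 * l) (holonomicVec L h p : JetSp (Euc n) r) =
      flatHol (coordFun e L) h (jetChart (r + 1) e p) := by
    rw [← h6, ← h1]
    exact (congrArg (fun A : ℝ →L[ℝ] JetSp (Euc n) r => A 1) h2).symm
  have h8 : ∀ q, q = extProj r.le_succ p → dChart r e q (holonomicVec L h p : JetSp (Euc n) r) =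
      dChart r e (extProj r.le_succ p) (holonomicVec L h p) := by
    rintro q rfl; rfl
  rw [← h7, ← h8 _ hp0]

theorem lagDz_eq {s : ℕ} (he : e ∈ smoothCharts n Q) {L : HTan n k Q × ℝ → ℝ}
    (hL : ContMDiff (extModel n k) 𝓘(ℝ, ℝ) ∞ L) (h : k ≤ s) {p : HTan n s Q × ℝ}
    (hp : p ∈ overChart s e) :
    lagDz L h p = fderiv ℝ (coordFun e L) (trunc h (jetChart s e p)) (0, 1) := by
  have hy : trunc h (jetChart s e p) ∈ dom e.target k := jetChart_mem he hp
  have hd := (differentiableAt_of_dom e.open_target (contDiffOn_coordFun he hL) hy).hasFDerivAt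
  have h1 : HasDerivAt (fun z : ℝ => ((trunc h (jetChart s e p)).1, z))
      ((0 : Fin (k + 1) → Euc n), (1 : ℝ)) p.2 :=
    (hasDerivAt_const p.2 _).prodMk (hasDerivAt_id p.2)
  have h2 := HasFDerivAt.comp_hasDerivAt (f := fun z : ℝ => ((trunc h (jetChart s e p)).1, z))
    p.2 hd h1
  rw [lagDz, ← h2.deriv]
  congr 1
  funext z
  have hpz : ((proj h p.1, z) : HTan n k Q × ℝ) ∈ overChart k e := by
    change (proj h p.1).base ∈ e.source
    rw [proj_base]; exact hp
  rw [← coordFun_jetChart he L hpz]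
  change _ = coordFun e L ((trunc h (jetChart s e p)).1, z)
  rw [← jetChart_extProj h he hp]
  rfl

theorem contract_apply {V : Type*} [NormedAddCommGroup V] [NormedSpace ℝ V]
    (ξ : V [⋀^Fin 2]→L[ℝ] ℝ) (v w : V) : contract ξ v w = ξ ![v, w] := by
  change ξ (Matrix.vecCons v fun _ => w) = ξ ![v, w]
  congr 1
  ext1 i
  fin_cases i <;> rfl

/-- In Cartan's formula the term `-(∂_u ξ)(Γ)` of `dξ(Γ, u)` cancels against the term `(∂_u ξ)(Γ)`
of `d(ξ(Γ))(u)`. What remains is `(∂_Γ ξ)(u) + ξ(∂_u Γ)`, which depends only on the projected field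
`(q_1, …, q_{r+1}, L)`. -/
theorem DL_apply {r : ℕ} (he : e ∈ smoothCharts n Q) {L : HTan n k Q × ℝ → ℝ}
    (hL : ContMDiff (extModel n k) 𝓘(ℝ, ℝ) ∞ L) (h : k ≤ r)
    {ξ : OneForm (extModel n r) (HTan n r Q × ℝ)}
    (hξ : ContDiffOn ℝ ∞ (coordForm r e ξ) (dom e.target r)) {p : HTan n (r + 1) Q × ℝ}
    (hp : p ∈ overChart (r + 1) e) (v : TangentSpace (extModel n (r + 1)) p) :
    DL L h ξ p v = flatDL (coordFun e L) h (coordForm r e ξ) (jetChart (r + 1) e p)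
      (dChart (r + 1) e p v) := by
  have hℓ := contDiffOn_coordFun he hL
  have hpr : extProj r.le_succ p ∈ overChart r e := (extProj_mem_over _).2 hp
  set y := jetChart (r + 1) e p with hy
  set u := dChart (r + 1) e p v with hu
  have hyd : y ∈ dom e.target (r + 1) := jetChart_mem he hp
  have hyd' : trunc r.le_succ y ∈ dom e.target r := hyd
  have hτ : jetChart r e (extProj r.le_succ p) = trunc r.le_succ y := jetChart_extProj r.le_succ he hp
  have hdτ : dChart r e (extProj r.le_succ p) (mfderiv (extModel n (r + 1)) (extModel n r)
      (extProj r.le_succ) p v) = trunc r.le_succ u := dChart_mfderiv_extProj r.le_succ he hp v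
  have hhol := dChart_holonomicVec he L h hp
  have hdξ := (differentiableAt_of_dom e.open_target hξ hyd').hasFDerivAt
  have hdh := (differentiableAt_of_dom e.open_target
    (contDiffOn_flatHol hℓ h) hyd).hasFDerivAt
  have h1 : extD (extModel n r) ξ (extProj r.le_succ p) ![holonomicVec L h p,
      mfderiv (extModel n (r + 1)) (extModel n r) (extProj r.le_succ) p v] =
      fderiv ℝ (coordForm r e ξ) (trunc r.le_succ y) (flatHol (coordFun e L) h y)
        (trunc r.le_succ u) -
      fderiv ℝ (coordForm r e ξ) (trunc r.le_succ y) (trunc r.le_succ u)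
        (flatHol (coordFun e L) h y) := by
    rw [extD_apply he hξ hpr, hdτ, hhol, hτ]
  have hF := (hdξ.comp y (hasFDerivAt_trunc r.le_succ y)).clm_apply hdh
  have hev : (fun x => (fun q : HTan n (r + 1) Q × ℝ => ξ (extProj r.le_succ q)
      (holonomicVec L h q)) (jetChartSymm (r + 1) e x)) =ᶠ[𝓝 y]
      fun x => coordForm r e ξ (trunc r.le_succ x) (flatHol (coordFun e L) h x) := by
    filter_upwards [(isOpen_dom_target (r + 1) e).mem_nhds hyd] with x hx
    have hx' := jetChartSymm_mem (Q := Q) he hx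
    change ξ (extProj r.le_succ (jetChartSymm (r + 1) e x)) (holonomicVec L h _) = _
    rw [form_apply he ξ ((extProj_mem_over r.le_succ).2 hx'), dChart_holonomicVec he L h hx',
      jetChart_extProj r.le_succ he hx', jetChart_jetChartSymm he hx]
  have hF' := hF.congr_of_eventuallyEq hev
  have h2 := dFun_apply (f := fun q : HTan n (r + 1) Q × ℝ => ξ (extProj r.le_succ q)
    (holonomicVec L h q)) he hp hF'.differentiableAt v
  rw [hF'.fderiv, ← hu] at h2
  have hlag : lagDz L (h.trans r.le_succ) p =
      fderiv ℝ (coordFun e L) (trunc (h.trans r.le_succ) y) (0, 1) := lagDz_eq he hL _ hp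
  have h3 : DL L h ξ p v = extD (extModel n r) ξ (extProj r.le_succ p) ![holonomicVec L h p,
      mfderiv (extModel n (r + 1)) (extModel n r) (extProj r.le_succ) p v] +
      dFun (extModel n (r + 1)) (fun q : HTan n (r + 1) Q × ℝ => ξ (extProj r.le_succ q)
        (holonomicVec L h q)) p v -
      lagDz L (h.trans r.le_succ) p * ξ (extProj r.le_succ p)
        (mfderiv (extModel n (r + 1)) (extModel n r) (extProj r.le_succ) p v) := by
    have h4 : contract (V := (Fin (r + 1) → Euc n) × ℝ)
        (extD (extModel n r) ξ (extProj r.le_succ p)) (holonomicVec L h p)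
        (mfderiv (extModel n (r + 1)) (extModel n r) (extProj r.le_succ) p v) =
        extD (extModel n r) ξ (extProj r.le_succ p) ![holonomicVec L h p,
          mfderiv (extModel n (r + 1)) (extModel n r) (extProj r.le_succ) p v] :=
      contract_apply _ _ _
    rw [← h4]
    rfl
  rw [h3, h1, h2, hlag, form_apply he ξ hpr, hdτ, hτ]
  simp only [flatDL, sub_apply, add_apply, smul_apply, ContinuousLinearMap.comp_apply,
    ContinuousLinearMap.flip_apply, smul_eq_mul, Function.comp_apply]
  ring

end Transfer

/-! ### First variation of the jet of a composition. -/

section Prolongation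

theorem fderiv_fderiv_comm {F : Type*} [NormedAddCommGroup F] [NormedSpace ℝ F]
    {G : Type*} [NormedAddCommGroup G] [NormedSpace ℝ G] {f : G → F} {x : G}
    (hf : ContDiffAt ℝ ∞ f x) (u w : G) :
    fderiv ℝ (fun y => fderiv ℝ f y u) x w = fderiv ℝ (fun y => fderiv ℝ f y w) x u := by
  have hd : DifferentiableAt ℝ (fderiv ℝ f) x :=
    (hf.fderiv_right (m := 1) (by norm_cast)).differentiableAt (by simp)
  rw [← fderiv_fderiv_swap hf, fderiv_clm_apply hd (differentiableAt_const _)]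
  simp

variable {E F : Type*} [NormedAddCommGroup E] [NormedSpace ℝ E]
  [NormedAddCommGroup F] [NormedSpace ℝ F]

theorem iteratedDeriv_succ_param {G : E × ℝ → F} {U : Set (E × ℝ)} (hU : IsOpen U)
    (hG : ContDiffOn ℝ ∞ G U) (j : ℕ) {x : E × ℝ} (hx : x ∈ U) :
    iteratedDeriv (j + 1) (fun t => G (x.1, t)) x.2 =
      fderiv ℝ (fun x : E × ℝ => iteratedDeriv j (fun t => G (x.1, t)) x.2) x (0, 1) := by
  have hd : DifferentiableAt ℝ (fun x : E × ℝ => iteratedDeriv j (fun t => G (x.1, t)) x.2) x :=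
    ((contDiffOn_iteratedDeriv_param hU hG j x hx).contDiffAt
      (hU.mem_nhds hx)).differentiableAt (by simp)
  rw [iteratedDeriv_succ]
  have h1 : HasDerivAt (fun t : ℝ => (x.1, t)) ((0 : E), (1 : ℝ)) x.2 :=
    (hasDerivAt_const x.2 x.1).prodMk (hasDerivAt_id x.2)
  exact (hd.hasFDerivAt.comp_hasDerivAt x.2 h1).deriv

/-- Differentiation in a parameter commutes with iterated differentiation in time. -/
theorem fderiv_iteratedDeriv_param {G : E × ℝ → F} {U : Set (E × ℝ)} (hU : IsOpen U)
    (hG : ContDiffOn ℝ ∞ G U) (v : E) (j : ℕ) : ∀ x ∈ U,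
    fderiv ℝ (fun x : E × ℝ => iteratedDeriv j (fun t => G (x.1, t)) x.2) x (v, 0) =
      iteratedDeriv j (fun t => fderiv ℝ G (x.1, t) (v, 0)) x.2 := by
  have hG' : ContDiffOn ℝ ∞ (fun x => fderiv ℝ G x (v, 0)) U :=
    (hG.fderiv_of_isOpen hU (m := ∞) (by simp)).clm_apply contDiffOn_const
  induction j with
  | zero => intro x _; simp
  | succ j ih =>
    intro x hx
    have h1 : (fun x : E × ℝ => iteratedDeriv (j + 1) (fun t => G (x.1, t)) x.2) =ᶠ[𝓝 x]
        fun x => fderiv ℝ (fun x : E × ℝ => iteratedDeriv j (fun t => G (x.1, t)) x.2) x (0, 1) := by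
      filter_upwards [hU.mem_nhds hx] with x' hx' using iteratedDeriv_succ_param hU hG j hx'
    have h2 : (fun x : E × ℝ => iteratedDeriv j (fun t => fderiv ℝ G (x.1, t) (v, 0)) x.2) =ᶠ[𝓝 x]
        fun x => fderiv ℝ (fun x : E × ℝ => iteratedDeriv j (fun t => G (x.1, t)) x.2) x (v, 0) := by
      filter_upwards [hU.mem_nhds hx] with x' hx' using (ih x' hx').symm
    rw [h1.fderiv_eq, iteratedDeriv_succ_param (G := fun x => fderiv ℝ G x (v, 0)) hU hG' j hx,
      h2.fderiv_eq]
    -- A time derivative is the partial derivative along `(0, 1)`, so the interchange is symmetry of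
    -- second derivatives on `E × ℝ`.
    exact fderiv_fderiv_comm ((contDiffOn_iteratedDeriv_param hU hG j).contDiffAt
      (hU.mem_nhds hx)) _ _

/-- Leibniz's rule, in which `t^a/a!` has only its `a`-th derivative nonzero at `0`. -/
theorem iteratedDeriv_pow_div_smul_fun {h : ℝ → F} (hh : ContDiffAt ℝ ∞ h 0) (a j : ℕ) :
    iteratedDeriv j (fun t : ℝ => (t ^ a / (a.factorial : ℝ)) • h t) 0 =
      if a ≤ j then (j.choose a : ℝ) • iteratedDeriv (j - a) h 0 else 0 := by
  have hp : ContDiff ℝ ∞ (fun t : ℝ => t ^ a / (a.factorial : ℝ)) := by fun_prop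
  have h0 := iteratedDerivWithin_smul (n := j) (Set.mem_univ (0 : ℝ)) uniqueDiffOn_univ
    ((hp.contDiffAt (x := 0)).contDiffWithinAt.of_le (by exact_mod_cast le_top))
    (hh.contDiffWithinAt.of_le (by exact_mod_cast le_top))
  simp only [iteratedDerivWithin_univ] at h0
  have h1 : ∀ i, iteratedDeriv i (fun t : ℝ => t ^ a / (a.factorial : ℝ)) 0 =
      if i = a then 1 else 0 := fun i => by
    simpa using iteratedDeriv_pow_div_smul a (1 : ℝ) i
  refine Eq.trans h0 ?_
  simp only [h1]
  split_ifs with haj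
  · rw [Finset.sum_eq_single a]
    · simp [Nat.cast_smul_eq_nsmul]
    · intro i _ hi
      simp [hi]
    · intro ha
      simp at ha
      omega
  · refine Finset.sum_eq_zero fun i hi => ?_
    have : i ≠ a := by simp at hi; omega
    simp [this]

theorem hasFDerivAt_taylorCurve_param {r : ℕ} (q : Fin (r + 1) → E) (t : ℝ)
    (w : Fin (r + 1) → E) :
    fderiv ℝ (fun x : (Fin (r + 1) → E) × ℝ => taylorCurve x.1 x.2) (q, t) (w, 0) =
      taylorCurve w t := by
  have h1 : DifferentiableAt ℝ (fun x : (Fin (r + 1) → E) × ℝ => taylorCurve x.1 x.2) (q, t) :=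
    (contDiff_taylorCurve (k := r)).differentiable (by simp) _
  have h2 : HasDerivAt (fun s : ℝ => (q + s • w, t)) (w, (0 : ℝ)) 0 := by
    refine HasDerivAt.prodMk ?_ (hasDerivAt_const _ _)
    simpa using ((hasDerivAt_id (0 : ℝ)).smul_const w).const_add q
  have h3 := HasFDerivAt.comp_hasDerivAt (f := fun s : ℝ => (q + s • w, t)) (0 : ℝ)
    (by simpa using h1.hasFDerivAt) h2
  have h4 : HasDerivAt (fun s : ℝ => taylorCurve q t + s • taylorCurve w t) (taylorCurve w t) 0 := by
    simpa using ((hasDerivAt_id (0 : ℝ)).smul_const (taylorCurve w t)).const_add (taylorCurve q t)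
  refine h3.unique (h4.congr_of_eventuallyEq (Filter.Eventually.of_forall fun s => ?_))
  simp only [Function.comp_apply, taylorCurve, Pi.add_apply, Pi.smul_apply, smul_add,
    Finset.sum_add_distrib, Finset.smul_sum]
  congr 1
  exact Finset.sum_congr rfl fun α _ => smul_comm _ _ _

/-- The first variation of the derivatives at `0` of `g ∘ taylorCurve q`. -/
theorem hasFDerivAt_iteratedDeriv_comp_taylorCurve {r : ℕ} {g : E → F} {W : Set E} (hW : IsOpen W)
    (hg : ContDiffOn ℝ ∞ g W) {q : Fin (r + 1) → E} (hq : q 0 ∈ W) (j : ℕ)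
    (w : Fin (r + 1) → E) :
    DifferentiableAt ℝ (fun q => iteratedDeriv j (g ∘ taylorCurve q) 0) q ∧
    fderiv ℝ (fun q => iteratedDeriv j (g ∘ taylorCurve q) 0) q w =
      ∑ a : Fin (r + 1), if (a : ℕ) ≤ j then (j.choose a : ℝ) •
        iteratedDeriv (j - a) (fun t => fderiv ℝ g (taylorCurve q t) (w a)) 0 else 0 := by
  have hT : ContDiff ℝ ∞ (fun x : (Fin (r + 1) → E) × ℝ => taylorCurve x.1 x.2) :=
    contDiff_taylorCurve
  set U := (fun x : (Fin (r + 1) → E) × ℝ => taylorCurve x.1 x.2) ⁻¹' W with hUdef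
  have hU : IsOpen U := hW.preimage hT.continuous
  have hG : ContDiffOn ℝ ∞ (fun x : (Fin (r + 1) → E) × ℝ => g (taylorCurve x.1 x.2)) U :=
    hg.comp hT.contDiffOn (fun _ h => h)
  have hx : (q, (0 : ℝ)) ∈ U := by
    change taylorCurve q 0 ∈ W
    rwa [taylorCurve_zero]
  have hK : DifferentiableAt ℝ (fun x : (Fin (r + 1) → E) × ℝ =>
      iteratedDeriv j (fun t => g (taylorCurve x.1 t)) x.2) (q, 0) :=
    ((contDiffOn_iteratedDeriv_param hU hG j).contDiffAt (hU.mem_nhds hx)).differentiableAt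
      (by simp)
  have hin : HasFDerivAt (fun q : Fin (r + 1) → E => (q, (0 : ℝ)))
      (ContinuousLinearMap.inl ℝ (Fin (r + 1) → E) ℝ) q :=
    (ContinuousLinearMap.inl ℝ (Fin (r + 1) → E) ℝ).hasFDerivAt
  have hcomp := HasFDerivAt.comp (f := fun q : Fin (r + 1) → E => (q, (0 : ℝ))) q hK.hasFDerivAt hin
  refine ⟨hcomp.differentiableAt, ?_⟩
  have h1 := congrArg (fun A => A w) hcomp.fderiv
  refine h1.trans ?_
  change fderiv ℝ (fun x : (Fin (r + 1) → E) × ℝ =>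
      iteratedDeriv j (fun t => g (taylorCurve x.1 t)) x.2) (q, 0) (w, 0) = _
  rw [fderiv_iteratedDeriv_param (G := fun x : (Fin (r + 1) → E) × ℝ => g (taylorCurve x.1 x.2))
    hU hG w j _ hx]
  have hct : ContDiff ℝ ∞ (taylorCurve q) := hT.comp (contDiff_const.prodMk contDiff_id)
  have hO : ∀ᶠ t in 𝓝 (0 : ℝ), taylorCurve q t ∈ W :=
    hct.continuous.continuousAt.preimage_mem_nhds (hW.mem_nhds hx)
  have h2 : (fun t => fderiv ℝ (fun x : (Fin (r + 1) → E) × ℝ => g (taylorCurve x.1 x.2)) (q, t)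
      (w, 0)) =ᶠ[𝓝 0] fun t => ∑ a : Fin (r + 1), (t ^ (a : ℕ) / ((a : ℕ).factorial : ℝ)) •
        fderiv ℝ g (taylorCurve q t) (w a) := by
    filter_upwards [hO] with t ht
    have hgd : DifferentiableAt ℝ g (taylorCurve q t) :=
      (hg.contDiffAt (hW.mem_nhds ht)).differentiableAt (by simp)
    have h3 := HasFDerivAt.comp (f := fun x : (Fin (r + 1) → E) × ℝ => taylorCurve x.1 x.2) (q, t)
      hgd.hasFDerivAt (hT.differentiable (by simp) (q, t)).hasFDerivAt
    refine (congrArg (fun A => A (w, (0 : ℝ))) h3.fderiv).trans ?_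
    simp only [ContinuousLinearMap.comp_apply]
    rw [hasFDerivAt_taylorCurve_param]
    simp only [taylorCurve, map_sum, map_smul]
  have hsm : ∀ u : E, ContDiffAt ℝ ∞ (fun t => fderiv ℝ g (taylorCurve q t) u) 0 := fun u => by
    have h4 : ContDiffAt ℝ ∞ (fderiv ℝ g) (taylorCurve q 0) :=
      (hg.fderiv_of_isOpen hW (m := ∞) (by simp)).contDiffAt (hW.mem_nhds hx)
    exact (h4.comp (0 : ℝ) hct.contDiffAt).clm_apply contDiffAt_const
  rw [h2.iteratedDeriv_eq, iteratedDeriv_fun_sum]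
  · exact Finset.sum_congr rfl fun a _ => iteratedDeriv_pow_div_smul_fun (hsm _) a j
  · intro a _
    have hp : ContDiff ℝ ∞ (fun t : ℝ => t ^ (a : ℕ) / ((a : ℕ).factorial : ℝ)) := by fun_prop
    exact (hp.contDiffAt.smul (hsm _)).of_le (by exact_mod_cast le_top)

end Prolongation

/-! ### Chart independence of the vertical endomorphisms. -/

section VertEndo

variable {n : ℕ} {Q : Type*} [TopologicalSpace Q] [ChartedSpace (Euc n) Q]
  [IsManifold (𝓡 n) ∞ Q] {e e' : OpenPartialHomeomorph Q (Euc n)} {k : ℕ}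

/-- The derivatives of a composition depend only on the jet of the inner curve, so the chosen
representative may be replaced by the Taylor polynomial. This makes the transition map an explicit
function of `q`. -/
theorem natCoord_ofNatCoord (r : ℕ) (he : e ∈ smoothCharts n Q) (he' : e' ∈ smoothCharts n Q)
    {q : Fin (r + 1) → Euc n} (hq : q 0 ∈ e.target ∩ e.symm ⁻¹' e'.source) (α : Fin (r + 1)) :
    natCoord r e' (ofNatCoord r e q : HTan n r Q) α =
      iteratedDeriv α ((e' ∘ e.symm) ∘ taylorCurve q) 0 := by
  have hWo : IsOpen (e.target ∩ e.symm ⁻¹' e'.source) := e.isOpen_inter_preimage_symm e'.open_source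
  have hT : ContDiff ℝ ∞ (fun x : (Fin (r + 1) → Euc n) × ℝ => taylorCurve x.1 x.2) :=
    contDiff_taylorCurve
  obtain ⟨c, hc, hs, hα⟩ := ofNatCoord_spec (Q := Q) r he q hq.1
  have h0 : e (c 0) = q 0 := by simpa using hα 0
  have hs' : c 0 ∈ e'.source := by
    have := hq.2; rwa [Set.mem_preimage, ← h0, e.left_inv hs] at this
  rw [hc, natCoord_jet r he' c hs']
  have hev : (e' ∘ c) =ᶠ[𝓝 0] ((e' ∘ e.symm) ∘ (e ∘ c)) := by
    filter_upwards [c.contMDiff.continuous.continuousAt.preimage_mem_nhds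
      (e.open_source.mem_nhds hs)] with t ht
    simp [e.left_inv ht]
  rw [hev.iteratedDeriv_eq]
  refine iteratedDeriv_comp_congr (k := r) (contDiffAt_chart_comp he c hs)
    (hT.comp (contDiff_const.prodMk contDiff_id)).contDiffAt ?_ ?_ α (Nat.lt_succ_iff.1 α.2)
  · refine (contDiffOn_chart_change he he').contDiffAt (hWo.mem_nhds ?_)
    simpa [h0] using hq
  · intro β hβ
    have h1 := hα ⟨β, Nat.lt_succ_iff.2 hβ⟩
    have h2 := iteratedDeriv_taylorCurve q ⟨β, Nat.lt_succ_iff.2 hβ⟩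
    exact h1.trans h2.symm

theorem fderiv_jetTrans {r : ℕ} (he : e ∈ smoothCharts n Q) (he' : e' ∈ smoothCharts n Q)
    {y : JetSp (Euc n) r} (hy : y.1 0 ∈ e.target ∩ e.symm ⁻¹' e'.source) (w : JetSp (Euc n) r) :
    fderiv ℝ (jetTrans (Q := Q) r e e') y w =
      (fun α : Fin (r + 1) => ∑ a : Fin (r + 1), if (a : ℕ) ≤ α then ((α : ℕ).choose a : ℝ) •
        iteratedDeriv ((α : ℕ) - a)
          (fun t => fderiv ℝ (e' ∘ e.symm) (taylorCurve y.1 t) (w.1 a)) 0 else 0, w.2) := by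
  have hWo : IsOpen (e.target ∩ e.symm ⁻¹' e'.source) := e.isOpen_inter_preimage_symm e'.open_source
  have hev : jetTrans (Q := Q) r e e' =ᶠ[𝓝 y] fun y =>
      (fun α : Fin (r + 1) => iteratedDeriv α ((e' ∘ e.symm) ∘ taylorCurve y.1) 0, y.2) := by
    have : (fun y : JetSp (Euc n) r => y.1 0) ⁻¹' (e.target ∩ e.symm ⁻¹' e'.source) ∈ 𝓝 y :=
      ((continuous_apply 0).comp continuous_fst).continuousAt.preimage_mem_nhds (hWo.mem_nhds hy)
    filter_upwards [this] with x hx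
    exact Prod.ext (funext fun α => natCoord_ofNatCoord r he he' hx α) rfl
  have hα := fun α : Fin (r + 1) => hasFDerivAt_iteratedDeriv_comp_taylorCurve hWo
    (contDiffOn_chart_change he he') hy (α : ℕ) w.1
  have hd : HasFDerivAt (fun y : JetSp (Euc n) r => (fun α : Fin (r + 1) =>
      iteratedDeriv α ((e' ∘ e.symm) ∘ taylorCurve y.1) 0, y.2))
      (((ContinuousLinearMap.pi fun α : Fin (r + 1) =>
        fderiv ℝ (fun q => iteratedDeriv α ((e' ∘ e.symm) ∘ taylorCurve q) 0) y.1).comp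
        (ContinuousLinearMap.fst ℝ _ ℝ)).prod (ContinuousLinearMap.snd ℝ _ ℝ)) y := by
    refine HasFDerivAt.prodMk ?_ hasFDerivAt_snd
    have hpi : HasFDerivAt (fun q : Fin (r + 1) → Euc n => fun α : Fin (r + 1) =>
        iteratedDeriv α ((e' ∘ e.symm) ∘ taylorCurve q) 0) (ContinuousLinearMap.pi
        fun α : Fin (r + 1) =>
          fderiv ℝ (fun q => iteratedDeriv α ((e' ∘ e.symm) ∘ taylorCurve q) 0) y.1) y.1 :=
      hasFDerivAt_pi.2 fun α => (hα α).1.hasFDerivAt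
    exact hpi.comp y (hasFDerivAt_fst (p := y))
  rw [hev.fderiv_eq, hd.fderiv]
  exact Prod.ext (funext fun α => (hα α).2) rfl

theorem fderiv_jetTrans_cv {r : ℕ} (he : e ∈ smoothCharts n Q) (he' : e' ∈ smoothCharts n Q)
    {y : JetSp (Euc n) r} (hy : y.1 0 ∈ e.target ∩ e.symm ⁻¹' e'.source) {a : ℕ} (ha : a ≤ r)
    (v : Euc n) :
    fderiv ℝ (jetTrans (Q := Q) r e e') y (cv (Euc n) r a v) =
      (fun α : Fin (r + 1) => if a ≤ (α : ℕ) then ((α : ℕ).choose a : ℝ) •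
        iteratedDeriv ((α : ℕ) - a)
          (fun t => fderiv ℝ (e' ∘ e.symm) (taylorCurve y.1 t) v) 0 else 0, 0) := by
  rw [fderiv_jetTrans he he' hy]
  refine Prod.ext (funext fun α => ?_) rfl
  refine (Finset.sum_eq_single (⟨a, Nat.lt_succ_iff.2 ha⟩ : Fin (r + 1)) ?_ (fun h => absurd (Finset.mem_univ _) h)).trans ?_
  · intro b _ hb
    have hb' : (b : ℕ) ≠ a := fun h => hb (Fin.ext h)
    simp [cv_apply, hb']
  · simp [cv_apply]

/-- Jet transition maps commute with the vertical endomorphisms. -/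
theorem fderiv_jetTrans_vertCoord (he : e ∈ smoothCharts n Q) (he' : e' ∈ smoothCharts n Q)
    {y : JetSp (Euc n) k} (hy : y.1 0 ∈ e.target ∩ e.symm ⁻¹' e'.source) (β : ℕ)
    (w : JetSp (Euc n) k) :
    fderiv ℝ (jetTrans (Q := Q) k e e') y (vertCoord n k β w) =
      vertCoord n k β (fderiv ℝ (jetTrans (Q := Q) k e e') y w) := by
  -- Encode a variation as the polynomial `w(t) = ∑ w_a t^a/a!`. Then `J_β` is multiplication by
  -- `t^β` up to order `k`, while the prolongation of `g = e' ∘ e.symm` applies `Dg(q(t))` pointwise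
  -- in `t`; the two commute. On basis vectors this is the identity checked below, `C(α, a+β)
  -- (a+β)!/a! = α!/(α-β)! C(α-β, a)`.
  suffices H : (fderiv ℝ (jetTrans (Q := Q) k e e') y).comp (vertCoord n k β) =
      (vertCoord n k β).comp (fderiv ℝ (jetTrans (Q := Q) k e e') y) from
    congrArg (fun A : JetSp (Euc n) k →L[ℝ] JetSp (Euc n) k => A w) H
  refine ext_cv (fun a ha v => ?_) ?_
  · rw [ContinuousLinearMap.comp_apply, ContinuousLinearMap.comp_apply, vertCoord_cv, map_smul,
      fderiv_jetTrans_cv he he' hy ha]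
    refine Prod.ext (funext fun α => ?_) ?_
    · by_cases haβ : a + β ≤ (α : ℕ)
      · rw [fderiv_jetTrans_cv he he' hy (show a + β ≤ k by omega)]
        have h1 : β ≤ (α : ℕ) := by omega
        have h2 : a ≤ (α : ℕ) - β := by omega
        have h3 : (α : ℕ) - β - a = α - (a + β) := by omega
        have hc1 := Nat.choose_mul_factorial_mul_factorial haβ
        have hc2 := Nat.choose_mul_factorial_mul_factorial h2
        simp only [Prod.smul_mk, Pi.smul_apply, haβ, if_true, vertCoord,
          ContinuousLinearMap.comp_apply, ContinuousLinearMap.inl_apply,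
          ContinuousLinearMap.coe_fst', ContinuousLinearMap.pi_apply, h1, h2, smul_apply,
          ContinuousLinearMap.proj_apply, smul_smul, h3]
        congr 1
        rw [h3] at hc2
        rw [← hc1, ← hc2]
        push_cast
        have h4 : (((α : ℕ) - (a + β)).factorial : ℝ) ≠ 0 := by positivity
        have h5 : ((((α : ℕ) - β).choose a : ℕ) : ℝ) ≠ 0 := by
          exact_mod_cast (Nat.choose_pos h2).ne'
        field_simp
      · have hR : (vertCoord n k β ((fun α : Fin (k + 1) => if a ≤ (α : ℕ) then
            ((α : ℕ).choose a : ℝ) • iteratedDeriv ((α : ℕ) - a)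
              (fun t => fderiv ℝ (e' ∘ e.symm) (taylorCurve y.1 t) v) 0 else 0), (0 : ℝ))).1 α =
            0 := by
          by_cases h1 : β ≤ (α : ℕ)
          · have h2 : ¬ a ≤ (α : ℕ) - β := by omega
            simp [vertCoord, h1, h2]
          · simp [vertCoord, h1]
        rw [hR]
        by_cases hk : a + β ≤ k
        · rw [fderiv_jetTrans_cv he he' hy hk]
          simp [haβ]
        · rw [cv_of_lt (by omega)]
          simp
    · have : ∀ x : JetSp (Euc n) k, (vertCoord n k β x).2 = 0 := fun x => rfl
      rw [this]
      by_cases hk : a + β ≤ k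
      · rw [fderiv_jetTrans_cv he he' hy hk]
        simp
      · rw [cv_of_lt (by omega)]
        simp
  · have h1 : fderiv ℝ (jetTrans (Q := Q) k e e') y (0, 1) = (0, 1) := by
      rw [fderiv_jetTrans he he' hy]
      refine Prod.ext (funext fun α => ?_) rfl
      change (∑ a : Fin (k + 1), if (a : ℕ) ≤ (α : ℕ) then ((α : ℕ).choose a : ℝ) •
        iteratedDeriv ((α : ℕ) - a)
          (fun t => fderiv ℝ (e' ∘ e.symm) (taylorCurve y.1 t) (0 : Euc n)) 0 else 0) = 0
      refine Finset.sum_eq_zero fun a _ => ?_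
      simp
    rw [ContinuousLinearMap.comp_apply, ContinuousLinearMap.comp_apply, h1, vertCoord_dz, map_zero]

/-- In the preferred chart at `p` this is the definition of `vertEndo`; commutation with jet
transitions carries it to every other natural chart. -/
theorem dChart_vertEndo (he : e ∈ smoothCharts n Q) (β : ℕ) {p : HTan n k Q × ℝ}
    (hp : p ∈ overChart k e) (v : TangentSpace (extModel n k) p) :
    dChart k e p (vertEndo k β p v) = vertCoord n k β (dChart k e p v) := by
  set e₀ := chartAt (Euc n) p.1.base with he₀
  have hs := chart_smooth (n := n) p.1.base
  have hp₀ := mem_over_chartAt p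
  have hy := jetChart_mem hs hp₀
  have h1 : dChart k e₀ p (vertEndo k β p v) = vertCoord n k β (dChart k e₀ p v) := by
    have h2 := dChart_dSymm (Q := Q) hs hy (vertCoord n k β (dChart k e₀ p v))
    rw [← h2]
    have h3 : ∀ q, q = p → ∀ w : JetSp (Euc n) k,
      (dChart k e₀ q : JetSp (Euc n) k →L[ℝ] JetSp (Euc n) k) w =
      (dChart k e₀ p : JetSp (Euc n) k →L[ℝ] JetSp (Euc n) k) w := by
      rintro q rfl w; rfl
    exact (h3 _ (jetChartSymm_jetChart hs hp₀) _).symm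
  have h0 : (jetChart k e₀ p).1 0 ∈ e₀.target ∩ e₀.symm ⁻¹' e.source := by
    refine ⟨hy, ?_⟩
    rw [Set.mem_preimage]
    have : (jetChart k e₀ p).1 0 = e₀ p.1.base := by simp [jetChart, natCoord]
    rw [this, e₀.left_inv (mem_chart_source (Euc n) p.1.base)]
    exact hp
  rw [← fderiv_jetTrans_dChart hs he hp₀ hp, h1, fderiv_jetTrans_vertCoord hs he h0,
    fderiv_jetTrans_dChart hs he hp₀ hp]

end VertEndo

/-! ### Locality of `D_L`. -/

section FlatCongr

variable {E : Type*} [NormedAddCommGroup E] [NormedSpace ℝ E] {V : Set E} {k : ℕ}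

theorem flatDL_congr (hV : IsOpen V) (ℓ : JetSp E k → ℝ) {r : ℕ} (h : k ≤ r)
    {ξ ξ' : JetSp E r → JetSp E r →L[ℝ] ℝ} (hξ : Set.EqOn ξ ξ' (dom V r)) {y : JetSp E (r + 1)}
    (hy : y ∈ dom V (r + 1)) : flatDL ℓ h ξ y = flatDL ℓ h ξ' y := by
  have hy' : trunc r.le_succ y ∈ dom V r := hy
  have h1 : ξ =ᶠ[𝓝 (trunc r.le_succ y)] ξ' :=
    hξ.eventuallyEq_of_mem ((isOpen_dom hV r).mem_nhds hy')
  rw [flatDL, flatDL, h1.fderiv_eq, hξ hy']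

end FlatCongr

/-! ### Cartan and contact forms in natural coordinates. -/

section CartanCoord

variable {n k : ℕ} {Q : Type*} [TopologicalSpace Q] [ChartedSpace (Euc n) Q]
  [IsManifold (𝓡 n) ∞ Q] {e : OpenPartialHomeomorph Q (Euc n)}

theorem coordForm_vertForm (he : e ∈ smoothCharts n Q) {L : HTan n k Q × ℝ → ℝ}
    (hL : ContMDiff (extModel n k) 𝓘(ℝ, ℝ) ∞ L) (β : ℕ) {y : JetSp (Euc n) k}
    (hy : y ∈ dom e.target k) :
    coordForm k e (fun q => (dFun (extModel n k) L q).comp (vertEndo k β q)) y =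
      vertForm (coordFun e L) β y := by
  refine coordForm_eq_of_forall (ζ := vertForm (coordFun e L) β) he (fun p hp v => ?_) hy
  have hd : DifferentiableAt ℝ (coordFun e L) (jetChart k e p) :=
    differentiableAt_of_dom e.open_target (contDiffOn_coordFun he hL) (jetChart_mem he hp)
  have h1 := dFun_apply he hp hd (vertEndo k β p v)
  rw [dChart_vertEndo he β hp v] at h1
  exact h1

-- Each stage needs smoothness of the previous iterate, since `D_L` differentiates it; this is
-- imported from the coordinate model through the inductive hypothesis.
theorem coordForm_DLiter (he : e ∈ smoothCharts n Q) {L : HTan n k Q × ℝ → ℝ}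
    (hL : ContMDiff (extModel n k) 𝓘(ℝ, ℝ) ∞ L) (β m : ℕ) :
    Set.EqOn (coordForm (k + m) e
      (DLiter L (fun q => (dFun (extModel n k) L q).comp (vertEndo k β q)) m))
      (flatDLiter (coordFun e L) (vertForm (coordFun e L) β) m) (dom e.target (k + m)) := by
  have hV := e.open_target
  have hℓ := contDiffOn_coordFun he hL
  induction m with
  | zero => exact fun y hy => coordForm_vertForm he hL β hy
  | succ m ih =>
    have hs : ContDiffOn ℝ ∞ (coordForm (k + m) e
        (DLiter L (fun q => (dFun (extModel n k) L q).comp (vertEndo k β q)) m))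
        (dom e.target (k + m)) :=
      (contDiffOn_flatDLiter hV hℓ (contDiffOn_vertForm hV hℓ β) m).congr ih
    intro y hy
    refine coordForm_eq_of_forall (r := k + m + 1)
      (ζ := flatDLiter (coordFun e L) (vertForm (coordFun e L) β) (m + 1)) he
      (fun p hp v => ?_) hy
    refine (DL_apply he hL (Nat.le_add_right k m) hs hp v).trans ?_
    rw [flatDL_congr hV (coordFun e L) (Nat.le_add_right k m) ih (jetChart_mem he hp)]
    rfl

theorem cartanForm_apply (he : e ∈ smoothCharts n Q) {L : HTan n k Q × ℝ → ℝ}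
    (hL : ContMDiff (extModel n k) 𝓘(ℝ, ℝ) ∞ L) {p : HTan n (2 * k - 1) Q × ℝ}
    (hp : p ∈ overChart (2 * k - 1) e) (v : TangentSpace (extModel n (2 * k - 1)) p) :
    cartanForm L p v = flatTheta (coordFun e L) (jetChart (2 * k - 1) e p)
      (dChart (2 * k - 1) e p v) := by
  rw [flatTheta_apply, cartanForm, sum_apply]
  refine Finset.sum_congr rfl fun m _ => ?_
  have h : k + (m : ℕ) ≤ 2 * k - 1 := by omega
  have hp' : extProj h p ∈ overChart (k + m) e := (extProj_mem_over h).2 hp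
  rw [smul_apply, smul_eq_mul]
  congr 1
  change DLiter L _ m (extProj h p) (mfderiv _ _ (extProj h) p v) = _
  rw [form_apply he _ hp', coordForm_DLiter he hL _ _ (jetChart_mem he hp'),
    jetChart_extProj h he hp, dChart_mfderiv_extProj h he hp]

/-- The coordinate expression of the contact form. -/
def flatEta (ℓ : JetSp (Euc n) k → ℝ) (y : JetSp (Euc n) (2 * k - 1)) :
    JetSp (Euc n) (2 * k - 1) →L[ℝ] ℝ :=
  ContinuousLinearMap.snd ℝ _ ℝ - flatTheta ℓ y

theorem contactForm_apply (he : e ∈ smoothCharts n Q) {L : HTan n k Q × ℝ → ℝ}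
    (hL : ContMDiff (extModel n k) 𝓘(ℝ, ℝ) ∞ L) {p : HTan n (2 * k - 1) Q × ℝ}
    (hp : p ∈ overChart (2 * k - 1) e) (v : TangentSpace (extModel n (2 * k - 1)) p) :
    contactForm L p v = flatEta (coordFun e L) (jetChart (2 * k - 1) e p)
      (dChart (2 * k - 1) e p v) := by
  have h1 := dFun_apply (f := Prod.snd) he hp differentiableAt_snd v
  have h2 : fderiv ℝ (fun y : JetSp (Euc n) (2 * k - 1) =>
      (jetChartSymm (2 * k - 1) e y : HTan n (2 * k - 1) Q × ℝ).2) (jetChart (2 * k - 1) e p) =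
      ContinuousLinearMap.snd ℝ _ ℝ := fderiv_snd
  rw [h2] at h1
  rw [contactForm, sub_apply, cartanForm_apply he hL hp, h1]
  rfl

theorem coordForm_contactForm (he : e ∈ smoothCharts n Q) {L : HTan n k Q × ℝ → ℝ}
    (hL : ContMDiff (extModel n k) 𝓘(ℝ, ℝ) ∞ L) :
    Set.EqOn (coordForm (2 * k - 1) e (contactForm L)) (flatEta (coordFun e L))
      (dom e.target (2 * k - 1)) :=
  fun _ hy => coordForm_eq_of_forall he (fun _ hp v => contactForm_apply he hL hp v) hy

theorem contDiffOn_flatEta {V : Set (Euc n)} (hV : IsOpen V) {ℓ : JetSp (Euc n) k → ℝ}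
    (hℓ : ContDiffOn ℝ ∞ ℓ (dom V k)) : ContDiffOn ℝ ∞ (flatEta ℓ) (dom V (2 * k - 1)) :=
  contDiffOn_const.sub (contDiffOn_flatTheta hV hℓ)

/-- `dη_L = -dθ_L` because `dz` has constant coefficients; the sign is absorbed by exchanging the
two arguments. -/
theorem extD_contactForm (he : e ∈ smoothCharts n Q) {L : HTan n k Q × ℝ → ℝ}
    (hL : ContMDiff (extModel n k) 𝓘(ℝ, ℝ) ∞ L) {p : HTan n (2 * k - 1) Q × ℝ}
    (hp : p ∈ overChart (2 * k - 1) e) (v w : TangentSpace (extModel n (2 * k - 1)) p) :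
    extD (extModel n (2 * k - 1)) (contactForm L) p ![v, w] =
      fderiv ℝ (flatTheta (coordFun e L)) (jetChart (2 * k - 1) e p)
        (dChart (2 * k - 1) e p w) (dChart (2 * k - 1) e p v) -
      fderiv ℝ (flatTheta (coordFun e L)) (jetChart (2 * k - 1) e p)
        (dChart (2 * k - 1) e p v) (dChart (2 * k - 1) e p w) := by
  have hV := e.open_target
  have hℓ := contDiffOn_coordFun he hL
  have heq := coordForm_contactForm he hL
  have hy := jetChart_mem he hp
  rw [extD_apply he ((contDiffOn_flatEta hV hℓ).congr heq) hp,
    (heq.eventuallyEq_of_mem ((isOpen_dom hV _).mem_nhds hy)).fderiv_eq]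
  have h1 : fderiv ℝ (flatEta (coordFun e L)) (jetChart (2 * k - 1) e p) =
      - fderiv ℝ (flatTheta (coordFun e L)) (jetChart (2 * k - 1) e p) :=
    fderiv_const_sub _
  rw [h1]
  simp only [neg_apply]
  ring

end CartanCoord

/-! ### Regularity of the momenta versus regularity of the Hessian. -/

section FlatLegendre

variable {n k : ℕ} {V : Set (Euc n)} {ℓ : JetSp (Euc n) k → ℝ} {y : JetSp (Euc n) (2 * k - 1)}

/-- The Hessian form of `ℓ` along the top derivatives is nondegenerate. -/
def TopRegular (ℓ : JetSp (Euc n) k → ℝ) (x : JetSp (Euc n) k) : Prop :=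
  ∀ w, (∀ v, topHess ℓ x w v = 0) → w = 0

variable (ℓ y) in
/-- The coordinates `(q₀, …, q_{k-1}, z)` and the momenta have independent differentials. -/
def MomentaRegular : Prop :=
  ∀ u : JetSp (Euc n) (2 * k - 1), (∀ α : Fin (2 * k - 1 + 1), (α : ℕ) < k → u.1 α = 0) →
    u.2 = 0 → (∀ a < k, ∀ v, fderiv ℝ (flatTheta ℓ) y u (cv _ (2 * k - 1) a v) = 0) → u = 0

theorem differentiableAt_flatTheta (hV : IsOpen V) (hℓ : ContDiffOn ℝ ∞ ℓ (dom V k))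
    (hy : y ∈ dom V (2 * k - 1)) : DifferentiableAt ℝ (flatTheta ℓ) y :=
  differentiableAt_of_dom hV (contDiffOn_flatTheta hV hℓ) hy

theorem fderiv_flatTheta_apply (hV : IsOpen V) (hℓ : ContDiffOn ℝ ∞ ℓ (dom V k))
    (hy : y ∈ dom V (2 * k - 1)) (u w : JetSp (Euc n) (2 * k - 1)) :
    fderiv ℝ (flatTheta ℓ) y u w = fderiv ℝ (fun x => flatTheta ℓ x w) y u := by
  rw [fderiv_clm_apply (differentiableAt_flatTheta hV hℓ hy) (differentiableAt_const _)]
  simp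

theorem fderiv_flatTheta_eq_zero (hV : IsOpen V) (hy : y ∈ dom V (2 * k - 1))
    (hℓ : ContDiffOn ℝ ∞ ℓ (dom V k)) (u : JetSp (Euc n) (2 * k - 1))
    {w : JetSp (Euc n) (2 * k - 1)} (hw : ∀ x ∈ dom V (2 * k - 1), flatTheta ℓ x w = 0) :
    fderiv ℝ (flatTheta ℓ) y u w = 0 := by
  have h : (fun x => flatTheta ℓ x w) =ᶠ[𝓝 y] fun _ => 0 :=
    Filter.eventuallyEq_of_mem ((isOpen_dom hV _).mem_nhds hy) hw
  rw [fderiv_flatTheta_apply hV hℓ hy, h.fderiv_eq]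
  simp

theorem fderiv_flatTheta_cv_eq_zero (hV : IsOpen V) (hy : y ∈ dom V (2 * k - 1))
    (hℓ : ContDiffOn ℝ ∞ ℓ (dom V k)) (u : JetSp (Euc n) (2 * k - 1)) {a : ℕ} (ha : k ≤ a)
    (v : Euc n) : fderiv ℝ (flatTheta ℓ) y u (cv _ (2 * k - 1) a v) = 0 :=
  fderiv_flatTheta_eq_zero hV hy hℓ u fun _ hx => flatTheta_cv_eq_zero hV hℓ hx ha v

theorem fderiv_flatTheta_dz (hV : IsOpen V) (hy : y ∈ dom V (2 * k - 1))
    (hℓ : ContDiffOn ℝ ∞ ℓ (dom V k)) (u : JetSp (Euc n) (2 * k - 1)) :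
    fderiv ℝ (flatTheta ℓ) y u (0, 1) = 0 :=
  fderiv_flatTheta_eq_zero hV hy hℓ u fun _ hx => flatTheta_dz hV hℓ hx

/-- A covector annihilating `dz` and the `q_a`, `a ≥ k`, is determined by its components along
`q₀, …, q_{k-1}`. -/
theorem semibasic_apply (A : JetSp (Euc n) (2 * k - 1) →L[ℝ] ℝ)
    (hA : ∀ a, k ≤ a → ∀ v, A (cv _ (2 * k - 1) a v) = 0) (hz : A (0, 1) = 0)
    (w : JetSp (Euc n) (2 * k - 1)) :
    A w = ∑ a : Fin k, A (cv _ (2 * k - 1) a (w.1 ⟨a, by omega⟩)) := by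
  have hz' : ((0 : Fin (2 * k - 1 + 1) → Euc n), w.2) =
      w.2 • ((0 : Fin (2 * k - 1 + 1) → Euc n), (1 : ℝ)) := by simp
  conv_lhs => rw [eq_sum_cv w, hz', map_add, map_smul, hz, smul_zero, add_zero, map_sum]
  symm
  refine Finset.sum_of_injOn (fun a : Fin k => (⟨a, by omega⟩ : Fin (2 * k - 1 + 1)))
    (fun a _ b _ h => Fin.ext (by simpa using h)) (fun _ _ => Finset.mem_coe.2 (Finset.mem_univ _))
    (fun b _ hb => hA b ?_ _) (fun a _ => rfl)
  by_contra h
  exact hb ⟨⟨b, by omega⟩, Finset.mem_coe.2 (Finset.mem_univ _), rfl⟩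

theorem fderiv_flatTheta_cv (hV : IsOpen V) (hℓ : ContDiffOn ℝ ∞ ℓ (dom V k))
    (hy : y ∈ dom V (2 * k - 1)) {a : ℕ} (ha : a < k) (v : Euc n) {b : ℕ} (w : Euc n) :
    (2 * k - 1 - a < b → fderiv ℝ (flatTheta ℓ) y (cv _ (2 * k - 1) b w)
      (cv _ (2 * k - 1) a v) = 0) ∧
    (b = 2 * k - 1 - a → fderiv ℝ (flatTheta ℓ) y (cv _ (2 * k - 1) b w) (cv _ (2 * k - 1) a v) =
      (-1) ^ (k - 1 - a) * topHess ℓ (trunc (show k ≤ 2 * k - 1 by omega) y) w v) := by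
  rw [fderiv_flatTheta_apply hV hℓ hy]
  exact (hasTop_flatTheta hV hℓ ha v).2 y hy b w

/-- If the Hessian form is regular then so are the momenta, by their triangular structure. -/
theorem momentaRegular_of_topRegular (hk : 1 ≤ k) (hV : IsOpen V) (hℓ : ContDiffOn ℝ ∞ ℓ (dom V k))
    (hy : y ∈ dom V (2 * k - 1))
    (h : TopRegular ℓ (trunc (show k ≤ 2 * k - 1 by omega) y)) : MomentaRegular ℓ y := by
  intro u hu hz hm
  have key : ∀ b, ∀ hb : b < 2 * k - 1 + 1, u.1 ⟨b, hb⟩ = 0 := by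
    intro b
    induction b using Nat.strong_induction_on with
    | _ b ih =>
      intro hb
      by_cases hbk : b < k
      · exact hu ⟨b, hb⟩ hbk
      -- The coordinate `u_b` is isolated by the momentum `θ_{2k-1-b}`, whose top index is exactly
      -- `b`: components below `b` vanish by induction, those above do not enter, and the
      -- coefficient of `u_b` is `±` the Hessian.
      have ha : 2 * k - 1 - b < k := by omega
      refine h _ fun v => ?_
      have h1 := hm _ ha v
      have hz' : ((0 : Fin (2 * k - 1 + 1) → Euc n), u.2) = 0 := by rw [hz]; rfl
      rw [eq_sum_cv u, hz', add_zero, map_sum, sum_apply, Finset.sum_eq_single ⟨b, hb⟩] at h1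
      · rw [(fderiv_flatTheta_cv hV hℓ hy ha v _).2
          (show b = 2 * k - 1 - (2 * k - 1 - b) by omega)] at h1
        exact (mul_eq_zero.1 h1).resolve_left (pow_ne_zero _ (by norm_num))
      · intro c _ hc
        rcases lt_or_gt_of_ne (fun h => hc (Fin.ext h) : (c : ℕ) ≠ b) with hcb | hcb
        · rw [ih c hcb c.2]
          simp
        · exact (fderiv_flatTheta_cv hV hℓ hy ha v _).1 (by omega)
      · exact fun h => absurd (Finset.mem_univ _) h
  exact Prod.ext (funext fun b => key b b.2) hz

/-- The kernel of `∂²ℓ/∂q_k∂q_k` lifts to the characteristic directions of `dz - θ`. -/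
theorem flatEta_cv_top (hk : 1 ≤ k) (hV : IsOpen V) (hℓ : ContDiffOn ℝ ∞ ℓ (dom V k))
    (hy : y ∈ dom V (2 * k - 1)) (w : Euc n) :
    flatEta ℓ y (cv _ (2 * k - 1) (2 * k - 1) w) = 0 := by
  rw [flatEta, sub_apply, flatTheta_cv_eq_zero hV hℓ hy (by omega), sub_zero]
  simp [cv_apply]

/-- The first term vanishes because `θ` has no `dq_{2k-1}`-component at any point. In the second,
`θ_a` with `a > 0` does not depend on `q_{2k-1}`, and `∂θ_0/∂q_{2k-1}` is `±` the Hessian, which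
kills `w`. -/
theorem fderiv_flatTheta_cv_top (hk : 1 ≤ k) (hV : IsOpen V) (hℓ : ContDiffOn ℝ ∞ ℓ (dom V k))
    (hy : y ∈ dom V (2 * k - 1)) {w : Euc n}
    (hw : ∀ v, topHess ℓ (trunc (show k ≤ 2 * k - 1 by omega) y) w v = 0)
    (u : JetSp (Euc n) (2 * k - 1)) :
    fderiv ℝ (flatTheta ℓ) y u (cv _ (2 * k - 1) (2 * k - 1) w) -
      fderiv ℝ (flatTheta ℓ) y (cv _ (2 * k - 1) (2 * k - 1) w) u = 0 := by
  rw [fderiv_flatTheta_cv_eq_zero hV hy hℓ u (show k ≤ 2 * k - 1 by omega), zero_sub, neg_eq_zero,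
    semibasic_apply _ (fun a ha v => fderiv_flatTheta_cv_eq_zero hV hy hℓ _ ha v)
      (fderiv_flatTheta_dz hV hy hℓ _)]
  refine Finset.sum_eq_zero fun a _ => ?_
  by_cases ha : (a : ℕ) = 0
  · rw [(fderiv_flatTheta_cv hV hℓ hy a.2 _ w).2 (by omega), hw, mul_zero]
  · exact (fderiv_flatTheta_cv hV hℓ hy a.2 _ w).1 (by omega)

/-- Darboux form at a point: `e = dq_a^i`, `f = dθ_{a,i}` for `a < k`. Because `θ` is semibasic, the
equations `η(u) = 0` and `dq_a(u) = 0` already force `dz(u) = 0`, so the kernel condition reduces to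
`MomentaRegular`. -/
theorem exists_coords_of_momentaRegular (hV : IsOpen V) (hℓ : ContDiffOn ℝ ∞ ℓ (dom V k))
    (hy : y ∈ dom V (2 * k - 1)) (h : MomentaRegular ℓ y) :
    ∃ e f : Fin (k * n) → JetSp (Euc n) (2 * k - 1) →L[ℝ] ℝ,
      (∀ u w, fderiv ℝ (flatTheta ℓ) y w u - fderiv ℝ (flatTheta ℓ) y u w =
        ∑ j, (e j u * f j w - f j u * e j w)) ∧
      ∀ u, flatEta ℓ y u = 0 → (∀ j, e j u = 0) → (∀ j, f j u = 0) → u = 0 := by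
  let e : Fin k × Fin n → JetSp (Euc n) (2 * k - 1) →L[ℝ] ℝ := fun j =>
    (EuclideanSpace.proj j.2).comp ((ContinuousLinearMap.proj (R := ℝ)
      (φ := fun _ : Fin (2 * k - 1 + 1) => Euc n) ⟨j.1, by omega⟩).comp
        (ContinuousLinearMap.fst ℝ _ ℝ))
  let f : Fin k × Fin n → JetSp (Euc n) (2 * k - 1) →L[ℝ] ℝ := fun j =>
    (ContinuousLinearMap.apply ℝ ℝ
      (cv (Euc n) (2 * k - 1) j.1 (EuclideanSpace.single j.2 1))).comp (fderiv ℝ (flatTheta ℓ) y)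
  have he : ∀ j u, e j u = u.1 ⟨j.1, by omega⟩ j.2 := fun j u => rfl
  have hf : ∀ j u, f j u = fderiv ℝ (flatTheta ℓ) y u
    (cv (Euc n) (2 * k - 1) j.1 (EuclideanSpace.single j.2 1)) := fun j u => rfl
  have hcv : ∀ (A : JetSp (Euc n) (2 * k - 1) →L[ℝ] ℝ) (a : ℕ) (v : Euc n),
      A (cv _ (2 * k - 1) a v) =
        ∑ i, v i * A (cv _ (2 * k - 1) a (EuclideanSpace.single i 1)) := by
    intro A a v
    have hv : v = ∑ i, v i • EuclideanSpace.single i (1 : ℝ) := by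
      ext i; simp [Pi.single_apply]
    conv_lhs => rw [hv, map_sum, map_sum]
    simp
  have hsum : ∀ u w, fderiv ℝ (flatTheta ℓ) y w u = ∑ j, e j u * f j w := by
    intro u w
    rw [semibasic_apply _ (fun a ha v => fderiv_flatTheta_cv_eq_zero hV hy hℓ _ ha v)
      (fderiv_flatTheta_dz hV hy hℓ _), Fintype.sum_prod_type]
    exact Finset.sum_congr rfl fun a _ => hcv _ _ _
  refine ⟨e ∘ finProdFinEquiv.symm, f ∘ finProdFinEquiv.symm, fun u w => ?_, fun u hη h1 h2 => ?_⟩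
  · rw [hsum, hsum, ← Finset.sum_sub_distrib]
    refine (Equiv.sum_comp finProdFinEquiv.symm
      (fun j => e j u * f j w - e j w * f j u)).symm.trans (Finset.sum_congr rfl fun j _ => ?_)
    simp only [Function.comp_apply]
    ring
  · have h1' : ∀ j, e j u = 0 := fun j => by simpa using h1 (finProdFinEquiv j)
    have h2' : ∀ j, f j u = 0 := fun j => by simpa using h2 (finProdFinEquiv j)
    have h3 : ∀ α : Fin (2 * k - 1 + 1), (α : ℕ) < k → u.1 α = 0 := fun α hα => by
      ext i; exact h1' (⟨α, hα⟩, i)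
    refine h u h3 ?_ fun a ha v => ?_
    · have h4 : u.2 - flatTheta ℓ y u = 0 := hη
      rw [semibasic_apply _ (fun a ha v => flatTheta_cv_eq_zero hV hℓ hy ha v)
        (flatTheta_dz hV hℓ hy), Finset.sum_eq_zero, sub_zero] at h4
      · exact h4
      · intro a _
        rw [h3 _ a.2]
        simp
    · rw [hcv]
      exact Finset.sum_eq_zero fun i _ => by
        have := h2' (⟨a, ha⟩, i)
        rw [hf] at this
        rw [this, mul_zero]

end FlatLegendre

/-! ### Cotangent coordinates and local diffeomorphisms. -/

section Cotangents

variable {E : Type*} [NormedAddCommGroup E] [NormedSpace ℝ E] {H : Type*} [TopologicalSpace H]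
  {I : ModelWithCorners ℝ E H} {M : Type*} [TopologicalSpace M] [ChartedSpace H M]
  {E' : Type*} [NormedAddCommGroup E'] [NormedSpace ℝ E'] {H' : Type*} [TopologicalSpace H']
  {J : ModelWithCorners ℝ E' H'} {N : Type*} [TopologicalSpace N] [ChartedSpace H' N]

/-- The target bundle is trivial, so only the tangent trivialization acts, and its inverse on fibres
is the derivative of the inverse chart. -/
theorem inCoordinates_cotangent [I.Boundaryless] [IsManifold I 1 M] {x₀ x : M}
    (hx : x ∈ (chartAt H x₀).source) (φ : E →L[ℝ] ℝ) :
    ContinuousLinearMap.inCoordinates E (TangentSpace I : M → Type _) ℝ (Bundle.Trivial M ℝ)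
      x₀ x x₀ x φ =
    φ.comp (mfderiv 𝓘(ℝ, E) I (extChartAt I x₀).symm (extChartAt I x₀ x) : E →L[ℝ] E) := by
  have h : ((trivializationAt E (TangentSpace I) x₀).symmL ℝ x : E →L[ℝ] E) =
      (mfderiv 𝓘(ℝ, E) I (extChartAt I x₀).symm (extChartAt I x₀ x) : E →L[ℝ] E) := by
    have h1 := TangentBundle.symmL_trivializationAt (I := I) hx
    rw [I.range_eq_univ, mfderivWithin_univ] at h1
    exact h1
  rw [← h]
  refine ContinuousLinearMap.ext fun v => ?_
  have h2 : (trivializationAt ℝ (Bundle.Trivial M ℝ) x₀).continuousLinearMapAt ℝ x =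
    ContinuousLinearMap.id ℝ ℝ := by simp
  exact congrArg (fun A : ℝ →L[ℝ] ℝ => A (φ ((trivializationAt E (TangentSpace I) x₀).symmL ℝ x v)))
    h2

/-- The inverse of a chart is a local diffeomorphism. -/
theorem isLocalDiffeomorphAt_extChartAt [I.Boundaryless] [IsManifold I ∞ M] (x : M) {y : M}
    (hy : y ∈ (extChartAt I x).source) :
    IsLocalDiffeomorphAt I 𝓘(ℝ, E) ∞ (extChartAt I x) y :=
  ⟨{ toPartialEquiv := extChartAt I x
     open_source := isOpen_extChartAt_source x
     open_target := isOpen_extChartAt_target x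
     contMDiffOn_toFun := by
       have := contMDiffOn_extChartAt (I := I) (n := ∞) (x := x)
       rwa [← extChartAt_source I] at this
     contMDiffOn_invFun := contMDiffOn_extChartAt_symm x }, hy, fun _ _ => rfl⟩

theorem isLocalDiffeomorphAt_extChartAt_symm [I.Boundaryless] [IsManifold I ∞ M] (x : M) {y : E}
    (hy : y ∈ (extChartAt I x).target) :
    IsLocalDiffeomorphAt 𝓘(ℝ, E) I ∞ (extChartAt I x).symm y :=
  ⟨{ toPartialEquiv := (extChartAt I x).symm
     open_source := isOpen_extChartAt_target x
     open_target := isOpen_extChartAt_source x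
     contMDiffOn_toFun := contMDiffOn_extChartAt_symm x
     contMDiffOn_invFun := by
       have := contMDiffOn_extChartAt (I := I) (n := ∞) (x := x)
       rwa [← extChartAt_source I] at this }, hy, fun _ _ => rfl⟩

theorem _root_.IsLocalDiffeomorphAt.congr_of_eqOn {f g : M → N} {x : M} {s : Set M}
    (hf : IsLocalDiffeomorphAt I J ∞ f x) (hs : IsOpen s) (hx : x ∈ s) (h : Set.EqOn g f s) :
    IsLocalDiffeomorphAt I J ∞ g x := by
  obtain ⟨Φ, hxΦ, hΦ⟩ := hf
  refine ⟨{ toPartialEquiv := Φ.toPartialEquiv.restr s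
            open_source := Φ.open_source.inter hs
            open_target := ?_
            contMDiffOn_toFun := Φ.contMDiffOn_toFun.mono Set.inter_subset_left
            contMDiffOn_invFun := Φ.contMDiffOn_invFun.mono Set.inter_subset_left },
    ⟨hxΦ, hx⟩, fun y hy => (h hy.2).trans (hΦ hy.1)⟩
  exact Φ.contMDiffOn_invFun.continuousOn.isOpen_inter_preimage Φ.open_target hs

/-- The inverse function theorem. -/
theorem isLocalDiffeomorphAt_of_fderiv_injective [FiniteDimensional ℝ E] [FiniteDimensional ℝ E']
    (hE : Module.finrank ℝ E = Module.finrank ℝ E') {f : E → E'} {s : Set E} (hs : IsOpen s)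
    (hf : ContDiffOn ℝ ∞ f s) {x : E} (hx : x ∈ s)
    (hinj : ∀ y ∈ s, ∀ u, fderiv ℝ f y u = 0 → u = 0) :
    IsLocalDiffeomorphAt 𝓘(ℝ, E) 𝓘(ℝ, E') ∞ f x := by
  have hat : ∀ y ∈ s, ContDiffAt ℝ ∞ f y := fun y hy => (hf y hy).contDiffAt (hs.mem_nhds hy)
  have hd : ∀ y ∈ s, ∃ A : E ≃L[ℝ] E', HasFDerivAt f (A : E →L[ℝ] E') y := by
    intro y hy
    have hi : Function.Injective (fderiv ℝ f y : E →ₗ[ℝ] E') :=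
      (injective_iff_map_eq_zero _).2 (hinj y hy)
    refine ⟨(LinearEquiv.ofInjectiveOfFinrankEq (fderiv ℝ f y : E →ₗ[ℝ] E') hi
      hE).toContinuousLinearEquiv, ?_⟩
    have h := ((hat y hy).differentiableAt (by simp)).hasFDerivAt
    convert h using 1
    ext u
    rfl
  have : CompleteSpace E := FiniteDimensional.complete ℝ E
  obtain ⟨A, hA⟩ := hd x hx
  let Φ := (hat x hx).toOpenPartialHomeomorph f hA (by simp)
  have hΦ : ∀ y, Φ y = f y := fun _ => rfl
  have hxΦ : x ∈ Φ.source := (hat x hx).mem_toOpenPartialHomeomorph_source hA (by simp)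
  -- Restricting the local inverse to `s` keeps the derivative invertible throughout the source,
  -- which is what makes the inverse smooth on the whole target and not only at the image of `x`.
  refine ⟨{ toPartialEquiv := Φ.toPartialEquiv.restr s
            open_source := Φ.open_source.inter hs
            open_target := Φ.continuousOn_symm.isOpen_inter_preimage Φ.open_target hs
            contMDiffOn_toFun := (hf.mono Set.inter_subset_right).contMDiffOn
            contMDiffOn_invFun := ContDiffOn.contMDiffOn fun z hz => ?_ },
    ⟨hxΦ, hx⟩, fun y hy => rfl⟩
  obtain ⟨B, hB⟩ := hd _ hz.2
  exact (Φ.contDiffAt_symm hz.1 hB (hat _ hz.2)).contDiffWithinAt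

end Cotangents

/-! ### The Legendre map in coordinates. -/

section FlatLegendreMap

variable {E : Type*} [NormedAddCommGroup E] [NormedSpace ℝ E]

/-- The section `(q₀, …, q_r, z) ↦ (q₀, …, q_r, 0, …, 0, z)` of `trunc`. -/
def extendZero (E : Type*) [NormedAddCommGroup E] [NormedSpace ℝ E] (r s : ℕ) :
    JetSp E r →L[ℝ] JetSp E s :=
  ((ContinuousLinearMap.pi fun α : Fin (s + 1) =>
    if h : (α : ℕ) < r + 1 then ContinuousLinearMap.proj (R := ℝ) (φ := fun _ : Fin (r + 1) => E)
      ⟨α, h⟩ else 0).comp (ContinuousLinearMap.fst ℝ _ ℝ)).prod (ContinuousLinearMap.snd ℝ _ ℝ)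

theorem extendZero_apply (r s : ℕ) (x : JetSp E r) : extendZero E r s x =
    (fun α : Fin (s + 1) => if h : (α : ℕ) < r + 1 then x.1 ⟨α, h⟩ else 0, x.2) := by
  refine Prod.ext (funext fun α => ?_) rfl
  change (dite ((α : ℕ) < r + 1) _ _ : (Fin (r + 1) → E) →L[ℝ] E) x.1 =
    if h : (α : ℕ) < r + 1 then x.1 ⟨α, h⟩ else 0
  split_ifs <;> rfl

theorem trunc_extendZero {r s : ℕ} (h : r ≤ s) (x : JetSp E r) :
    trunc h (extendZero E r s x) = x := by
  rw [extendZero_apply, trunc_apply]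
  exact Prod.ext (funext fun α => dif_pos α.2) rfl

theorem extendZero_cv {r s a : ℕ} (h : a ≤ r) (v : E) :
    extendZero E r s (cv E r a v) = cv E s a v := by
  rw [extendZero_apply, cv_apply, cv_apply]
  refine Prod.ext (funext fun α => ?_) rfl
  by_cases hα : (α : ℕ) < r + 1
  · simp [hα]
  · have : (α : ℕ) ≠ a := by omega
    simp [hα, this]

variable {n k : ℕ} {V : Set (Euc n)} {ℓ : JetSp (Euc n) k → ℝ} {y : JetSp (Euc n) (2 * k - 1)}

/-- Extending by zero after truncation alters only the coordinates `q_a` with `a ≥ k`, which `A`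
ignores; a semibasic covector therefore factors through the projection. -/
theorem semibasic_extendZero (h : k - 1 ≤ 2 * k - 1) (A : JetSp (Euc n) (2 * k - 1) →L[ℝ] ℝ)
    (hA : ∀ a, k ≤ a → ∀ v, A (cv _ (2 * k - 1) a v) = 0)
    (u : JetSp (Euc n) (2 * k - 1)) : A (extendZero _ _ _ (trunc h u)) = A u := by
  suffices H : A.comp ((extendZero (Euc n) (k - 1) (2 * k - 1)).comp (trunc h)) = A from
    congrArg (fun B : JetSp (Euc n) (2 * k - 1) →L[ℝ] ℝ => B u) H
  refine ext_cv (fun a ha v => ?_) ?_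
  · rw [ContinuousLinearMap.comp_apply, ContinuousLinearMap.comp_apply, trunc_cv]
    by_cases hak : a ≤ k - 1
    · rw [extendZero_cv hak]
    · rw [cv_of_lt (E := Euc n) (show k - 1 < a by omega), hA a (by omega)]
      simp
  · rw [ContinuousLinearMap.comp_apply, ContinuousLinearMap.comp_apply, trunc_apply,
      extendZero_apply]
    refine congrArg A ?_
    refine Prod.ext (funext fun α => ?_) rfl
    simp

/-- The inclusion of the coordinates `q₀, …, q_{k-1}`; composing a covector with it gives its momenta
`(p⁰, …, p^{k-1})`. -/
def momentum (n k : ℕ) : (Fin (k - 1 + 1) → Euc n) →L[ℝ] JetSp (Euc n) (2 * k - 1) :=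
  (extendZero (Euc n) (k - 1) (2 * k - 1)).comp (ContinuousLinearMap.inl ℝ _ ℝ)

/-- The coordinate expression of the Legendre map. -/
def flatLegendre (ℓ : JetSp (Euc n) k → ℝ) (y : JetSp (Euc n) (2 * k - 1)) :
    ((Fin (k - 1 + 1) → Euc n) × ((Fin (k - 1 + 1) → Euc n) →L[ℝ] ℝ)) × ℝ :=
  (((trunc (show k - 1 ≤ 2 * k - 1 by omega) y).1, (flatTheta ℓ y).comp (momentum n k)), y.2)

theorem contDiffOn_flatLegendre (hV : IsOpen V) (hℓ : ContDiffOn ℝ ∞ ℓ (dom V k)) :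
    ContDiffOn ℝ ∞ (flatLegendre ℓ) (dom V (2 * k - 1)) := by
  refine ContDiffOn.prodMk (ContDiffOn.prodMk ?_ ?_) contDiff_snd.contDiffOn
  · exact (contDiff_fst.comp (trunc (E := Euc n) _).contDiff).contDiffOn
  · exact (contDiffOn_flatTheta hV hℓ).clm_comp contDiffOn_const

theorem fderiv_flatLegendre (hV : IsOpen V) (hℓ : ContDiffOn ℝ ∞ ℓ (dom V k))
    (hy : y ∈ dom V (2 * k - 1)) (u : JetSp (Euc n) (2 * k - 1)) :
    fderiv ℝ (flatLegendre ℓ) y u = (((trunc (show k - 1 ≤ 2 * k - 1 by omega) u).1,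
      (fderiv ℝ (flatTheta ℓ) y u).comp (momentum n k)), u.2) := by
  have h1 : HasFDerivAt (fun y : JetSp (Euc n) (2 * k - 1) =>
      (trunc (show k - 1 ≤ 2 * k - 1 by omega) y).1) ((ContinuousLinearMap.fst ℝ _ ℝ).comp
        (trunc (E := Euc n) (show k - 1 ≤ 2 * k - 1 by omega))) y :=
    ((ContinuousLinearMap.fst ℝ _ ℝ).comp (trunc (E := Euc n) _)).hasFDerivAt
  have h2 := ((ContinuousLinearMap.compL ℝ (Fin (k - 1 + 1) → Euc n)
    (JetSp (Euc n) (2 * k - 1)) ℝ).flip (momentum n k)).hasFDerivAt.comp y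
      (differentiableAt_flatTheta hV hℓ hy).hasFDerivAt
  have h3 := (h1.prodMk h2).prodMk (hasFDerivAt_snd (p := y))
  exact congrArg (fun A : JetSp (Euc n) (2 * k - 1) →L[ℝ] _ => A u) h3.fderiv

/-- The differential has components `dq_a`, `dθ_a` (`a < k`) and `dz`, whose common kernel is the
one `MomentaRegular` requires to be zero. -/
theorem fderiv_flatLegendre_injective_iff (hk : 1 ≤ k) (hV : IsOpen V)
    (hℓ : ContDiffOn ℝ ∞ ℓ (dom V k)) (hy : y ∈ dom V (2 * k - 1)) :
    (∀ u, fderiv ℝ (flatLegendre ℓ) y u = 0 → u = 0) ↔ MomentaRegular ℓ y := by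
  have hm : ∀ a < k, ∀ v, momentum n k (cv (Euc n) (k - 1) a v).1 = cv _ (2 * k - 1) a v := by
    intro a ha v
    exact extendZero_cv (show a ≤ k - 1 by omega) v
  constructor
  · intro h u hu hz hθ
    refine h u ?_
    rw [fderiv_flatLegendre hV hℓ hy]
    refine Prod.ext (Prod.ext (funext fun α => hu _ ?_) ?_) hz
    · simp only [Fin.val_castLE]
      omega
    · refine ContinuousLinearMap.ext fun x => ?_
      have hx : momentum n k x = ∑ α : Fin (k - 1 + 1), cv _ (2 * k - 1) α (x α) := by
        have h1 := eq_sum_cv ((x, 0) : JetSp (Euc n) (k - 1))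
        have h2 : ((0 : Fin (k - 1 + 1) → Euc n), (0 : ℝ)) = 0 := rfl
        simp only [h2, add_zero] at h1
        change extendZero (Euc n) (k - 1) (2 * k - 1) (x, 0) = _
        rw [h1, map_sum]
        exact Finset.sum_congr rfl fun α _ => extendZero_cv (Nat.lt_succ_iff.1 α.2) _
      change fderiv ℝ (flatTheta ℓ) y u (momentum n k x) = 0
      rw [hx, map_sum]
      exact Finset.sum_eq_zero fun α _ => hθ _ (by omega) _
  · intro h u hu
    rw [fderiv_flatLegendre hV hℓ hy] at hu
    have h1 := congrArg (fun x => x.1.1) hu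
    have h2 := congrArg (fun x => x.1.2) hu
    have h3 := congrArg (fun x => x.2) hu
    refine h u (fun α hα => ?_) h3 fun a ha v => ?_
    · exact congrFun h1 ⟨α, by omega⟩
    · rw [← hm a ha v]
      exact congrArg (fun A : (Fin (k - 1 + 1) → Euc n) →L[ℝ] ℝ => A (cv (Euc n) (k - 1) a v).1) h2

theorem finrank_jetSp (n r : ℕ) : Module.finrank ℝ (JetSp (Euc n) r) = (r + 1) * n + 1 := by
  simp [Module.finrank_prod, Module.finrank_pi_fintype]

theorem finrank_legendre_target (hk : 1 ≤ k) : Module.finrank ℝ (JetSp (Euc n) (2 * k - 1)) =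
    Module.finrank ℝ
      (((Fin (k - 1 + 1) → Euc n) × ((Fin (k - 1 + 1) → Euc n) →L[ℝ] ℝ)) × ℝ) := by
  have h : Module.finrank ℝ ((Fin (k - 1 + 1) → Euc n) →L[ℝ] ℝ) =
      Module.finrank ℝ (Fin (k - 1 + 1) → Euc n) := by
    rw [← (LinearMap.toContinuousLinearMap (𝕜 := ℝ) (E := Fin (k - 1 + 1) → Euc n)
      (F' := ℝ)).finrank_eq, Module.finrank_linearMap_self]
  rw [finrank_jetSp, Module.finrank_prod, Module.finrank_prod, h]
  obtain ⟨j, rfl⟩ : ∃ j, k = j + 1 := ⟨k - 1, by omega⟩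
  simp only [Nat.add_sub_cancel, Module.finrank_pi_fintype, finrank_euclideanSpace, Fintype.card_fin,
    Finset.sum_const, Finset.card_univ, smul_eq_mul, Module.finrank_self]
  rw [show 2 * (j + 1) - 1 + 1 = (j + 1) + (j + 1) by omega]
  ring

end FlatLegendreMap

/-! ### The Hessian matrix and the Hessian form. -/

section Hessian

variable {n k : ℕ} {Q : Type*} [TopologicalSpace Q] [ChartedSpace (Euc n) Q]
  [IsManifold (𝓡 n) ∞ Q] {e : OpenPartialHomeomorph Q (Euc n)}

theorem hasFDerivAt_update_last (q : Fin (k + 1) → Euc n) (z : ℝ) (v : Euc n) :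
    HasFDerivAt (fun v : Euc n => ((Function.update q (Fin.last k) v, z) : JetSp (Euc n) k))
      (cv (Euc n) k k) v := by
  have h : (fun v : Euc n => ((Function.update q (Fin.last k) v, z) : JetSp (Euc n) k)) =
      fun v => cv (Euc n) k k v + (Function.update q (Fin.last k) 0, z) := by
    funext v
    rw [cv_apply]
    refine Prod.ext (funext fun α => ?_) (by simp)
    by_cases hα : α = Fin.last k
    · subst hα; simp
    · have : (α : ℕ) ≠ k := fun h => hα (Fin.ext h)
      simp [hα, this]
  rw [h]
  exact (cv (Euc n) k k).hasFDerivAt.add_const _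

theorem hessian_apply (he : e ∈ smoothCharts n Q) {L : HTan n k Q × ℝ → ℝ}
    (hL : ContMDiff (extModel n k) 𝓘(ℝ, ℝ) ∞ L) {q : Fin (k + 1) → Euc n} (z : ℝ)
    (hq : q 0 ∈ e.target) (i j : Fin n) :
    hessian L e q z i j = topHess (coordFun e L) (q, z) (EuclideanSpace.single i 1)
      (EuclideanSpace.single j 1) := by
  have hV := e.open_target
  have hℓ := contDiffOn_coordFun he hL
  set U : Euc n → JetSp (Euc n) k := fun v => (Function.update q (Fin.last k) v, z) with hU
  have hU0 : U (q (Fin.last k)) = (q, z) := by simp [hU]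
  have hUd := hasFDerivAt_update_last q z
  have hmem : ∀ᶠ v in 𝓝 (q (Fin.last k)), U v ∈ dom e.target k := by
    refine (hUd _).continuousAt.preimage_mem_nhds ((isOpen_dom hV k).mem_nhds ?_)
    change U (q (Fin.last k)) ∈ _
    rw [hU0]
    exact hq
  have h1 : (fun w : Euc n => fderiv ℝ (fun v : Euc n =>
      L (ofNatCoord k e (Function.update q (Fin.last k) v), z)) w (EuclideanSpace.single j 1))
      =ᶠ[𝓝 (q (Fin.last k))] fun w => fderiv ℝ (coordFun e L) (U w)
        (cv (Euc n) k k (EuclideanSpace.single j 1)) := by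
    filter_upwards [hmem] with w hw
    have h2 := (differentiableAt_of_dom hV hℓ hw).hasFDerivAt.comp w (hUd w)
    exact congrArg (fun A : Euc n →L[ℝ] ℝ => A (EuclideanSpace.single j 1)) h2.fderiv
  have h3 : DifferentiableAt ℝ (fun x => fderiv ℝ (coordFun e L) x
      (cv (Euc n) k k (EuclideanSpace.single j 1))) (U (q (Fin.last k))) := by
    rw [hU0]
    exact (differentiableAt_of_dom (V := e.target) hV (contDiffOn_fderiv hV hℓ) hq).clm_apply
      (differentiableAt_const _)
  have h4 := h3.hasFDerivAt.comp _ (hUd (q (Fin.last k)))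
  rw [hU0] at h4
  rw [hessian, Matrix.of_apply, h1.fderiv_eq]
  exact congrArg (fun A : Euc n →L[ℝ] ℝ => A (EuclideanSpace.single i 1)) h4.fderiv

theorem topHess_eq {V : Set (Euc n)} (hV : IsOpen V) {ℓ : JetSp (Euc n) k → ℝ}
    (hℓ : ContDiffOn ℝ ∞ ℓ (dom V k)) {x : JetSp (Euc n) k} (hx : x ∈ dom V k) (w v : Euc n) :
    topHess ℓ x w v = fderiv ℝ (fderiv ℝ ℓ) x (cv (Euc n) k k w) (cv (Euc n) k k v) := by
  have hd : DifferentiableAt ℝ (fderiv ℝ ℓ) x :=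
    differentiableAt_of_dom hV (contDiffOn_fderiv hV hℓ) hx
  rw [topHess, fderiv_clm_apply hd (differentiableAt_const _)]
  simp

/-- A singular matrix has a left null vector, and left multiplication by `w` gives the coordinates
of the functional `topHess w`. Bilinearity comes from `topHess_eq`. -/
theorem det_hessian_ne_zero_iff (he : e ∈ smoothCharts n Q) {L : HTan n k Q × ℝ → ℝ}
    (hL : ContMDiff (extModel n k) 𝓘(ℝ, ℝ) ∞ L) {q : Fin (k + 1) → Euc n} (z : ℝ)
    (hq : q 0 ∈ e.target) :
    (hessian L e q z).det ≠ 0 ↔ TopRegular (coordFun e L) (q, z) := by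
  have hsum : ∀ v : Euc n, v = ∑ i, v i • EuclideanSpace.single i (1 : ℝ) := fun v => by
    ext i; simp [Pi.single_apply]
  have hV := e.open_target
  have hℓ := contDiffOn_coordFun he hL
  have hB := topHess_eq (x := (q, z)) hV hℓ hq
  have h1 : ∀ w v : Euc n, topHess (coordFun e L) (q, z) w v =
      ∑ j, v j * topHess (coordFun e L) (q, z) w (EuclideanSpace.single j 1) := by
    intro w v
    simp only [hB]
    conv_lhs => rw [hsum v, map_sum, map_sum]
    simp
  have h2 : ∀ (w : Euc n) (j : Fin n), Matrix.vecMul w (hessian L e q z) j =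
      topHess (coordFun e L) (q, z) w (EuclideanSpace.single j 1) := by
    intro w j
    simp only [Matrix.vecMul, dotProduct, hessian_apply he hL z hq, hB]
    conv_rhs => rw [hsum w, map_sum, map_sum, sum_apply]
    simp
  rw [ne_eq, ← Matrix.exists_vecMul_eq_zero_iff, TopRegular]
  constructor
  · intro h w hw
    by_contra hne
    refine h ⟨w, fun h0 => hne (by ext i; exact congrFun h0 i), funext fun j => ?_⟩
    rw [h2, hw]
    rfl
  · rintro h ⟨w, hne, hw⟩
    have h3 := h (WithLp.toLp 2 w) fun v => by
      rw [h1]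
      refine Finset.sum_eq_zero fun j _ => ?_
      rw [← h2]
      exact mul_eq_zero_of_right _ (congrFun hw j)
    exact hne (congrArg WithLp.ofLp h3)

end Hessian

/-! ### The Legendre map and the contact form in bundle charts. -/

section LegendreCoord

variable {n k : ℕ} {Q : Type*} [TopologicalSpace Q] [ChartedSpace (Euc n) Q]
  [IsManifold (𝓡 n) ∞ Q] {e : OpenPartialHomeomorph Q (Euc n)}

theorem dChart_injective {r : ℕ} (he : e ∈ smoothCharts n Q) {p : HTan n r Q × ℝ}
    (hp : p ∈ overChart r e) {u v : TangentSpace (extModel n r) p}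
    (h : dChart r e p u = dChart r e p v) : u = v := by
  have h1 := dSymm_dChart he hp u
  have h2 := dSymm_dChart he hp v
  rw [h] at h1
  exact h1.symm.trans h2

theorem exists_dChart_eq {r : ℕ} (he : e ∈ smoothCharts n Q) {p : HTan n r Q × ℝ}
    (hp : p ∈ overChart r e) (u : JetSp (Euc n) r) :
    ∃ v : TangentSpace (extModel n r) p, dChart r e p v = u := by
  have h : ∀ q : HTan n r Q × ℝ, q = p →
      (∃ v : TangentSpace (extModel n r) q, dChart r e q v = u) →
      ∃ v : TangentSpace (extModel n r) p, dChart r e p v = u := by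
    rintro q rfl h; exact h
  exact h _ (jetChartSymm_jetChart he hp) ⟨_, dChart_dSymm he (jetChart_mem he hp) u⟩

theorem dChart_dSymm_jetChart {r : ℕ} (he : e ∈ smoothCharts n Q) {p : HTan n r Q × ℝ}
    (hp : p ∈ overChart r e) (u : JetSp (Euc n) r) :
    (dChart r e p : JetSp (Euc n) r →L[ℝ] JetSp (Euc n) r)
      (dSymm (Q := Q) r e (jetChart r e p) u) = u := by
  have h : ∀ q : HTan n r Q × ℝ, q = p → ∀ w : JetSp (Euc n) r,
      (dChart r e q : JetSp (Euc n) r →L[ℝ] JetSp (Euc n) r) w =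
      (dChart r e p : JetSp (Euc n) r →L[ℝ] JetSp (Euc n) r) w := by
    rintro q rfl w; rfl
  exact (h _ (jetChartSymm_jetChart he hp) _).symm.trans
    (dChart_dSymm he (jetChart_mem he hp) u)

/-- The chosen covector is meaningful because one exists, `θ` precomposed with the zero extension,
by semibasicity. It is determined by its defining property because the projection is a submersion:
every `v` is the image of its zero extension. -/
theorem extLegendre_snd_apply (he : e ∈ smoothCharts n Q) {L : HTan n k Q × ℝ → ℝ}
    (hL : ContMDiff (extModel n k) 𝓘(ℝ, ℝ) ∞ L) {p : HTan n (2 * k - 1) Q × ℝ}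
    (hp : p ∈ overChart (2 * k - 1) e) (h : k - 1 ≤ 2 * k - 1)
    (v : TangentSpace (extModel n (k - 1)) (extProj h p)) :
    (extLegendre L p).snd v = flatTheta (coordFun e L) (jetChart (2 * k - 1) e p)
      (extendZero _ _ _ (dChart (k - 1) e (extProj h p) v)) := by
  have hV := e.open_target
  have hℓ := contDiffOn_coordFun he hL
  have hp' : extProj h p ∈ overChart (k - 1) e := (extProj_mem_over h).2 hp
  have hspec : ∀ u, cartanForm L p u = (extLegendre L p).snd
      (mfderiv (extModel n (2 * k - 1)) (extModel n (k - 1)) (extProj h) p u) := by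
    refine Classical.epsilon_spec (p := fun l :
      TangentSpace (extModel n (k - 1)) (extProj h p) →L[ℝ] ℝ => ∀ u, cartanForm L p u =
      l (mfderiv (extModel n (2 * k - 1)) (extModel n (k - 1)) (extProj h) p u))
      ⟨((flatTheta (coordFun e L) (jetChart (2 * k - 1) e p)).comp (extendZero _ _ _)).comp
        (dChart (k - 1) e (extProj h p)), fun u => ?_⟩
    rw [ContinuousLinearMap.comp_apply, ContinuousLinearMap.comp_apply,
      dChart_mfderiv_extProj h he hp, semibasic_extendZero h _ (fun a ha v =>
        flatTheta_cv_eq_zero hV hℓ (jetChart_mem he hp) ha v), cartanForm_apply he hL hp]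
  obtain ⟨u, hu⟩ := exists_dChart_eq he hp (extendZero _ _ _ (dChart (k - 1) e (extProj h p) v))
  have huv : mfderiv (extModel n (2 * k - 1)) (extModel n (k - 1)) (extProj h) p u = v := by
    refine dChart_injective he hp' ?_
    rw [dChart_mfderiv_extProj h he hp, hu, trunc_extendZero]
  rw [← hu, ← cartanForm_apply he hL hp, hspec u, huv]

/-- Needed because the Legendre map restricts the covector on `T^{k-1}Q × ℝ` to the factor
`T^{k-1}Q`: in the product chart, directions tangent to that factor stay tangent to it. -/
theorem dSymm_inl {r : ℕ} (he : e ∈ smoothCharts n Q) {y : JetSp (Euc n) r}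
    (hy : y ∈ dom e.target r) (w : Fin (r + 1) → Euc n) :
    dSymm (Q := Q) r e y (w, 0) =
      (mfderiv 𝓘(ℝ, Fin (r + 1) → Euc n) (jetModel n r) (ofNatCoord r e : _ → HTan n r Q) y.1 w,
        (0 : ℝ)) := by
  have hd : MDifferentiableAt 𝓘(ℝ, Fin (r + 1) → Euc n) (jetModel n r)
      (ofNatCoord r e : _ → HTan n r Q) y.1 :=
    ((contMDiffOn_ofNatCoord r he).contMDiffAt
      ((natHomeo r he).open_target.mem_nhds hy)).mdifferentiableAt (by simp)
  have hfst : MDifferentiableAt 𝓘(ℝ, JetSp (Euc n) r) 𝓘(ℝ, Fin (r + 1) → Euc n)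
      (Prod.fst : JetSp (Euc n) r → _) y := differentiableAt_fst.mdifferentiableAt
  have hsnd : MDifferentiableAt 𝓘(ℝ, JetSp (Euc n) r) 𝓘(ℝ, ℝ)
      (Prod.snd : JetSp (Euc n) r → _) y := differentiableAt_snd.mdifferentiableAt
  have h1 := mfderiv_prodMk (MDifferentiableAt.comp y hd hfst) hsnd
  have h2 := mfderiv_comp y hd hfst
  have h3 : mfderiv 𝓘(ℝ, JetSp (Euc n) r) 𝓘(ℝ, Fin (r + 1) → Euc n)
      (Prod.fst : JetSp (Euc n) r → _) y =
      (ContinuousLinearMap.fst ℝ (Fin (r + 1) → Euc n) ℝ :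
        JetSp (Euc n) r →L[ℝ] Fin (r + 1) → Euc n) := by
    rw [mfderiv_eq_fderiv]; exact fderiv_fst
  have h4 : mfderiv 𝓘(ℝ, JetSp (Euc n) r) 𝓘(ℝ, ℝ)
      (Prod.snd : JetSp (Euc n) r → _) y =
      (ContinuousLinearMap.snd ℝ (Fin (r + 1) → Euc n) ℝ : JetSp (Euc n) r →L[ℝ] ℝ) := by
    rw [mfderiv_eq_fderiv]; exact fderiv_snd
  rw [h3] at h2
  rw [h2, h4] at h1
  exact congrArg (fun A : JetSp (Euc n) r →L[ℝ] JetSp (Euc n) r => A (w, 0)) h1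

/-- The Legendre map in natural coordinates. -/
theorem extChartAt_legendre {L : HTan n k Q × ℝ → ℝ}
    (hL : ContMDiff (extModel n k) 𝓘(ℝ, ℝ) ∞ L) (p : HTan n (2 * k - 1) Q × ℝ)
    (he₀ : e = chartAt (Euc n) (legendre L p).1.proj.base)
    {p' : HTan n (2 * k - 1) Q × ℝ} (hp' : p' ∈ overChart (2 * k - 1) e) :
    extChartAt (cotModel n (k - 1)) (legendre L p) (legendre L p') =
      flatLegendre (coordFun e L) (jetChart (2 * k - 1) e p') := by
  have h : k - 1 ≤ 2 * k - 1 := by omega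
  subst he₀
  set b := (legendre L p).1.proj with hb
  have he := chart_smooth (n := n) b.base
  have hq : extProj h p' ∈ overChart (k - 1) (chartAt (Euc n) b.base) :=
    (extProj_mem_over h).2 hp'
  have h1 := hom_chart (HB := Fin (k - 1 + 1) → Euc n) (legendre L p).1 (legendre L p').1
  refine Prod.ext ((show (extChartAt (cotModel n (k - 1)) (legendre L p) (legendre L p')).1 =
    chartAt (ModelProd (Fin (k - 1 + 1) → Euc n) ((Fin (k - 1 + 1) → Euc n) →L[ℝ] ℝ))
      (legendre L p).1 (legendre L p').1 from rfl).trans (h1.trans (Prod.ext ?_ ?_))) rfl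
  · have h2 := congrArg Prod.fst (jetChart_extProj h he hp')
    exact h2
  -- The fibre coordinate of the covector is its pullback along the inverse chart of `T^{k-1}Q`;
  -- padding with a zero `z`-component turns this into a value of `extLegendre`.
  · refine (inCoordinates_cotangent (I := jetModel n (k - 1)) (x₀ := b)
      (x := (legendre L p').1.proj) hq _).trans ?_
    refine ContinuousLinearMap.ext fun w => ?_
    have h2 := dSymm_inl he (jetChart_mem he hq) w
    have h3 := extLegendre_snd_apply he hL hp' h (dSymm (Q := Q) (k - 1) (chartAt (Euc n) b.base)
      (jetChart (k - 1) (chartAt (Euc n) b.base) (extProj h p')) (w, 0))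
    have h4 := dChart_dSymm_jetChart he hq (w, 0)
    refine Eq.trans ?_ (h3.trans (congrArg (fun u => flatTheta _ _ (extendZero _ _ _ u)) h4))
    exact (congrArg (fun u : JetSp (Euc n) (k - 1) =>
      ((extLegendre L p').snd : JetSp (Euc n) (k - 1) →L[ℝ] ℝ) u) h2).symm

theorem contMDiff_contactForm {L : HTan n k Q × ℝ → ℝ}
    (hL : ContMDiff (extModel n k) 𝓘(ℝ, ℝ) ∞ L) :
    ContMDiff (extModel n (2 * k - 1))
      ((extModel n (2 * k - 1)).prod 𝓘(ℝ, JetSp (Euc n) (2 * k - 1) →L[ℝ] ℝ)) ∞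
      (fun p => (⟨p, contactForm L p⟩ :
        Cotangent (extModel n (2 * k - 1)) (HTan n (2 * k - 1) Q × ℝ))) := by
  intro p
  have he := chart_smooth (n := n) p.1.base
  have hp := mem_over_chartAt p
  refine (contMDiffAt_hom_bundle _).2 ⟨contMDiffAt_id, ?_⟩
  have h1 : ContMDiffAt (extModel n (2 * k - 1)) 𝓘(ℝ, JetSp (Euc n) (2 * k - 1) →L[ℝ] ℝ) ∞
      (fun q => flatEta (coordFun (chartAt (Euc n) p.1.base) L)
        (jetChart (2 * k - 1) (chartAt (Euc n) p.1.base) q)) p := by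
    refine ContMDiffAt.comp (g := flatEta (coordFun (chartAt (Euc n) p.1.base) L)) p
      (ContDiffAt.contMDiffAt ?_)
      ((contMDiffOn_jetChart _ he).contMDiffAt ((isOpen_overChart _ he).mem_nhds hp))
    exact ((contDiffOn_flatEta (chartAt (Euc n) p.1.base).open_target
      (contDiffOn_coordFun he hL)) _ (jetChart_mem he hp)).contDiffAt
        ((isOpen_dom_target _ _).mem_nhds (jetChart_mem he hp))
  refine h1.congr_of_eventuallyEq ?_
  filter_upwards [(isOpen_overChart _ he).mem_nhds hp] with q hq
  refine (inCoordinates_cotangent (I := extModel n (2 * k - 1)) (x₀ := p) (x := q) ?_ _).trans ?_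
  · exact ⟨hq, trivial⟩
  · refine ContinuousLinearMap.ext fun u => ?_
    have h2 := contactForm_apply he hL hq (dSymm (Q := Q) (2 * k - 1) (chartAt (Euc n) p.1.base)
      (jetChart (2 * k - 1) (chartAt (Euc n) p.1.base) q) u)
    exact h2.trans (congrArg (flatEta _ _) (dChart_dSymm_jetChart he hq u))

end LegendreCoord

/-! ### The implications between the three conditions. -/

section Equivalences

variable {n k : ℕ} {Q : Type*} [TopologicalSpace Q] [ChartedSpace (Euc n) Q]
  [IsManifold (𝓡 n) ∞ Q] {e : OpenPartialHomeomorph Q (Euc n)} {L : HTan n k Q × ℝ → ℝ}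

theorem legendre_base (p : HTan n (2 * k - 1) Q × ℝ) :
    (legendre L p).1.proj.base = p.1.base :=
  proj_base (show k - 1 ≤ 2 * k - 1 by omega) p.1

theorem legendre_mem_source {p p' : HTan n (2 * k - 1) Q × ℝ}
    (hp' : p' ∈ overChart (2 * k - 1) (chartAt (Euc n) p.1.base)) :
    legendre L p' ∈ (extChartAt (cotModel n (k - 1)) (legendre L p)).source := by
  have h1 : (legendre L p').1.proj ∈ (chartAt (Fin (k - 1 + 1) → Euc n)
      (legendre L p).1.proj).source := by
    change (legendre L p').1.proj.base ∈ (chartAt (Euc n) (legendre L p).1.proj.base).source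
    rw [legendre_base, legendre_base]
    exact hp'
  have h2 : (legendre L p').1 ∈ (chartAt (ModelProd (Fin (k - 1 + 1) → Euc n)
      ((Fin (k - 1 + 1) → Euc n) →L[ℝ] ℝ)) (legendre L p).1).source := by
    rw [FiberBundle.chartedSpace_chartAt]
    simp only [mfld_simps]
    exact ⟨⟨h1, trivial⟩, h1⟩
  rw [extChartAt_source]
  exact ⟨h2, trivial⟩

/-- Over the domain of a chart around the base point the Legendre map is a chart, followed by
`flatLegendre`, followed by an inverse chart; the inverse function theorem handles the middle
factor. -/
theorem isLocalDiffeomorph_legendre_of_momentaRegular (hk : 1 ≤ k)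
    (hL : ContMDiff (extModel n k) 𝓘(ℝ, ℝ) ∞ L)
    (h : ∀ e ∈ smoothCharts n Q, ∀ y ∈ dom e.target (2 * k - 1), MomentaRegular (coordFun e L) y) :
    IsLocalDiffeomorph (extModel n (2 * k - 1)) (cotModel n (k - 1)) ∞ (legendre L) := by
  intro p
  set e := chartAt (Euc n) p.1.base with he₀
  have he := chart_smooth (n := n) p.1.base
  have hp := mem_over_chartAt p
  have he₁ : e = chartAt (Euc n) (legendre L p).1.proj.base := by rw [legendre_base]
  have hV := e.open_target
  have hℓ := contDiffOn_coordFun he hL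
  have hy := jetChart_mem he hp
  have h1 : IsLocalDiffeomorphAt (extModel n (2 * k - 1)) 𝓘(ℝ, JetSp (Euc n) (2 * k - 1)) ∞
      (jetChart (2 * k - 1) e) p :=
    isLocalDiffeomorphAt_extChartAt (I := extModel n (2 * k - 1)) p (mem_extChartAt_source p)
  have h2 := isLocalDiffeomorphAt_of_fderiv_injective (finrank_legendre_target (n := n) hk)
    (isOpen_dom hV _) (contDiffOn_flatLegendre hV hℓ) hy fun y hy =>
      (fderiv_flatLegendre_injective_iff hk hV hℓ hy).2 (h e he y hy)
  have hval := extChartAt_legendre hL p he₁ (p' := p) hp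
  have h3 : IsLocalDiffeomorphAt 𝓘(ℝ, ((Fin (k - 1 + 1) → Euc n) ×
      ((Fin (k - 1 + 1) → Euc n) →L[ℝ] ℝ)) × ℝ) (cotModel n (k - 1)) ∞
      (extChartAt (cotModel n (k - 1)) (legendre L p)).symm
      (flatLegendre (coordFun e L) (jetChart (2 * k - 1) e p)) := by
    refine isLocalDiffeomorphAt_extChartAt_symm (I := cotModel n (k - 1)) (legendre L p) ?_
    rw [← hval]
    exact mem_extChartAt_target _
  refine ((h1.comp _ _ h2).comp _ _ h3).congr_of_eqOn (isOpen_overChart _ he) hp fun p' hp' => ?_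
  have h4 := extChartAt_legendre hL p he₁ (p' := p') hp'
  change _ = (extChartAt (cotModel n (k - 1)) (legendre L p)).symm
    (flatLegendre (coordFun e L) (jetChart (2 * k - 1) e p'))
  rw [← h4, (extChartAt (cotModel n (k - 1)) (legendre L p)).left_inv (legendre_mem_source hp')]

/-- The derivative of a local diffeomorphism read in a target chart is invertible and equals the
derivative of `flatLegendre` after `dChart`, which is onto; hence the former has no kernel. -/
theorem momentaRegular_of_isLocalDiffeomorph (hk : 1 ≤ k)
    (hL : ContMDiff (extModel n k) 𝓘(ℝ, ℝ) ∞ L)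
    (h : IsLocalDiffeomorph (extModel n (2 * k - 1)) (cotModel n (k - 1)) ∞ (legendre L))
    (p : HTan n (2 * k - 1) Q × ℝ) :
    MomentaRegular (coordFun (chartAt (Euc n) p.1.base) L)
      (jetChart (2 * k - 1) (chartAt (Euc n) p.1.base) p) := by
  set e := chartAt (Euc n) p.1.base with he₀
  have he := chart_smooth (n := n) p.1.base
  have hp := mem_over_chartAt p
  have he₁ : e = chartAt (Euc n) (legendre L p).1.proj.base := by rw [legendre_base]
  have hV := e.open_target
  have hℓ := contDiffOn_coordFun he hL
  have hy := jetChart_mem he hp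
  refine (fderiv_flatLegendre_injective_iff hk hV hℓ hy).1 fun u hu => ?_
  have h1 := (h p).comp _ _ (isLocalDiffeomorphAt_extChartAt (I := cotModel n (k - 1)) (legendre L p)
    (mem_extChartAt_source _))
  have h2 : extChartAt (cotModel n (k - 1)) (legendre L p) ∘ legendre L =ᶠ[𝓝 p]
      flatLegendre (coordFun e L) ∘ jetChart (2 * k - 1) e :=
    Filter.eventuallyEq_of_mem ((isOpen_overChart _ he).mem_nhds hp) fun p' hp' =>
      extChartAt_legendre hL p he₁ hp'
  have h3 := mfderiv_comp p (differentiableAt_of_dom hV (contDiffOn_flatLegendre hV hℓ)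
    hy).mdifferentiableAt (mdifferentiableAt_jetChart he hp)
  rw [mfderiv_eq_fderiv] at h3
  have h4 := (h2.mfderiv_eq (I := extModel n (2 * k - 1))).trans h3
  obtain ⟨v, rfl⟩ := exists_dChart_eq he hp u
  have h5 : mfderiv (extModel n (2 * k - 1)) 𝓘(ℝ, ((Fin (k - 1 + 1) → Euc n) ×
      ((Fin (k - 1 + 1) → Euc n) →L[ℝ] ℝ)) × ℝ)
      (extChartAt (cotModel n (k - 1)) (legendre L p) ∘ legendre L) p v = 0 := by
    rw [h4]
    exact hu
  have h6 : v = 0 := (h1.mfderivToContinuousLinearEquiv (by simp)).map_eq_zero_iff.1 h5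
  rw [h6, map_zero]

theorem isContactManifold_of_momentaRegular (hk : 1 ≤ k)
    (hL : ContMDiff (extModel n k) 𝓘(ℝ, ℝ) ∞ L)
    (h : ∀ p : HTan n (2 * k - 1) Q × ℝ,
      MomentaRegular (coordFun (chartAt (Euc n) p.1.base) L)
        (jetChart (2 * k - 1) (chartAt (Euc n) p.1.base) p)) :
    IsContactManifold (extModel n (2 * k - 1)) (k * n) (contactForm L) := by
  have hfin : Module.finrank ℝ (JetSp (Euc n) (2 * k - 1)) = 2 * (k * n) + 1 := by
    rw [finrank_jetSp, show 2 * k - 1 + 1 = 2 * k by omega, mul_assoc]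
  refine ⟨hfin, contMDiff_contactForm hL, fun p => ?_⟩
  have he := chart_smooth (n := n) p.1.base
  have hp := mem_over_chartAt p
  obtain ⟨E, F, hEF, hinj⟩ := exists_coords_of_momentaRegular
    (chartAt (Euc n) p.1.base).open_target (contDiffOn_coordFun he hL) (jetChart_mem he hp) (h p)
  have : FiniteDimensional ℝ (TangentSpace (extModel n (2 * k - 1)) p) :=
    inferInstanceAs (FiniteDimensional ℝ (JetSp (Euc n) (2 * k - 1)))
  have hfin' : Module.finrank ℝ (TangentSpace (extModel n (2 * k - 1)) p) = 2 * (k * n) + 1 := hfin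
  refine exists_wedgePow_ne_zero hfin' (fun j => (E j).comp (dChart _ (chartAt (Euc n) p.1.base) p))
    (fun j => (F j).comp (dChart _ (chartAt (Euc n) p.1.base) p)) (fun u w => ?_) fun u hη hE hF => ?_
  · rw [extD_contactForm he hL hp, hEF]
    rfl
  · rw [contactForm_apply he hL hp] at hη
    exact dChart_injective he hp ((hinj _ hη hE hF).trans (map_zero _).symm)

theorem topRegular_of_isContactManifold (hk : 1 ≤ k)
    (hL : ContMDiff (extModel n k) 𝓘(ℝ, ℝ) ∞ L)
    (h : IsContactManifold (extModel n (2 * k - 1)) (k * n) (contactForm L))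
    (he : e ∈ smoothCharts n Q) {x : JetSp (Euc n) k} (hx : x ∈ dom e.target k) :
    TopRegular (coordFun e L) x := by
  intro w hw
  have hV := e.open_target
  have hℓ := contDiffOn_coordFun he hL
  have hk' : k ≤ 2 * k - 1 := by omega
  -- Any lift of `x` would serve: the Hessian at `y` depends only on its projection to order `k`.
  set y := extendZero (Euc n) k (2 * k - 1) x with hydef
  have hxy : trunc hk' y = x := trunc_extendZero hk' x
  have hy : y ∈ dom e.target (2 * k - 1) := by
    rw [← trunc_mem_dom hk', hxy]; exact hx
  have hp := jetChartSymm_mem (Q := Q) he hy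
  have hyp := jetChart_jetChartSymm (Q := Q) he hy
  set p : HTan n (2 * k - 1) Q × ℝ := jetChartSymm (2 * k - 1) e y with hpdef
  obtain ⟨u, hu⟩ := exists_dChart_eq he hp (cv _ (2 * k - 1) (2 * k - 1) w)
  obtain ⟨v, hv⟩ := h.volume p
  have : FiniteDimensional ℝ (TangentSpace (extModel n (2 * k - 1)) p) :=
    inferInstanceAs (FiniteDimensional ℝ (JetSp (Euc n) (2 * k - 1)))
  have hfin : Module.finrank ℝ (TangentSpace (extModel n (2 * k - 1)) p) = 2 * (k * n) + 1 :=
    h.finrank_eq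
  -- The tangent vector with coordinates `w ∂/∂q_{2k-1}` lies in the kernels of both `η_L` and
  -- `dη_L`, so the volume condition annihilates it and with it `w`.
  have hu0 : u = 0 := by
    refine eq_zero_of_wedgePow_ne_zero hfin hv ?_ fun v' => ?_
    · rw [contactForm_apply he hL hp, hu, hyp, flatEta_cv_top hk hV hℓ hy]
    · rw [extD_contactForm he hL hp, hu, hyp]
      exact fderiv_flatTheta_cv_top hk hV hℓ hy (by rw [hxy]; exact hw) _
  rw [hu0, map_zero] at hu
  have h1 := congrFun (congrArg Prod.fst hu) (Fin.last (2 * k - 1))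
  rw [cv_apply] at h1
  simpa using h1.symm

end Equivalences

end HigherContact

end

theorem mainTheorem2 {n k : ℕ} (hk : 1 ≤ k) {Q : Type*} [TopologicalSpace Q]
    [ChartedSpace (EuclideanSpace ℝ (Fin n)) Q] [IsManifold (𝓡 n) ∞ Q]
    (L : HTan n k Q × ℝ → ℝ) (hL : ContMDiff (extModel n k) 𝓘(ℝ, ℝ) ∞ L) :
    [IsLocalDiffeomorph (extModel n (2 * k - 1)) (cotModel n (k - 1)) ∞ (legendre L),
      IsContactManifold (extModel n (2 * k - 1)) (k * n) (contactForm L),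
      ∀ e ∈ smoothCharts n Q, ∀ (q : Fin (k + 1) → EuclideanSpace ℝ (Fin n)) (z : ℝ),
        q 0 ∈ e.target → (hessian L e q z).det ≠ 0].TFAE := by
  tfae_have 1 → 2 := fun h => isContactManifold_of_momentaRegular hk hL
    (momentaRegular_of_isLocalDiffeomorph hk hL h)
  tfae_have 2 → 3 := fun h e he q z hq => (det_hessian_ne_zero_iff he hL z hq).2
    (topRegular_of_isContactManifold hk hL h he hq)
  tfae_have 3 → 1 := fun h => isLocalDiffeomorph_legendre_of_momentaRegular hk hL
    fun e he _ hy => momentaRegular_of_topRegular hk e.open_target (contDiffOn_coordFun he hL) hy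
      ((det_hessian_ne_zero_iff he hL _ hy).1 (h e he _ _ hy))
  tfae_finish
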